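/- All 2-categories are strict. An *icon* $\alpha\colon F\Rightarrow G$ between pseudofunctors $F,G\colon \mathcal{X}\to\mathcal{Y}$ of 2-categories exists only if $Fx=Gx$ for all objects $x$, and then consists of natural transformations $\alpha_{x,y}\colon F_{x,y}\Rightarrow G_{x,y}\colon \mathcal{X}(x,y)\to\mathcal{Y}(Fx,Fy)$ for all objects $x,y$, compatible with the unit and composition constraints of $F$ and $G$. Let $\mathbf{2Cat}_{p,i}$ be the 2-category of small 2-categories, pseudofunctors and icons, and let $\mathbf{2Cat}_{2,i}$ be the 2-category of small 2-categories, 2-functors and icons, with its inclusion $i\colon \mathbf{2Cat}_{2,i}\hookrightarrow\mathbf{2Cat}_{p,i}$. Let $\mathcal{A}$ be a small 2-category. Write $[\mathcal{A},\mathbf{2Cat}_{2,i}]$ for the 2-category of 2-functors, 2-natural transformations and modifications from $\mathcal{A}$ to $\mathbf{2Cat}_{2,i}$, and $\mathrm{Bicat}(\mathcal{A},\mathbf{2Cat}_{p,i})$ for the 2-category of pseudofunctors, pseudonatural transformations and modifications from $\mathcal{A}$ to $\mathbf{2Cat}_{p,i}$. Then the inclusion 2-functor $$J\colon [\mathcal{A},\mathbf{2Cat}_{2,i}]\hookrightarrow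 \mathrm{Bicat}(\mathcal{A},\mathbf{2Cat}_{p,i}),$$ given by composition with $i$, has a left 2-adjoint $Q$: there are a 2-functor $Q$ in the other direction and 2-natural transformations $\eta\colon 1\Rightarrow JQ$ and $\varepsilon\colon QJ\Rightarrow 1$ which satisfy the triangle identities strictly. Moreover, for every pseudofunctor $X\colon\mathcal{A}\to\mathbf{2Cat}_{p,i}$ the unit component $\eta_X\colon X\to JQX$, and for every 2-functor $Y\colon\mathcal{A}\to\mathbf{2Cat}_{2,i}$ the 1-cell $J\varepsilon_Y\colon JQJY\to JY$, is an internal equivalence in $\mathrm{Bicat}(\mathcal{A},\mathbf{2Cat}_{p,i})$, i.e. a 1-cell $f$ that admits a 1-cell $g$ in the other direction with invertible 2-cells $g f\cong 1$ and $f g\cong 1$. -/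

import Mathlib

open CategoryTheory Bicategory

universe u w₁ w₂ w₃ w₄ v₁ v₂ v₃ v₄ u₁ u₂ u₃ u₄

namespace TwoDim

section Icons

variable {B : Type u₁} [Bicategory.{w₁, v₁} B] {C : Type u₂} [Bicategory.{w₂, v₂} C]
  {D : Type u₃} [Bicategory.{w₃, v₃} D]

/-- Identification of hom-categories along equalities of objects; it is the identity functor
when both equalities are `rfl`. -/
abbrev homCast {a a' b b' : C} (h : a = a') (h' : b = b') : (a' ⟶ b') ⥤ (a ⟶ b) :=
  match a', b', h, h' with
  | _, _, rfl, rfl => 𝟭 _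

lemma homCast_id {a a' : C} (h : a = a') : (homCast h h).obj (𝟙 a') = 𝟙 a := by
  subst h; rfl

lemma homCast_comp {a a' b b' c c' : C} (ha : a = a') (hb : b = b') (hc : c = c')
    (f : a' ⟶ b') (g : b' ⟶ c') :
    (homCast ha hc).obj (f ≫ g) = (homCast ha hb).obj f ≫ (homCast hb hc).obj g := by
  subst ha hb hc; rfl

lemma homCast_trans {a a' a'' b b' b'' : C} (ha : a = a') (ha' : a' = a'') (hb : b = b')
    (hb' : b' = b'') (f : a'' ⟶ b'') :
    (homCast ha hb).obj ((homCast ha' hb').obj f) =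
      (homCast (ha.trans ha') (hb.trans hb')).obj f := by
  subst ha ha' hb hb'; rfl

lemma map_homCast (F : C ⥤ᵖ D) {a a' b b' : C} (ha : a = a') (hb : b = b') (f : a' ⟶ b') :
    F.map ((homCast ha hb).obj f) =
      (homCast (congrArg F.obj ha) (congrArg F.obj hb)).obj (F.map f) := by
  subst ha hb; rfl

/-- An icon between pseudofunctors: `F` and `G` agree on objects, and there are natural
transformations between the functors on hom-categories, compatible with the unit and
composition constraints. -/
structure Icon (F G : B ⥤ᵖ C) where
  obj_eq (a : B) : F.obj a = G.obj a
  app {a b : B} (f : a ⟶ b) : F.map f ⟶ (homCast (obj_eq a) (obj_eq b)).obj (G.map f)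
  naturality {a b : B} {f g : a ⟶ b} (η : f ⟶ g) :
    F.map₂ η ≫ app g = app f ≫ (homCast (obj_eq a) (obj_eq b)).map (G.map₂ η)
  app_id (a : B) :
    app (𝟙 a) ≫ (homCast (obj_eq a) (obj_eq a)).map (G.mapId a).hom ≫
      eqToHom (homCast_id (obj_eq a)) = (F.mapId a).hom
  app_comp {a b c : B} (f : a ⟶ b) (g : b ⟶ c) :
    app (f ≫ g) ≫ (homCast (obj_eq a) (obj_eq c)).map (G.mapComp f g).hom ≫
      eqToHom (homCast_comp (obj_eq a) (obj_eq b) (obj_eq c) (G.map f) (G.map g)) =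
    (F.mapComp f g).hom ≫ app f ▷ F.map g ≫
      (homCast (obj_eq a) (obj_eq b)).obj (G.map f) ◁ app g

namespace Icon

/-- Icons are determined by their components. -/
lemma ext' {F G : B ⥤ᵖ C} {α β : Icon F G}
    (h : ∀ {a b : B} (f : a ⟶ b), α.app f = β.app f) : α = β := by
  cases α; cases β
  congr
  funext a b f
  exact h f

/-- The identity icon. -/
def id (F : B ⥤ᵖ C) : Icon F F where
  obj_eq _ := rfl
  app f := 𝟙 (F.map f)
  naturality η := by simp
  app_id a := by simp
  app_comp f g := by simp

lemma homCast_map_trans {a a' a'' b b' b'' : C} (ha : a = a') (ha' : a' = a'') (hb : b = b')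
    (hb' : b' = b'') {f g : a'' ⟶ b''} (η : f ⟶ g) :
    (homCast ha hb).map ((homCast ha' hb').map η) =
      eqToHom (homCast_trans ha ha' hb hb' f) ≫
        (homCast (ha.trans ha') (hb.trans hb')).map η ≫
        eqToHom (homCast_trans ha ha' hb hb' g).symm := by
  subst ha ha' hb hb'; simp

lemma map₂_homCast (F : C ⥤ᵖ D) {a a' b b' : C} (ha : a = a') (hb : b = b') {f g : a' ⟶ b'}
    (η : f ⟶ g) :
    F.map₂ ((homCast ha hb).map η) = eqToHom (map_homCast F ha hb f) ≫
      (homCast (congrArg F.obj ha) (congrArg F.obj hb)).map (F.map₂ η) ≫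
      eqToHom (map_homCast F ha hb g).symm := by
  subst ha hb; simp

lemma homCast_map_eqToHom {a a' b b' : C} (ha : a = a') (hb : b = b') {f g : a' ⟶ b'}
    (h : f = g) : (homCast ha hb).map (eqToHom h) = eqToHom (by rw [h]) := by
  subst h; simp

lemma homCast_whiskerRight {a a' b b' c c' : C} (ha : a = a') (hb : b = b') (hc : c = c')
    {f g : a' ⟶ b'} (η : f ⟶ g) (k : b' ⟶ c') :
    (homCast ha hc).map (η ▷ k) = eqToHom (homCast_comp ha hb hc f k) ≫
      (homCast ha hb).map η ▷ (homCast hb hc).obj k ≫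
        eqToHom (homCast_comp ha hb hc g k).symm := by
  subst ha hb hc; simp

lemma homCast_whiskerLeft {a a' b b' c c' : C} (ha : a = a') (hb : b = b') (hc : c = c')
    (k : a' ⟶ b') {f g : b' ⟶ c'} (η : f ⟶ g) :
    (homCast ha hc).map (k ◁ η) = eqToHom (homCast_comp ha hb hc k f) ≫
      (homCast ha hb).obj k ◁ (homCast hb hc).map η ≫
        eqToHom (homCast_comp ha hb hc k g).symm := by
  subst ha hb hc; simp

lemma comp_aux {x y z x' y' z' x'' y'' z'' : C} (hx : x = x') (hy : y = y') (hz : z = z')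
    (hx' : x' = x'') (hy' : y' = y'') (hz' : z' = z'')
    {f : x ⟶ y} {g : y ⟶ z} {k : x ⟶ z} {f' : x' ⟶ y'} {g' : y' ⟶ z'} {k' : x' ⟶ z'}
    {f'' : x'' ⟶ y''} {g'' : y'' ⟶ z''} {k'' : x'' ⟶ z''}
    (m : k ⟶ f ≫ g) (m' : k' ⟶ f' ≫ g') (m'' : k'' ⟶ f'' ≫ g'')
    (p : f ⟶ (homCast hx hy).obj f') (q : g ⟶ (homCast hy hz).obj g')
    (r : k ⟶ (homCast hx hz).obj k') (p' : f' ⟶ (homCast hx' hy').obj f'')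
    (q' : g' ⟶ (homCast hy' hz').obj g'') (r' : k' ⟶ (homCast hx' hz').obj k'')
    (h : r ≫ (homCast hx hz).map m' ≫ eqToHom (homCast_comp hx hy hz f' g') =
      m ≫ p ▷ g ≫ (homCast hx hy).obj f' ◁ q)
    (h' : r' ≫ (homCast hx' hz').map m'' ≫ eqToHom (homCast_comp hx' hy' hz' f'' g'') =
      m' ≫ p' ▷ g' ≫ (homCast hx' hy').obj f'' ◁ q') :
    (r ≫ (homCast hx hz).map r' ≫ eqToHom (homCast_trans hx hx' hz hz' k'')) ≫
      (homCast (hx.trans hx') (hz.trans hz')).map m'' ≫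
      eqToHom (homCast_comp (hx.trans hx') (hy.trans hy') (hz.trans hz') f'' g'') =
    m ≫ (p ≫ (homCast hx hy).map p' ≫ eqToHom (homCast_trans hx hx' hy hy' f'')) ▷ g ≫
      (homCast (hx.trans hx') (hy.trans hy')).obj f'' ◁
        (q ≫ (homCast hy hz).map q' ≫ eqToHom (homCast_trans hy hy' hz hz' g'')) := by
  subst hx hy hz hx' hy' hz'
  simp only [homCast, Functor.id_map, Functor.id_obj, eqToHom_refl, Category.comp_id,
    Category.assoc] at h h' ⊢
  rw [h', reassoc_of% h]
  simp [whisker_exchange_assoc]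

lemma whiskerRight_aux (H : C ⥤ᵖ D) {x y z x' y' z' : C} (hx : x = x') (hy : y = y')
    (hz : z = z') {f : x ⟶ y} {g : y ⟶ z} {k : x ⟶ z} {f' : x' ⟶ y'} {g' : y' ⟶ z'}
    {k' : x' ⟶ z'} (m : k ⟶ f ≫ g) (m' : k' ⟶ f' ≫ g')
    (p : f ⟶ (homCast hx hy).obj f') (q : g ⟶ (homCast hy hz).obj g')
    (r : k ⟶ (homCast hx hz).obj k')
    (h : r ≫ (homCast hx hz).map m' ≫ eqToHom (homCast_comp hx hy hz f' g') =
      m ≫ p ▷ g ≫ (homCast hx hy).obj f' ◁ q) :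
    (H.map₂ r ≫ eqToHom (map_homCast H hx hz k')) ≫
      (homCast (congrArg H.obj hx) (congrArg H.obj hz)).map
        (H.map₂ m' ≫ (H.mapComp f' g').hom) ≫
      eqToHom (homCast_comp (congrArg H.obj hx) (congrArg H.obj hy) (congrArg H.obj hz) _ _) =
    (H.map₂ m ≫ (H.mapComp f g).hom) ≫
      (H.map₂ p ≫ eqToHom (map_homCast H hx hy f')) ▷ H.map g ≫
      (homCast (congrArg H.obj hx) (congrArg H.obj hy)).obj (H.map f') ◁
        (H.map₂ q ≫ eqToHom (map_homCast H hy hz g')) := by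
  subst hx hy hz
  simp only [homCast, Functor.id_map, Functor.id_obj, eqToHom_refl, Category.comp_id,
    Category.assoc] at h ⊢
  rw [← H.map₂_comp_assoc, h]
  simp

lemma whiskerRight_aux' (H : C ⥤ᵖ D) {x x' : C} (hx : x = x') {k : x ⟶ x} {k' : x' ⟶ x'}
    (m : k ⟶ 𝟙 x) (m' : k' ⟶ 𝟙 x') (r : k ⟶ (homCast hx hx).obj k')
    (h : r ≫ (homCast hx hx).map m' ≫ eqToHom (homCast_id hx) = m) :
    (H.map₂ r ≫ eqToHom (map_homCast H hx hx k')) ≫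
      (homCast (congrArg H.obj hx) (congrArg H.obj hx)).map
        (H.map₂ m' ≫ (H.mapId x').hom) ≫
      eqToHom (homCast_id (congrArg H.obj hx)) =
    H.map₂ m ≫ (H.mapId x).hom := by
  subst hx
  simp only [homCast, Functor.id_map, Functor.id_obj, eqToHom_refl, Category.comp_id] at h ⊢
  rw [← H.map₂_comp_assoc, h]

lemma comp_whiskerRight_aux (K : C ⥤ᵖ D) {x x' x'' y y' y'' : C} (hx : x = x') (hy : y = y')
    (hx' : x' = x'') (hy' : y' = y'') {f : x ⟶ y} {f' : x' ⟶ y'} {f'' : x'' ⟶ y''}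
    (p : f ⟶ (homCast hx hy).obj f') (p' : f' ⟶ (homCast hx' hy').obj f'') :
    K.map₂ (p ≫ (homCast hx hy).map p' ≫ eqToHom (homCast_trans hx hx' hy hy' f'')) ≫
      eqToHom (map_homCast K (hx.trans hx') (hy.trans hy') f'') =
    (K.map₂ p ≫ eqToHom (map_homCast K hx hy f')) ≫
      (homCast (congrArg K.obj hx) (congrArg K.obj hy)).map
        (K.map₂ p' ≫ eqToHom (map_homCast K hx' hy' f'')) ≫
      eqToHom (homCast_trans _ _ _ _ _) := by
  subst hx hy hx' hy'
  simp [homCast]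

lemma whiskerRight_comp_aux {E : Type u₄} [Bicategory.{w₄, v₄} E] (H : C ⥤ᵖ D) (K : D ⥤ᵖ E)
    {x x' y y' : C} (hx : x = x') (hy : y = y') {f : x ⟶ y} {f' : x' ⟶ y'}
    (p : f ⟶ (homCast hx hy).obj f') :
    K.map₂ (H.map₂ p) ≫ eqToHom (map_homCast (H.comp K) hx hy f') =
    K.map₂ (H.map₂ p ≫ eqToHom (map_homCast H hx hy f')) ≫
      eqToHom (map_homCast K (congrArg H.obj hx) (congrArg H.obj hy) (H.map f')) := by
  subst hx hy
  change f ⟶ f' at p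
  change K.map₂ (H.map₂ p) ≫ eqToHom rfl = K.map₂ (H.map₂ p ≫ eqToHom rfl) ≫ eqToHom rfl
  simp

lemma whisker_exchange_aux {H K : C ⥤ᵖ D} (β : Icon H K) {x x' y y' : C} (hx : x = x')
    (hy : y = y') {f : x ⟶ y} {f' : x' ⟶ y'} (p : f ⟶ (homCast hx hy).obj f') :
    β.app f ≫ (homCast (β.obj_eq x) (β.obj_eq y)).map
        (K.map₂ p ≫ eqToHom (map_homCast K hx hy f')) ≫ eqToHom (homCast_trans _ _ _ _ _) =
      (H.map₂ p ≫ eqToHom (map_homCast H hx hy f')) ≫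
        (homCast (congrArg H.obj hx) (congrArg H.obj hy)).map (β.app f') ≫
        eqToHom (homCast_trans _ _ _ _ _) := by
  subst hx hy
  change f ⟶ f' at p
  change β.app f ≫ (homCast _ _).map (K.map₂ p ≫ eqToHom rfl) ≫ eqToHom rfl =
    (H.map₂ p ≫ eqToHom rfl) ≫ β.app f' ≫ eqToHom rfl
  simp [β.naturality p]

/-- Vertical composition of icons. -/
def comp {F G H : B ⥤ᵖ C} (α : Icon F G) (β : Icon G H) : Icon F H where
  obj_eq a := (α.obj_eq a).trans (β.obj_eq a)
  app {a b} f := α.app f ≫ (homCast (α.obj_eq a) (α.obj_eq b)).map (β.app f) ≫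
    eqToHom (homCast_trans _ _ _ _ _)
  naturality {a b f g} η := by
    have h1 := α.naturality η
    have h2 := congrArg (homCast (α.obj_eq a) (α.obj_eq b)).map (β.naturality η)
    rw [Functor.map_comp, Functor.map_comp, homCast_map_trans] at h2
    rw [reassoc_of% h1, reassoc_of% h2]
    simp
  app_id a := by
    have h1 := α.app_id a
    have h2 := congrArg (homCast (α.obj_eq a) (α.obj_eq a)).map (β.app_id a)
    rw [Functor.map_comp, Functor.map_comp, homCast_map_trans] at h2
    rw [← h1, ← h2]
    simp [homCast_map_eqToHom]
  app_comp {a b c} f g := comp_aux _ _ _ _ _ _ _ _ _ _ _ _ _ _ _ (α.app_comp f g) (β.app_comp f g)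

/-- Whiskering of an icon with a pseudofunctor applied before it. -/
def whiskerLeft (F : B ⥤ᵖ C) {G H : C ⥤ᵖ D} (α : Icon G H) : Icon (F.comp G) (F.comp H) where
  obj_eq a := α.obj_eq (F.obj a)
  app f := α.app (F.map f)
  naturality η := α.naturality _
  app_id a := by
    have h1 := α.naturality (F.mapId a).hom
    have h2 := α.app_id (F.obj a)
    have h3 : α.app (F.map (𝟙 a)) ≫
        (homCast (α.obj_eq (F.obj a)) (α.obj_eq (F.obj a))).map
          (H.map₂ (F.mapId a).hom ≫ (H.mapId (F.obj a)).hom) ≫ eqToHom (homCast_id _) =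
        G.map₂ (F.mapId a).hom ≫ (G.mapId (F.obj a)).hom := by
      rw [Functor.map_comp, Category.assoc, ← reassoc_of% h1, h2]
    exact h3
  app_comp {a b c} f g := by
    have h1 := α.naturality (F.mapComp f g).hom
    have h2 := α.app_comp (F.map f) (F.map g)
    have h3 : α.app (F.map (f ≫ g)) ≫
        (homCast (α.obj_eq (F.obj a)) (α.obj_eq (F.obj c))).map
          (H.map₂ (F.mapComp f g).hom ≫ (H.mapComp (F.map f) (F.map g)).hom) ≫
          eqToHom (homCast_comp _ (α.obj_eq (F.obj b)) _ _ _) =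
        (G.map₂ (F.mapComp f g).hom ≫ (G.mapComp (F.map f) (F.map g)).hom) ≫
          α.app (F.map f) ▷ G.map (F.map g) ≫ (homCast _ _).obj (H.map (F.map f)) ◁
            α.app (F.map g) := by
      rw [Functor.map_comp, Category.assoc, ← reassoc_of% h1, h2, Category.assoc]
    exact h3

/-- Whiskering of an icon with a pseudofunctor applied after it. -/
def whiskerRight {F G : B ⥤ᵖ C} (α : Icon F G) (H : C ⥤ᵖ D) : Icon (F.comp H) (G.comp H) where
  obj_eq a := congrArg H.obj (α.obj_eq a)
  app f := H.map₂ (α.app f) ≫ eqToHom (map_homCast H _ _ _)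
  naturality {a b f g} η := by
    have h1 := congrArg H.map₂ (α.naturality η)
    rw [H.map₂_comp, H.map₂_comp, map₂_homCast] at h1
    have h2 : H.map₂ (F.map₂ η) ≫ H.map₂ (α.app g) ≫ eqToHom (map_homCast H _ _ _) =
      (H.map₂ (α.app f) ≫ eqToHom (map_homCast H _ _ _)) ≫
        (homCast (congrArg H.obj (α.obj_eq a)) (congrArg H.obj (α.obj_eq b))).map
          (H.map₂ (G.map₂ η)) := by
      rw [reassoc_of% h1]; simp
    exact h2
  app_id a := whiskerRight_aux' H _ _ _ _ (α.app_id a)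
  app_comp f g := whiskerRight_aux H _ _ _ _ _ _ _ _ (α.app_comp f g)

lemma comp_whiskerRight {F G H : B ⥤ᵖ C} (α : Icon F G) (β : Icon G H) (K : C ⥤ᵖ D) :
    (α.comp β).whiskerRight K = (α.whiskerRight K).comp (β.whiskerRight K) :=
  ext' fun _ => comp_whiskerRight_aux K _ _ _ _ _ _

lemma whiskerRight_comp {E : Type u₄} [Bicategory.{w₄, v₄} E] {F G : B ⥤ᵖ C} (α : Icon F G)
    (H : C ⥤ᵖ D) (K : D ⥤ᵖ E) {a b : B} (f : a ⟶ b) :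
    (α.whiskerRight (H.comp K)).app f = ((α.whiskerRight H).whiskerRight K).app f :=
  whiskerRight_comp_aux H K _ _ _

lemma whisker_exchange {F G : B ⥤ᵖ C} {H K : C ⥤ᵖ D} (α : Icon F G) (β : Icon H K) :
    (β.whiskerLeft F).comp (α.whiskerRight K) = (α.whiskerRight H).comp (β.whiskerLeft G) :=
  ext' fun _ => whisker_exchange_aux β _ _ _

/-- The icon with identity components between the two ways of composing three
pseudofunctors. -/
def assocHom {E : Type u₄} [Bicategory.{w₄, v₄} E] (F : B ⥤ᵖ C) (G : C ⥤ᵖ D) (H : D ⥤ᵖ E) :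
    Icon ((F.comp G).comp H) (F.comp (G.comp H)) where
  obj_eq _ := rfl
  app f := 𝟙 (H.map (G.map (F.map f)))
  naturality η := (Category.comp_id _).trans (Category.id_comp _).symm
  app_id a := by
    change 𝟙 _ ≫ (H.map₂ (G.map₂ (F.mapId a).hom) ≫ H.map₂ (G.mapId _).hom ≫
      (H.mapId _).hom) ≫ eqToHom rfl =
      H.map₂ (G.map₂ (F.mapId a).hom ≫ (G.mapId _).hom) ≫ (H.mapId _).hom
    simp
  app_comp f g := by
    change 𝟙 _ ≫ (H.map₂ (G.map₂ (F.mapComp f g).hom) ≫ H.map₂ (G.mapComp _ _).hom ≫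
      (H.mapComp _ _).hom) ≫ eqToHom rfl =
      (H.map₂ (G.map₂ (F.mapComp f g).hom ≫ (G.mapComp _ _).hom) ≫ (H.mapComp _ _).hom) ≫
        𝟙 (H.map (G.map (F.map f))) ▷ H.map (G.map (F.map g)) ≫
        H.map (G.map (F.map f)) ◁ 𝟙 (H.map (G.map (F.map g)))
    simp

/-- The inverse of `assocHom`. -/
def assocInv {E : Type u₄} [Bicategory.{w₄, v₄} E] (F : B ⥤ᵖ C) (G : C ⥤ᵖ D) (H : D ⥤ᵖ E) :
    Icon (F.comp (G.comp H)) ((F.comp G).comp H) where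
  obj_eq _ := rfl
  app f := 𝟙 (H.map (G.map (F.map f)))
  naturality η := (Category.comp_id _).trans (Category.id_comp _).symm
  app_id a := by
    change 𝟙 _ ≫ (H.map₂ (G.map₂ (F.mapId a).hom ≫ (G.mapId _).hom) ≫ (H.mapId _).hom) ≫
      eqToHom rfl = H.map₂ (G.map₂ (F.mapId a).hom) ≫ H.map₂ (G.mapId _).hom ≫ (H.mapId _).hom
    simp
  app_comp f g := by
    change 𝟙 _ ≫ (H.map₂ (G.map₂ (F.mapComp f g).hom ≫ (G.mapComp _ _).hom) ≫
        (H.mapComp _ _).hom) ≫ eqToHom rfl =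
      (H.map₂ (G.map₂ (F.mapComp f g).hom) ≫ H.map₂ (G.mapComp _ _).hom ≫
        (H.mapComp _ _).hom) ≫ 𝟙 (H.map (G.map (F.map f))) ▷ H.map (G.map (F.map g)) ≫
        H.map (G.map (F.map f)) ◁ 𝟙 (H.map (G.map (F.map g)))
    simp

/-- The icon with identity components from `𝟙 ≫ F` to `F`. -/
def leftUnitHom (F : B ⥤ᵖ C) : Icon ((Pseudofunctor.id B).comp F) F where
  obj_eq _ := rfl
  app f := 𝟙 (F.map f)
  naturality η := (Category.comp_id _).trans (Category.id_comp _).symm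
  app_id a := by
    change 𝟙 _ ≫ (F.mapId a).hom ≫ eqToHom rfl = F.map₂ (𝟙 _) ≫ (F.mapId a).hom
    simp
  app_comp f g := by
    change 𝟙 _ ≫ (F.mapComp f g).hom ≫ eqToHom rfl = (F.map₂ (𝟙 _) ≫ (F.mapComp f g).hom) ≫
      𝟙 (F.map f) ▷ F.map g ≫ F.map f ◁ 𝟙 (F.map g)
    simp

/-- The inverse of `leftUnitHom`. -/
def leftUnitInv (F : B ⥤ᵖ C) : Icon F ((Pseudofunctor.id B).comp F) where
  obj_eq _ := rfl
  app f := 𝟙 (F.map f)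
  naturality η := (Category.comp_id _).trans (Category.id_comp _).symm
  app_id a := by
    change 𝟙 _ ≫ (F.map₂ (𝟙 _) ≫ (F.mapId a).hom) ≫ eqToHom rfl = (F.mapId a).hom
    simp
  app_comp f g := by
    change 𝟙 _ ≫ (F.map₂ (𝟙 _) ≫ (F.mapComp f g).hom) ≫ eqToHom rfl = (F.mapComp f g).hom ≫
      𝟙 (F.map f) ▷ F.map g ≫ F.map f ◁ 𝟙 (F.map g)
    simp

/-- The icon with identity components from `F ≫ 𝟙` to `F`. -/
def rightUnitHom (F : B ⥤ᵖ C) : Icon (F.comp (Pseudofunctor.id C)) F where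
  obj_eq _ := rfl
  app f := 𝟙 (F.map f)
  naturality η := (Category.comp_id _).trans (Category.id_comp _).symm
  app_id a := by
    change 𝟙 _ ≫ (F.mapId a).hom ≫ eqToHom rfl = (F.mapId a).hom ≫ 𝟙 _
    simp
  app_comp f g := by
    change 𝟙 _ ≫ (F.mapComp f g).hom ≫ eqToHom rfl = ((F.mapComp f g).hom ≫ 𝟙 _) ≫
      𝟙 (F.map f) ▷ F.map g ≫ F.map f ◁ 𝟙 (F.map g)
    simp

/-- The inverse of `rightUnitHom`. -/
def rightUnitInv (F : B ⥤ᵖ C) : Icon F (F.comp (Pseudofunctor.id C)) where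
  obj_eq _ := rfl
  app f := 𝟙 (F.map f)
  naturality η := (Category.comp_id _).trans (Category.id_comp _).symm
  app_id a := by
    change 𝟙 _ ≫ ((F.mapId a).hom ≫ 𝟙 _) ≫ eqToHom rfl = (F.mapId a).hom
    simp
  app_comp f g := by
    change 𝟙 _ ≫ ((F.mapComp f g).hom ≫ 𝟙 _) ≫ eqToHom rfl = (F.mapComp f g).hom ≫
      𝟙 (F.map f) ▷ F.map g ≫ F.map f ◁ 𝟙 (F.map g)
    simp

end Icon

end Icons

/-- The objects of the 2-category `2Cat_{p,i}`: small (strict) 2-categories. -/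
structure TwoCatPI : Type (u + 1) where
  carrier : Type u
  [bicategory : Bicategory.{u, u} carrier]
  [strict : Strict carrier]

attribute [instance] TwoCatPI.bicategory TwoCatPI.strict

namespace TwoCatPI

/-- The 1-cells of `2Cat_{p,i}`: pseudofunctors. -/
structure Hom (X Y : TwoCatPI.{u}) where
  fn : X.carrier ⥤ᵖ Y.carrier

@[ext]
lemma Hom.ext' {X Y : TwoCatPI.{u}} {F G : Hom X Y} (h : F.fn = G.fn) : F = G := by
  cases F; cases G; congr

instance : CategoryStruct TwoCatPI.{u} where
  Hom X Y := Hom X Y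
  id X := ⟨Pseudofunctor.id X.carrier⟩
  comp F G := ⟨F.fn.comp G.fn⟩

/-- The 2-cells of `2Cat_{p,i}`: icons. -/
structure Hom₂ {X Y : TwoCatPI.{u}} (F G : X ⟶ Y) where
  icon : Icon F.fn G.fn

lemma Hom₂.ext' {X Y : TwoCatPI.{u}} {F G : X ⟶ Y} (α β : Hom₂ F G)
    (h : ∀ {a b : X.carrier} (f : a ⟶ b), α.icon.app f = β.icon.app f) : α = β := by
  cases α; cases β
  congr
  exact Icon.ext' h

instance homCategory (X Y : TwoCatPI.{u}) : Category (X ⟶ Y) where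
  Hom F G := Hom₂ F G
  id F := ⟨Icon.id F.fn⟩
  comp α β := ⟨α.icon.comp β.icon⟩
  id_comp {F G} α := Hom₂.ext' _ _ fun f => by
    change 𝟙 _ ≫ α.icon.app f ≫ eqToHom rfl = _
    simp
  comp_id {F G} α := Hom₂.ext' _ _ fun {a b} f => by
    change α.icon.app f ≫ (homCast (α.icon.obj_eq a) (α.icon.obj_eq b)).map (𝟙 _) ≫
      eqToHom rfl = _
    simp
  assoc α β γ := Hom₂.ext' _ _ fun {a b} f => by
    change (α.icon.app f ≫ (homCast _ _).map (β.icon.app f) ≫ eqToHom _) ≫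
        (homCast _ _).map (γ.icon.app f) ≫ eqToHom _ =
      α.icon.app f ≫ (homCast _ _).map (β.icon.app f ≫ (homCast _ _).map (γ.icon.app f) ≫
        eqToHom _) ≫ eqToHom _
    simp [Icon.homCast_map_trans, Icon.homCast_map_eqToHom]

@[simp]
lemma id_fn (X : TwoCatPI.{u}) : Hom.fn (𝟙 X) = Pseudofunctor.id X.carrier := rfl

@[simp]
lemma comp_fn {X Y Z : TwoCatPI.{u}} (F : X ⟶ Y) (G : Y ⟶ Z) :
    Hom.fn (F ≫ G) = F.fn.comp G.fn := rfl

@[simp]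
lemma id_app {X Y : TwoCatPI.{u}} (F : X ⟶ Y) {a b : X.carrier} (f : a ⟶ b) :
    (Hom₂.icon (𝟙 F)).app f = 𝟙 (F.fn.map f) := rfl

@[simp]
lemma comp_app {X Y : TwoCatPI.{u}} {F G H : X ⟶ Y} (α : F ⟶ G) (β : G ⟶ H) {a b : X.carrier}
    (f : a ⟶ b) :
    (Hom₂.icon (α ≫ β)).app f = α.icon.app f ≫
      (homCast (α.icon.obj_eq a) (α.icon.obj_eq b)).map (β.icon.app f) ≫
        eqToHom (homCast_trans _ _ _ _ _) := rfl

/-- The 2-category `2Cat_{p,i}` of 2-categories, pseudofunctors and icons. -/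
instance instBicategory : Bicategory TwoCatPI.{u} where
  toCategoryStruct := inferInstance
  homCategory := homCategory
  whiskerLeft F _ _ α := Hom₂.mk (α.icon.whiskerLeft F.fn)
  whiskerRight α H := Hom₂.mk (α.icon.whiskerRight H.fn)
  associator F G H :=
    { hom := ⟨Icon.assocHom F.fn G.fn H.fn⟩
      inv := ⟨Icon.assocInv F.fn G.fn H.fn⟩
      hom_inv_id := Hom₂.ext' _ _ fun f => by
        change 𝟙 _ ≫ 𝟙 _ ≫ eqToHom rfl = 𝟙 _
        simp
      inv_hom_id := Hom₂.ext' _ _ fun f => by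
        change 𝟙 _ ≫ 𝟙 _ ≫ eqToHom rfl = 𝟙 _
        simp }
  leftUnitor F :=
    { hom := ⟨Icon.leftUnitHom F.fn⟩
      inv := ⟨Icon.leftUnitInv F.fn⟩
      hom_inv_id := Hom₂.ext' _ _ fun f => by
        change 𝟙 _ ≫ 𝟙 _ ≫ eqToHom rfl = 𝟙 _
        simp
      inv_hom_id := Hom₂.ext' _ _ fun f => by
        change 𝟙 _ ≫ 𝟙 _ ≫ eqToHom rfl = 𝟙 _
        simp }
  rightUnitor F :=
    { hom := ⟨Icon.rightUnitHom F.fn⟩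
      inv := ⟨Icon.rightUnitInv F.fn⟩
      hom_inv_id := Hom₂.ext' _ _ fun f => by
        change 𝟙 _ ≫ 𝟙 _ ≫ eqToHom rfl = 𝟙 _
        simp
      inv_hom_id := Hom₂.ext' _ _ fun f => by
        change 𝟙 _ ≫ 𝟙 _ ≫ eqToHom rfl = 𝟙 _
        simp }
  whiskerLeft_id F G := rfl
  whiskerLeft_comp F _ _ _ α β := rfl
  id_whiskerLeft {X Y F G} α := Hom₂.ext' _ _ fun {a b} f => by
    change α.icon.app f = 𝟙 _ ≫ (α.icon.app f ≫
      (homCast (α.icon.obj_eq a) (α.icon.obj_eq b)).map (𝟙 _) ≫ eqToHom rfl) ≫ eqToHom rfl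
    simp
  comp_whiskerLeft F G _ _ α := Hom₂.ext' _ _ fun {a b} f => by
    change α.icon.app (G.fn.map (F.fn.map f)) = 𝟙 _ ≫ (α.icon.app (G.fn.map (F.fn.map f)) ≫
      (homCast _ _).map (𝟙 _) ≫ eqToHom rfl) ≫ eqToHom rfl
    simp
  id_whiskerRight F G := Hom₂.ext' _ _ fun {a b} f => by
    change G.fn.map₂ (𝟙 _) ≫ eqToHom rfl = 𝟙 _
    simp
  comp_whiskerRight α β H := congrArg Hom₂.mk (Icon.comp_whiskerRight α.icon β.icon H.fn)
  whiskerRight_id {X Y F G} α := Hom₂.ext' _ _ fun {a b} f => by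
    change α.icon.app f ≫ eqToHom _ = 𝟙 _ ≫ (α.icon.app f ≫
      (homCast (α.icon.obj_eq a) (α.icon.obj_eq b)).map (𝟙 _) ≫ eqToHom rfl) ≫ eqToHom rfl
    simp
  whiskerRight_comp α G H := Hom₂.ext' _ _ fun {a b} f => by
    refine (Icon.whiskerRight_comp α.icon G.fn H.fn f).trans ?_
    change _ = 𝟙 _ ≫ (((α.icon.whiskerRight G.fn).whiskerRight H.fn).app f ≫
        (homCast _ _).map (𝟙 _) ≫ eqToHom rfl) ≫ eqToHom rfl
    simp
  whisker_assoc F _ _ α H := Hom₂.ext' _ _ fun {a b} f => by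
    change H.fn.map₂ (α.icon.app (F.fn.map f)) ≫ eqToHom _ =
      𝟙 _ ≫ ((H.fn.map₂ (α.icon.app (F.fn.map f)) ≫ eqToHom _) ≫
        (homCast _ _).map (𝟙 _) ≫ eqToHom rfl) ≫ eqToHom rfl
    simp
  whisker_exchange α β := congrArg Hom₂.mk (Icon.whisker_exchange α.icon β.icon)
  pentagon F G H K := Hom₂.ext' _ _ fun {a b} f => by
    change (K.fn.map₂ (𝟙 (H.fn.map (G.fn.map (F.fn.map f)))) ≫ eqToHom rfl) ≫
      (𝟙 (K.fn.map (H.fn.map (G.fn.map (F.fn.map f)))) ≫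
        𝟙 (K.fn.map (H.fn.map (G.fn.map (F.fn.map f)))) ≫ eqToHom rfl) ≫ eqToHom rfl =
      𝟙 (K.fn.map (H.fn.map (G.fn.map (F.fn.map f)))) ≫
        𝟙 (K.fn.map (H.fn.map (G.fn.map (F.fn.map f)))) ≫ eqToHom rfl
    simp
  triangle F G := Hom₂.ext' _ _ fun {a b} f => by
    change 𝟙 (G.fn.map (F.fn.map f)) ≫ 𝟙 (G.fn.map (F.fn.map f)) ≫ eqToHom rfl =
      G.fn.map₂ (𝟙 (F.fn.map f)) ≫ eqToHom rfl
    simp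

lemma pseudofunctor_ext {B : Type u₁} [Bicategory.{w₁, v₁} B] {C : Type u₂}
    [Bicategory.{w₂, v₂} C] {F G : B ⥤ᵖ C} (h : F.toPrelaxFunctor = G.toPrelaxFunctor)
    (hId : ∀ a, HEq (F.mapId a).hom (G.mapId a).hom)
    (hComp : ∀ {a b c : B} (f : a ⟶ b) (g : b ⟶ c),
      HEq (F.mapComp f g).hom (G.mapComp f g).hom) : F = G := by
  obtain ⟨P, i, m, _, _, _, _, _⟩ := F
  obtain ⟨P', i', m', _, _, _, _, _⟩ := G
  obtain rfl : P = P' := h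
  obtain rfl : i = i' := by
    funext a; exact Iso.ext (eq_of_heq (hId a))
  obtain rfl : @m = @m' := by
    funext a b c f g; exact Iso.ext (eq_of_heq (hComp f g))
  rfl

lemma eqToHom_app {X Y : TwoCatPI.{u}} {F G : X ⟶ Y} (h : F = G) {a b : X.carrier} (f : a ⟶ b) :
    (Hom₂.icon (eqToHom h)).app f = eqToHom (by subst h; rfl) := by
  subst h; rfl

/-- `2Cat_{p,i}` is a strict 2-category. -/
instance : Strict TwoCatPI.{u} where
  id_comp F := Hom.ext' (pseudofunctor_ext rfl
    (fun a => heq_of_eq (by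
      change F.fn.map₂ (𝟙 _) ≫ (F.fn.mapId a).hom = _
      simp))
    (fun f g => heq_of_eq (by
      change F.fn.map₂ (𝟙 _) ≫ (F.fn.mapComp f g).hom = _
      simp)))
  comp_id F := Hom.ext' (pseudofunctor_ext rfl
    (fun a => heq_of_eq (Category.comp_id _))
    (fun f g => heq_of_eq (Category.comp_id _)))
  assoc F G H := Hom.ext' (pseudofunctor_ext rfl
    (fun a => heq_of_eq (by
      change H.fn.map₂ (G.fn.map₂ (F.fn.mapId a).hom ≫ (G.fn.mapId _).hom) ≫
          (H.fn.mapId _).hom =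
        H.fn.map₂ (G.fn.map₂ (F.fn.mapId a).hom) ≫ H.fn.map₂ (G.fn.mapId _).hom ≫
          (H.fn.mapId _).hom
      simp))
    (fun f g => heq_of_eq (by
      change H.fn.map₂ (G.fn.map₂ (F.fn.mapComp f g).hom ≫ (G.fn.mapComp _ _).hom) ≫
          (H.fn.mapComp _ _).hom =
        H.fn.map₂ (G.fn.map₂ (F.fn.mapComp f g).hom) ≫ H.fn.map₂ (G.fn.mapComp _ _).hom ≫
          (H.fn.mapComp _ _).hom
      simp)))
  leftUnitor_eqToIso F := Iso.ext (Hom₂.ext' _ _ fun f => by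
    rw [eqToIso.hom, eqToHom_app]; rfl)
  rightUnitor_eqToIso F := Iso.ext (Hom₂.ext' _ _ fun f => by
    rw [eqToIso.hom, eqToHom_app]; rfl)
  associator_eqToIso F G H := Iso.ext (Hom₂.ext' _ _ fun f => by
    rw [eqToIso.hom, eqToHom_app]; rfl)

end TwoCatPI

section LocallyFull

variable {B : Type u₁} [Bicategory.{w₁, v₁} B] {C : Type u₂} (φ : C → B)

/-- A class of 1-cells, closed under identities and composition, between the objects `φ x`
of a bicategory. -/
structure OneCellClass where
  holds {x y : C} (f : φ x ⟶ φ y) : Prop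
  id_holds (x : C) : holds (𝟙 (φ x))
  comp_holds {x y z : C} {f : φ x ⟶ φ y} {g : φ y ⟶ φ z} :
    holds f → holds g → holds (f ≫ g)

variable {φ}

/-- The bicategory with objects the `x : C`, with 1-cells `x ⟶ y` the 1-cells `φ x ⟶ φ y` in the
class `P`, and with all 2-cells between these. -/
structure LocallyFull (P : OneCellClass φ) where
  obj : C

namespace LocallyFull

variable {P : OneCellClass φ}

/-- The 1-cells: those in the class `P`. -/
@[ext]
structure Hom (X Y : LocallyFull P) where
  cell : φ X.obj ⟶ φ Y.obj
  property : P.holds cell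

@[simps id_cell comp_cell]
instance : CategoryStruct (LocallyFull P) where
  Hom X Y := Hom X Y
  id X := ⟨𝟙 (φ X.obj), P.id_holds _⟩
  comp f g := ⟨f.cell ≫ g.cell, P.comp_holds f.property g.property⟩

@[ext]
lemma hom_ext {X Y : LocallyFull P} {f g : X ⟶ Y} (h : f.cell = g.cell) : f = g :=
  Hom.ext h

/-- The 2-cells: all 2-cells of the ambient bicategory. -/
@[ext]
structure Hom₂ {X Y : LocallyFull P} (f g : X ⟶ Y) where
  cell : f.cell ⟶ g.cell

@[simps!]
instance homCategory (X Y : LocallyFull P) : Category (X ⟶ Y) where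
  Hom f g := Hom₂ f g
  id f := ⟨𝟙 f.cell⟩
  comp η θ := ⟨η.cell ≫ θ.cell⟩

@[ext]
lemma hom₂_ext {X Y : LocallyFull P} {f g : X ⟶ Y} {η θ : f ⟶ g} (h : η.cell = θ.cell) :
    η = θ :=
  Hom₂.ext h

/-- Invertible 2-cells of the ambient bicategory are invertible. -/
@[simps]
def isoMk {X Y : LocallyFull P} {f g : X ⟶ Y} (e : f.cell ≅ g.cell) : f ≅ g where
  hom := ⟨e.hom⟩
  inv := ⟨e.inv⟩

@[simps!]
instance bicategory : Bicategory (LocallyFull P) where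
  toCategoryStruct := inferInstance
  homCategory := homCategory
  whiskerLeft f _ _ η := Hom₂.mk (f.cell ◁ Hom₂.cell η)
  whiskerRight η h := Hom₂.mk (Hom₂.cell η ▷ h.cell)
  associator f g h := isoMk (α_ f.cell g.cell h.cell)
  leftUnitor f := isoMk (λ_ f.cell)
  rightUnitor f := isoMk (ρ_ f.cell)
  whisker_exchange η θ := by ext; exact whisker_exchange _ _

attribute [-simp] bicategory_comp_cell bicategory_Hom

lemma eqToHom_cell {X Y : LocallyFull P} {f g : X ⟶ Y} (h : f = g) :
    (eqToHom h).cell = eqToHom (h ▸ rfl) := by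
  subst h; rfl

instance [Strict B] : Strict (LocallyFull P) where
  id_comp f := hom_ext (Strict.id_comp f.cell)
  comp_id f := hom_ext (Strict.comp_id f.cell)
  assoc f g h := hom_ext (Strict.assoc f.cell g.cell h.cell)
  leftUnitor_eqToIso f := by
    ext; simp [eqToHom_cell, Strict.leftUnitor_eqToIso]
  rightUnitor_eqToIso f := by
    ext; simp [eqToHom_cell, Strict.rightUnitor_eqToIso]
  associator_eqToIso f g h := by
    ext; simp [eqToHom_cell, Strict.associator_eqToIso]

variable (P) in
/-- The inclusion 2-functor into the ambient bicategory. -/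
@[simps!]
def inclusion : StrictPseudofunctor (LocallyFull P) B :=
  StrictPseudofunctor.mk'
    { obj X := φ X.obj
      map f := f.cell
      map₂ η := η.cell }

end LocallyFull

end LocallyFull

section FunctorBicategory

open scoped Pseudofunctor.StrongTrans

variable {A : Type u₁} [Bicategory.{w₁, v₁} A] {K : Type u₂} [Bicategory.{w₂, v₂} K]
  {L : Type u₃} [Bicategory.{w₃, v₃} L]

lemma eq_of_modification {F G : A ⥤ᵖ K} {α β : F ⟶ G} (Γ : α ⟶ β)
    (h : ∀ a, α.app a = β.app a) (hΓ : ∀ a, Γ.as.app a = eqToHom (h a)) : α = β := by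
  obtain ⟨⟨γ, hγ⟩⟩ := Γ
  obtain ⟨p, n, _, _, _⟩ := α
  obtain ⟨q, m, _, _, _⟩ := β
  obtain rfl : p = q := funext h
  obtain rfl : γ = fun a => 𝟙 (p a) := funext hΓ
  obtain rfl : @n = @m := by
    funext a b f
    apply Iso.ext
    simpa using (hγ f).symm
  rfl

lemma eqToHom_as_app {F G : A ⥤ᵖ K} {α β : F ⟶ G} (h : α = β) (a : A) :
    (eqToHom h).as.app a = eqToHom (by rw [h]) := by
  subst h; rfl

/-- `Bicat(A, K)` is a strict 2-category if `K` is one. -/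
instance [Strict K] : Strict (A ⥤ᵖ K) where
  id_comp α := eq_of_modification (λ_ α).hom (fun _ => Strict.id_comp _) fun a => by
    change (λ_ (α.app a)).hom = _
    rw [Strict.leftUnitor_eqToIso]; rfl
  comp_id α := eq_of_modification (ρ_ α).hom (fun _ => Strict.comp_id _) fun a => by
    change (ρ_ (α.app a)).hom = _
    rw [Strict.rightUnitor_eqToIso]; rfl
  assoc α β γ := eq_of_modification (α_ α β γ).hom (fun _ => Strict.assoc _ _ _) fun a => by
    change (α_ (α.app a) (β.app a) (γ.app a)).hom = _
    rw [Strict.associator_eqToIso]; rfl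
  leftUnitor_eqToIso α := by
    ext a
    simp only [eqToIso.hom, eqToHom_as_app, Strict.leftUnitor_eqToIso,
      Pseudofunctor.StrongTrans.leftUnitor_hom_as_app]
    rfl
  rightUnitor_eqToIso α := by
    ext a
    simp only [eqToIso.hom, eqToHom_as_app, Strict.rightUnitor_eqToIso,
      Pseudofunctor.StrongTrans.rightUnitor_hom_as_app]
    rfl
  associator_eqToIso α β γ := by
    ext a
    simp only [eqToIso.hom, eqToHom_as_app, Strict.associator_eqToIso,
      Pseudofunctor.StrongTrans.associator_hom_as_app]
    rfl

lemma twoNatural_aux [Strict K] {x x' x'' y y' y'' : K} {f : x ⟶ y} {f' : x' ⟶ y'}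
    {f'' : x'' ⟶ y''} {p : x ⟶ x'} {q : y ⟶ y'} {p' : x' ⟶ x''} {q' : y' ⟶ y''}
    (h : f ≫ q = p ≫ f') (h' : f' ≫ q' = p' ≫ f'') :
    (α_ f q q').inv ≫ (eqToIso h).hom ▷ q' ≫ (α_ p f' q').hom ≫ p ◁ (eqToIso h').hom ≫
      (α_ p p' f'').inv = eqToHom (by
        rw [← Strict.assoc, h, Strict.assoc, h', Strict.assoc]) := by
  simp [Strict.associator_eqToIso]

variable (A K) in
/-- The pseudonatural transformations between 2-functors which are 2-natural, i.e. whose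
pseudonaturality isomorphisms are identities. -/
def twoNatural [Strict K] :
    OneCellClass (fun F : StrictPseudofunctor A K => F.toPseudofunctor) where
  holds α := ∀ ⦃a b : A⦄ (f : a ⟶ b), ∃ h, α.naturality f = eqToIso h
  id_holds F a b f := ⟨(Strict.comp_id _).trans (Strict.id_comp _).symm, by
    change ρ_ (F.map f) ≪≫ (λ_ (F.map f)).symm = _
    rw [Strict.leftUnitor_eqToIso, Strict.rightUnitor_eqToIso]
    exact Iso.ext (eqToHom_trans (Strict.comp_id _) (Strict.id_comp _).symm)⟩
  comp_holds {F G H α β} hα hβ a b f := by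
    obtain ⟨h, e⟩ := hα f
    obtain ⟨h', e'⟩ := hβ f
    refine ⟨?_, ?_⟩
    · simp only [Pseudofunctor.StrongTrans.comp_app]
      rw [← Strict.assoc, h, Strict.assoc, h', Strict.assoc]
    · ext
      rw [Pseudofunctor.StrongTrans.categoryStruct_comp_naturality_hom, e, e']
      exact twoNatural_aux h h'

lemma map₂_associator_inv (i : K ⥤ᵖ L) {a b c d : K} (f : a ⟶ b) (g : b ⟶ c) (h : c ⟶ d) :
    i.map₂ (α_ f g h).inv = (i.mapComp f (g ≫ h)).hom ≫ i.map f ◁ (i.mapComp g h).hom ≫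
      (α_ (i.map f) (i.map g) (i.map h)).inv ≫ (i.mapComp f g).inv ▷ i.map h ≫
      (i.mapComp (f ≫ g) h).inv := by
  rw [i.map₂_iso_inv]
  apply IsIso.inv_eq_of_hom_inv_id
  simp

lemma postcomp_aux_id (i : K ⥤ᵖ L) {x x' : K} (p : x ⟶ x') {k : x ⟶ x} {k' : x' ⟶ x'}
    (m : k ⟶ 𝟙 x) (m' : k' ⟶ 𝟙 x') (n : k ≫ p ⟶ p ≫ k')
    (h : n ≫ p ◁ m' = m ▷ p ≫ (λ_ p).hom ≫ (ρ_ p).inv) :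
    ((i.mapComp k p).inv ≫ i.map₂ n ≫ (i.mapComp p k').hom) ≫
        i.map p ◁ (i.map₂ m' ≫ (i.mapId x').hom) =
      (i.map₂ m ≫ (i.mapId x).hom) ▷ i.map p ≫ (λ_ (i.map p)).hom ≫ (ρ_ (i.map p)).inv := by
  have h' : n ≫ p ◁ m' ≫ (ρ_ p).hom = m ▷ p ≫ (λ_ p).hom := by
    rw [reassoc_of% h]; simp
  have h'' := congrArg i.map₂ h'
  simp only [PrelaxFunctor.map₂_comp, i.map₂_whisker_left, i.map₂_whisker_right,
    i.map₂_left_unitor, i.map₂_right_unitor, Category.assoc, Iso.inv_hom_id_assoc] at h''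
  rw [← cancel_mono (ρ_ (i.map p)).hom, ← cancel_epi (i.mapComp k p).hom]
  simp only [Category.assoc, Iso.hom_inv_id_assoc, whiskerLeft_comp, comp_whiskerRight,
    Iso.inv_hom_id, Category.comp_id]
  exact h''

lemma postcomp_aux_comp (i : K ⥤ᵖ L) {x y z x' y' z' : K} {p : x ⟶ x'} {q : y ⟶ y'}
    {r : z ⟶ z'} {f : x ⟶ y} {g : y ⟶ z} {k : x ⟶ z} {f' : x' ⟶ y'} {g' : y' ⟶ z'}
    {k' : x' ⟶ z'} (m : k ⟶ f ≫ g) (m' : k' ⟶ f' ≫ g') (n : f ≫ q ⟶ p ≫ f')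
    (n' : g ≫ r ⟶ q ≫ g') (n'' : k ≫ r ⟶ p ≫ k')
    (h : n'' ≫ p ◁ m' = m ▷ r ≫ (α_ f g r).hom ≫ f ◁ n' ≫ (α_ f q g').inv ≫ n ▷ g' ≫
      (α_ p f' g').hom) :
    ((i.mapComp k r).inv ≫ i.map₂ n'' ≫ (i.mapComp p k').hom) ≫
        i.map p ◁ (i.map₂ m' ≫ (i.mapComp f' g').hom) =
      (i.map₂ m ≫ (i.mapComp f g).hom) ▷ i.map r ≫ (α_ _ _ _).hom ≫
        i.map f ◁ ((i.mapComp g r).inv ≫ i.map₂ n' ≫ (i.mapComp q g').hom) ≫ (α_ _ _ _).inv ≫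
        ((i.mapComp f q).inv ≫ i.map₂ n ≫ (i.mapComp p f').hom) ▷ i.map g' ≫
          (α_ _ _ _).hom := by
  have h' := congrArg i.map₂ h
  simp only [PrelaxFunctor.map₂_comp, i.map₂_whisker_left, i.map₂_whisker_right,
    i.map₂_associator, map₂_associator_inv, Category.assoc, Iso.inv_hom_id_assoc] at h'
  rw [← cancel_epi (i.mapComp k r).hom, ← cancel_mono (i.map p ◁ (i.mapComp f' g').inv),
    ← cancel_mono (i.mapComp p (f' ≫ g')).inv]
  simp only [Category.assoc, Iso.hom_inv_id_assoc, whiskerLeft_comp, comp_whiskerRight,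
    whiskerLeft_hom_inv_assoc, h']

/-- The pseudonatural transformation obtained by applying a pseudofunctor `i`. -/
def postcompTrans (i : K ⥤ᵖ L) {F G : A ⥤ᵖ K} (α : F ⟶ G) : F.comp i ⟶ G.comp i where
  app a := i.map (α.app a)
  naturality {a b} f := (i.mapComp (F.map f) (α.app b)).symm ≪≫ i.map₂Iso (α.naturality f) ≪≫
    i.mapComp (α.app a) (G.map f)
  naturality_naturality {a b f g} η := by
    have h := congrArg i.map₂ (α.naturality_naturality η)
    change i.map₂ (F.map₂ η) ▷ i.map (α.app b) ≫ (i.mapComp _ _).inv ≫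
        i.map₂ (α.naturality g).hom ≫ (i.mapComp _ _).hom =
      ((i.mapComp _ _).inv ≫ i.map₂ (α.naturality f).hom ≫ (i.mapComp _ _).hom) ≫
        i.map (α.app a) ◁ i.map₂ (G.map₂ η)
    rw [i.map₂_comp, i.map₂_comp, i.map₂_whisker_left, i.map₂_whisker_right] at h
    simp only [Category.assoc] at h ⊢
    rw [← cancel_epi (i.mapComp (F.map f) (α.app b)).hom, reassoc_of% h]
    simp
  naturality_id a := by
    change ((i.mapComp _ _).inv ≫ i.map₂ (α.naturality (𝟙 a)).hom ≫ (i.mapComp _ _).hom) ≫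
        i.map (α.app a) ◁ (i.map₂ (G.mapId a).hom ≫ (i.mapId _).hom) =
      (i.map₂ (F.mapId a).hom ≫ (i.mapId _).hom) ▷ i.map (α.app a) ≫
        (λ_ (i.map (α.app a))).hom ≫ (ρ_ (i.map (α.app a))).inv
    exact postcomp_aux_id i _ _ _ _ (α.naturality_id a)
  naturality_comp {a b c} f g := by
    change ((i.mapComp _ _).inv ≫ i.map₂ (α.naturality (f ≫ g)).hom ≫ (i.mapComp _ _).hom) ≫
        i.map (α.app a) ◁ (i.map₂ (G.mapComp f g).hom ≫ (i.mapComp _ _).hom) =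
      (i.map₂ (F.mapComp f g).hom ≫ (i.mapComp _ _).hom) ▷ i.map (α.app c) ≫
        (α_ _ _ _).hom ≫ i.map (F.map f) ◁ ((i.mapComp _ _).inv ≫
          i.map₂ (α.naturality g).hom ≫ (i.mapComp _ _).hom) ≫ (α_ _ _ _).inv ≫
        ((i.mapComp _ _).inv ≫ i.map₂ (α.naturality f).hom ≫ (i.mapComp _ _).hom) ▷
          i.map (G.map g) ≫ (α_ _ _ _).hom
    exact postcomp_aux_comp i _ _ _ _ _ (α.naturality_comp f g)

lemma postcomp_aux_mod (i : K ⥤ᵖ L) {x y x' y' : K} {p p' : x ⟶ x'} {q q' : y ⟶ y'}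
    {f : x ⟶ y} {f' : x' ⟶ y'} (n : f ≫ q ⟶ p ≫ f') (n' : f ≫ q' ⟶ p' ≫ f')
    (s : p ⟶ p') (t : q ⟶ q') (h : f ◁ t ≫ n' = n ≫ s ▷ f') :
    i.map f ◁ i.map₂ t ≫ (i.mapComp f q').inv ≫ i.map₂ n' ≫ (i.mapComp p' f').hom =
      ((i.mapComp f q).inv ≫ i.map₂ n ≫ (i.mapComp p f').hom) ≫ i.map₂ s ▷ i.map f' := by
  have h' := congrArg i.map₂ h
  simp only [PrelaxFunctor.map₂_comp, i.map₂_whisker_left, i.map₂_whisker_right,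
    Category.assoc] at h'
  rw [← cancel_epi (i.mapComp f q).hom, reassoc_of% h']
  simp

lemma postcomp_aux_mapId (i : K ⥤ᵖ L) {x y : K} (f : x ⟶ y) :
    i.map f ◁ (i.mapId y).hom ≫ (ρ_ (i.map f)).hom ≫ (λ_ (i.map f)).inv =
      ((i.mapComp f (𝟙 y)).inv ≫ i.map₂ ((ρ_ f).hom ≫ (λ_ f).inv) ≫
        (i.mapComp (𝟙 x) f).hom) ≫ (i.mapId x).hom ▷ i.map f := by
  rw [i.whiskerRight_mapId_hom, i.whiskerLeft_mapId_hom]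
  simp only [PrelaxFunctor.map₂_comp, Category.assoc, Iso.hom_inv_id_assoc, Iso.inv_hom_id_assoc,
    PrelaxFunctor.map₂_inv_hom_assoc]

lemma postcomp_aux_mapComp (i : K ⥤ᵖ L) {x x' x'' y y' y'' : K} {f : x ⟶ y} {f' : x' ⟶ y'}
    {f'' : x'' ⟶ y''} {p : x ⟶ x'} {q : y ⟶ y'} {p' : x' ⟶ x''} {q' : y' ⟶ y''}
    (n : f ≫ q ⟶ p ≫ f') (n' : f' ≫ q' ⟶ p' ≫ f'') :
    i.map f ◁ (i.mapComp q q').hom ≫ (α_ (i.map f) (i.map q) (i.map q')).inv ≫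
        ((i.mapComp f q).inv ≫ i.map₂ n ≫ (i.mapComp p f').hom) ▷ i.map q' ≫
        (α_ (i.map p) (i.map f') (i.map q')).hom ≫
        i.map p ◁ ((i.mapComp f' q').inv ≫ i.map₂ n' ≫ (i.mapComp p' f'').hom) ≫
        (α_ (i.map p) (i.map p') (i.map f'')).inv =
      ((i.mapComp f (q ≫ q')).inv ≫ i.map₂ ((α_ f q q').inv ≫ n ▷ q' ≫ (α_ p f' q').hom ≫
        p ◁ n' ≫ (α_ p p' f'').inv) ≫ (i.mapComp (p ≫ p') f'').hom) ≫
        (i.mapComp p p').hom ▷ i.map f'' := by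
  simp [map₂_associator_inv]

variable (A K) in
/-- `[A, K]`: the 2-category of 2-functors, 2-natural transformations and modifications. -/
abbrev TwoFunctorCat [Strict K] := LocallyFull (twoNatural A K)

/-- Postcomposition with a pseudofunctor, between 2-categories of pseudofunctors,
pseudonatural transformations and modifications. -/
def postcompPseudo (A : Type u₁) [Bicategory.{w₁, v₁} A] (i : K ⥤ᵖ L) :
    (A ⥤ᵖ K) ⥤ᵖ (A ⥤ᵖ L) where
  obj F := F.comp i
  map α := postcompTrans i α
  map₂ Γ := ⟨{
    app a := i.map₂ (Γ.as.app a)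
    naturality f := postcomp_aux_mod i _ _ _ _ (Γ.as.naturality f) }⟩
  map₂_id α := by
    ext a; exact i.map₂_id _
  map₂_comp Γ Γ' := by
    ext a; exact i.map₂_comp _ _
  mapId F := Pseudofunctor.StrongTrans.isoMk (fun a => i.mapId (F.obj a))
    (fun f => postcomp_aux_mapId i (F.map f))
  mapComp α β := Pseudofunctor.StrongTrans.isoMk (fun a => i.mapComp (α.app a) (β.app a))
    (fun f => postcomp_aux_mapComp i (α.naturality f).hom (β.naturality f).hom)
  map₂_whisker_left α _ _ Γ := by
    ext a; exact i.map₂_whisker_left _ _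
  map₂_whisker_right Γ α := by
    ext a; exact i.map₂_whisker_right _ _
  map₂_associator α β γ := by
    ext a; exact i.map₂_associator _ _ _
  map₂_left_unitor α := by
    ext a; exact i.map₂_left_unitor _
  map₂_right_unitor α := by
    ext a; exact i.map₂_right_unitor _

/-- Postcomposition with a 2-functor `i`: the 2-functor `i_* : Bicat(A, K) ⟶ Bicat(A, L)`. -/
def postcomp (A : Type u₁) [Bicategory.{w₁, v₁} A] (i : StrictPseudofunctor K L) :
    StrictPseudofunctor (A ⥤ᵖ K) (A ⥤ᵖ L) where
  __ := postcompPseudo A i.toPseudofunctor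
  map_id F := eq_of_modification ((postcompPseudo A i.toPseudofunctor).mapId F).hom
    (fun a => i.map_id (F.obj a)) (fun a => by
      change (i.mapId _).hom = _
      rw [i.mapId_eq_eqToIso]; rfl)
  mapId_eq_eqToIso F := by
    ext a
    simp only [eqToIso.hom, eqToHom_as_app]
    change (i.mapId _).hom = _
    rw [i.mapId_eq_eqToIso]; rfl
  map_comp α β := eq_of_modification ((postcompPseudo A i.toPseudofunctor).mapComp α β).hom
    (fun a => i.map_comp (α.app a) (β.app a)) (fun a => by
      change (i.mapComp _ _).hom = _
      rw [i.mapComp_eq_eqToIso]; rfl)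
  mapComp_eq_eqToIso α β := by
    ext a
    simp only [eqToIso.hom, eqToHom_as_app]
    change (i.mapComp _ _).hom = _
    rw [i.mapComp_eq_eqToIso]; rfl

end FunctorBicategory

section TwoAdjunction

variable {B : Type u₁} [Bicategory.{w₁, v₁} B] {C : Type u₂} [Bicategory.{w₂, v₂} C]

/-- A 2-natural transformation between 2-functors. -/
structure TwoNatTrans (F G : StrictPseudofunctor B C) where
  app (b : B) : F.obj b ⟶ G.obj b
  naturality {b b' : B} (f : b ⟶ b') : F.map f ≫ app b' = app b ≫ G.map f
  naturality₂ {b b' : B} {f g : b ⟶ b'} (η : f ⟶ g) :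
    F.map₂ η ▷ app b' ≫ eqToHom (naturality g) = eqToHom (naturality f) ≫ app b ◁ G.map₂ η

/-- A 2-adjunction `L ⊣ R` between 2-categories: 2-natural unit and counit satisfying the triangle
identities on the nose. -/
structure TwoAdjunction [Strict B] [Strict C] (L : StrictPseudofunctor B C)
    (R : StrictPseudofunctor C B) where
  unit : TwoNatTrans (StrictPseudofunctor.id B) (L.comp R)
  counit : TwoNatTrans (R.comp L) (StrictPseudofunctor.id C)
  left_triangle (b : B) : L.map (unit.app b) ≫ counit.app (L.obj b) = 𝟙 (L.obj b)
  right_triangle (c : C) : unit.app (R.obj c) ≫ R.map (counit.app c) = 𝟙 (R.obj c)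

/-- A 1-cell `f` is an internal equivalence if it has an inverse up to invertible 2-cells. -/
def IsInternalEquivalence {a b : B} (f : a ⟶ b) : Prop :=
  ∃ g : b ⟶ a, Nonempty (f ≫ g ≅ 𝟙 a) ∧ Nonempty (g ≫ f ≅ 𝟙 b)

end TwoAdjunction

section Inclusion

open scoped Pseudofunctor.StrongTrans

/-- A pseudofunctor is a (strict) 2-functor if its structure isomorphisms are identities. -/
def IsTwoFunctor {B : Type u₁} [Bicategory.{w₁, v₁} B] {C : Type u₂} [Bicategory.{w₂, v₂} C]
    (F : B ⥤ᵖ C) : Prop :=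
  (∀ a, ∃ h, F.mapId a = eqToIso h) ∧
    ∀ ⦃a b c : B⦄ (f : a ⟶ b) (g : b ⟶ c), ∃ h, F.mapComp f g = eqToIso h

/-- The 2-functors among the 1-cells of `2Cat_{p,i}`. -/
def twoFunctors : OneCellClass (fun X : TwoCatPI.{u} => X) where
  holds F := IsTwoFunctor F.fn
  id_holds _ := ⟨fun _ => ⟨rfl, rfl⟩, fun _ _ _ _ _ => ⟨rfl, rfl⟩⟩
  comp_holds {X Y Z F G} hF hG := by
    refine ⟨fun a => ?_, fun a b c f g => ?_⟩
    · obtain ⟨h, e⟩ := hF.1 a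
      obtain ⟨h', e'⟩ := hG.1 (F.fn.obj a)
      refine ⟨(congrArg G.fn.map h).trans h', ?_⟩
      change G.fn.map₂Iso (F.fn.mapId a) ≪≫ G.fn.mapId (F.fn.obj a) = _
      rw [e, e', PrelaxFunctor.map₂Iso_eqToIso]
      exact eqToIso_trans _ _
    · obtain ⟨h, e⟩ := hF.2 f g
      obtain ⟨h', e'⟩ := hG.2 (F.fn.map f) (F.fn.map g)
      refine ⟨(congrArg G.fn.map h).trans h', ?_⟩
      change G.fn.map₂Iso (F.fn.mapComp f g) ≪≫ G.fn.mapComp (F.fn.map f) (F.fn.map g) = _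
      rw [e, e', PrelaxFunctor.map₂Iso_eqToIso]
      exact eqToIso_trans _ _

/-- The 2-category `2Cat_{2,i}` of small 2-categories, 2-functors and icons. -/
abbrev TwoCatTwoI := LocallyFull twoFunctors.{u}

/-- The inclusion 2-functor `J : [A, 2Cat_{2,i}] ⟶ Bicat(A, 2Cat_{p,i})`. -/
def inclusionJ (A : Type u) [Bicategory.{u, u} A] :
    StrictPseudofunctor (TwoFunctorCat A TwoCatTwoI.{u}) (A ⥤ᵖ TwoCatPI.{u}) :=
  (LocallyFull.inclusion (twoNatural A TwoCatTwoI.{u})).comp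
    (postcomp A (LocallyFull.inclusion twoFunctors.{u}))

end Inclusion

end TwoDim

open TwoDim

open scoped Pseudofunctor.StrongTrans

/-! The left adjoint freely adds strict images of 1-cells. For a pseudofunctor `X`, the 2-category
`QX(a)` has the objects of `X a`. Its 1-cells are composable strings of formal cells `f(v)`, with `f
: b ⟶ a` in `A` and `v` a 1-cell of `X b`. Its 2-cells are the 2-cells of `X a` between the
evaluated strings, where `f(v)` evaluates to `X f v`. A 1-cell `g` of `A` acts by `f(v) ↦ (f ≫
g)(v)`. This has the right ends because an icon forces `X (f ≫ g)` and `X f ≫ X g` to agree on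
objects. The action preserves concatenation, so it is a 2-functor, and it is strictly functorial in
`g` because `A` is strict. Evaluation `QX(a) ⟶ X a` is a 2-functor, the identity on objects and
fully faithful on 2-cells.

Two principles carry the argument. Icons into `QX(a)` lift uniquely along evaluation (`liftHom₂`,
`whiskerRight_evalHom_injective`). An icon between 2-functors out of `QX(a)` whose components at
formal cells are identities has only identity components (`strictObj_isEqToHom_arr`), and then its
source and target are equal (`isEqToHom_of_arr`). Strict equations are therefore proved by building
a comparison icon from the coherence of `X` and inspecting it at the formal cells.

The unit sends `v` to `1(v)` and is pointwise inverse to evaluation. Evaluation is pseudonatural and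
locally faithful, so these inverses are pseudonatural too (`PointwiseInverse`), and the unit is an
internal equivalence.

A transformation `σ : X ⟶ JY` extends to `QX` by `f(v) ↦ (Y f)(σ v)`. This extension is isomorphic
to evaluation followed by `σ`, hence pseudonatural. At formal cells the coherence of `σ` and the
strictness of `Y` leave only identities, so the extension is 2-natural and restricts exactly to `σ`
(`isEqToHom_extTrans_naturality`, `unitTrans_comp_extTrans`). It is unique because `f(v)` is the
image of `1(v)` under `QX(f)` (`extend_unique`). The universal property for 2-cells holds because
the unit is an equivalence and `J` is locally fully faithful. Universal arrows of this kind yield a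
2-adjunction (`UniversalArrows.adjunction`), and the triangle identity at `JY` transfers the
equivalence from the unit to the counit.

Equality of ends is handled throughout by `Arr`, where components of icons become plain morphisms
and "is an identity" means "is an `eqToHom`". -/

namespace TwoDim

/-! ### Arrow categories: icons as families of morphisms without transport -/

section ArrowCategory

variable {B : Type u₁} [Bicategory.{w₁, v₁} B] {C : Type u₂} [Bicategory.{w₂, v₂} C]
  {D : Type u₃} [Bicategory.{w₃, v₃} D]

variable (C) in
/-- The disjoint union of the hom-categories of a bicategory. -/
structure Arr where
  of ::
  {src : C}
  {tgt : C}
  hom : src ⟶ tgt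

namespace Arr

/-- A 2-cell between 1-cells with propositionally equal ends. -/
structure Hom (p q : Arr C) where
  src_eq : p.src = q.src
  tgt_eq : p.tgt = q.tgt
  cell : p.hom ⟶ (homCast src_eq tgt_eq).obj q.hom

instance : Category (Arr C) where
  Hom := Hom
  id p := ⟨rfl, rfl, 𝟙 p.hom⟩
  comp m n := ⟨m.src_eq.trans n.src_eq, m.tgt_eq.trans n.tgt_eq,
    m.cell ≫ (homCast m.src_eq m.tgt_eq).map n.cell ≫ eqToHom (homCast_trans _ _ _ _ _)⟩
  id_comp {p q} m := by
    obtain ⟨h, h', m⟩ := m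
    obtain ⟨f⟩ := p
    obtain ⟨g⟩ := q
    dsimp only at h h'
    subst h h'
    simp [homCast]
  comp_id {p q} m := by
    obtain ⟨h, h', m⟩ := m
    obtain ⟨f⟩ := p
    obtain ⟨g⟩ := q
    dsimp only at h h'
    subst h h'
    simp [homCast]
  assoc {p q r s} m n k := by
    obtain ⟨h, h', m⟩ := m
    obtain ⟨i, i', n⟩ := n
    obtain ⟨j, j', k⟩ := k
    obtain ⟨f⟩ := p
    obtain ⟨g⟩ := q
    obtain ⟨r⟩ := r
    obtain ⟨s⟩ := s
    dsimp only at h h' i i' j j'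
    subst h h' i i' j j'
    simp [homCast]

/-- A 2-cell as a morphism of the arrow category. -/
def ofCell {a b : C} {f g : a ⟶ b} (η : f ⟶ g) : of f ⟶ of g := ⟨rfl, rfl, η⟩

lemma ofCell_id {a b : C} (f : a ⟶ b) : ofCell (𝟙 f) = 𝟙 (of f) := rfl

lemma ofCell_comp {a b : C} {f g h : a ⟶ b} (η : f ⟶ g) (θ : g ⟶ h) :
    ofCell (η ≫ θ) = ofCell η ≫ ofCell θ := by
  change ofCell (η ≫ θ) = ofCell (η ≫ θ ≫ 𝟙 _)
  simp

lemma ofCell_comp_assoc {a b : C} {f g h : a ⟶ b} (η : f ⟶ g) (θ : g ⟶ h) {z : Arr C}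
    (m : of h ⟶ z) : ofCell (η ≫ θ) ≫ m = ofCell η ≫ ofCell θ ≫ m := by
  rw [ofCell_comp, Category.assoc]

lemma ofCell_injective {a b : C} {f g : a ⟶ b} {η θ : f ⟶ g} (h : ofCell η = ofCell θ) :
    η = θ := by
  injection h

lemma ofCell_eqToHom {a b : C} {f g : a ⟶ b} (h : f = g) :
    ofCell (eqToHom h) = eqToHom (congrArg of h) := by
  subst h; rfl

/-- The 2-cell underlying a morphism between parallel 1-cells. -/
def toCell {a b : C} {f g : a ⟶ b} (m : of f ⟶ of g) : f ⟶ g := m.cell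

@[simp]
lemma toCell_ofCell {a b : C} {f g : a ⟶ b} (η : f ⟶ g) : toCell (ofCell η) = η := rfl

@[simp]
lemma ofCell_toCell {a b : C} {f g : a ⟶ b} (m : of f ⟶ of g) : ofCell (toCell m) = m := rfl

/-- An invertible 2-cell as an isomorphism of the arrow category. -/
def ofIso {a b : C} {f g : a ⟶ b} (e : f ≅ g) : of f ≅ of g where
  hom := ofCell e.hom
  inv := ofCell e.inv
  hom_inv_id := by rw [← ofCell_comp, e.hom_inv_id, ofCell_id]
  inv_hom_id := by rw [← ofCell_comp, e.inv_hom_id, ofCell_id]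

instance {a b : C} {f g : a ⟶ b} (η : f ⟶ g) [IsIso η] : IsIso (ofCell η) :=
  (ofIso (asIso η)).isIso_hom

/-- The invertible 2-cell underlying an isomorphism between parallel 1-cells. -/
def toIso {a b : C} {f g : a ⟶ b} (e : of f ≅ of g) : f ≅ g where
  hom := toCell e.hom
  inv := toCell e.inv
  hom_inv_id := ofCell_injective (by simp [ofCell_comp, ofCell_id])
  inv_hom_id := ofCell_injective (by simp [ofCell_comp, ofCell_id])

lemma of_homCast {a a' b b' : C} (h : a = a') (h' : b = b') (f : a' ⟶ b') :
    of ((homCast h h').obj f) = of f := by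
  subst h h'; rfl

/-- With the ends free variables, their equalities can be substituted away, so a claim about arrow
morphisms need only be checked on genuine 2-cells. -/
lemma hom_induction {P : ∀ {a b a' b' : C} {f : a ⟶ b} {g : a' ⟶ b'}, (of f ⟶ of g) → Prop}
    (h : ∀ {a b : C} {f g : a ⟶ b} (η : f ⟶ g), P (ofCell η)) {a b a' b' : C} {f : a ⟶ b}
    {g : a' ⟶ b'} (m : of f ⟶ of g) : P m := by
  obtain ⟨i, i', m⟩ := m
  dsimp only at i i'
  subst i i'
  exact h m

/-- The action of a pseudofunctor on 2-cells between 1-cells with equal ends. -/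
def map (F : B ⥤ᵖ C) {a b a' b' : B} {f : a ⟶ b} {g : a' ⟶ b'} (m : of f ⟶ of g) :
    of (F.map f) ⟶ of (F.map g) :=
  ⟨congrArg F.obj m.src_eq, congrArg F.obj m.tgt_eq,
    F.map₂ m.cell ≫ eqToHom (map_homCast F _ _ _)⟩

lemma map_ofCell (F : B ⥤ᵖ C) {a b : B} {f g : a ⟶ b} (η : f ⟶ g) :
    map F (ofCell η) = ofCell (F.map₂ η) := congrArg ofCell (Category.comp_id _)

@[simp]
lemma map_id (F : B ⥤ᵖ C) {a b : B} (f : a ⟶ b) : map F (𝟙 (of f)) = 𝟙 (of (F.map f)) := by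
  rw [← ofCell_id, map_ofCell, F.map₂_id, ofCell_id]

lemma map_comp (F : B ⥤ᵖ C) {a b a' b' a'' b'' : B} {f : a ⟶ b} {g : a' ⟶ b'} {h : a'' ⟶ b''}
    (m : of f ⟶ of g) (n : of g ⟶ of h) : map F (m ≫ n) = map F m ≫ map F n := by
  obtain ⟨i, i', m⟩ := m
  obtain ⟨j, j', n⟩ := n
  dsimp only at i i' j j'
  subst i i' j j'
  change map F (ofCell m ≫ ofCell n) = map F (ofCell m) ≫ map F (ofCell n)
  rw [← ofCell_comp, map_ofCell, map_ofCell, map_ofCell, F.map₂_comp, ofCell_comp]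

lemma of_map_congr (F : B ⥤ᵖ C) {a b a' b' : B} {f : a ⟶ b} {g : a' ⟶ b'} (h : of f = of g) :
    of (F.map f) = of (F.map g) := by
  cases h; rfl

lemma map_eqToHom (F : B ⥤ᵖ C) {a b a' b' : B} {f : a ⟶ b} {g : a' ⟶ b'} (h : of f = of g) :
    map F (eqToHom h) = eqToHom (of_map_congr F h) := by
  cases h; exact map_id F f

lemma map_id_map {a b a' b' : B} {f : a ⟶ b} {g : a' ⟶ b'} (m : of f ⟶ of g) :
    map (Pseudofunctor.id B) m = m :=
  hom_induction (P := fun m => map (Pseudofunctor.id _) m = m) (fun η => by rw [map_ofCell]; rfl) m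

lemma map_comp_map (F : B ⥤ᵖ C) (G : C ⥤ᵖ D) {a b a' b' : B} {f : a ⟶ b} {g : a' ⟶ b'}
    (m : of f ⟶ of g) : map (F.comp G) m = map G (map F m) :=
  hom_induction (P := fun m => map (F.comp G) m = map G (map F m))
    (fun η => by rw [map_ofCell, map_ofCell, map_ofCell]; rfl) m

/-- The action of a pseudofunctor on isomorphisms of the arrow category. -/
@[simps]
def mapIso (F : B ⥤ᵖ C) {a b a' b' : B} {f : a ⟶ b} {g : a' ⟶ b'} (m : of f ≅ of g) :
    of (F.map f) ≅ of (F.map g) where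
  hom := map F m.hom
  inv := map F m.inv
  hom_inv_id := by rw [← map_comp, m.hom_inv_id, map_id]
  inv_hom_id := by rw [← map_comp, m.inv_hom_id, map_id]

/-- Horizontal composition in the arrow category. -/
def hcomp {a b c a' b' c' : C} {f : a ⟶ b} {g : b ⟶ c} {f' : a' ⟶ b'} {g' : b' ⟶ c'}
    (m : of f ⟶ of f') (n : of g ⟶ of g') : of (f ≫ g) ⟶ of (f' ≫ g') :=
  ⟨m.src_eq, n.tgt_eq, m.cell ▷ g ≫ (homCast m.src_eq m.tgt_eq).obj f' ◁ n.cell ≫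
    eqToHom (homCast_comp m.src_eq m.tgt_eq n.tgt_eq f' g').symm⟩

lemma hcomp_ofCell {a b c : C} {f f' : a ⟶ b} {g g' : b ⟶ c} (η : f ⟶ f') (θ : g ⟶ g') :
    hcomp (ofCell η) (ofCell θ) = ofCell (η ▷ g ≫ f' ◁ θ) := by
  change ofCell (η ▷ g ≫ f' ◁ θ ≫ 𝟙 _) = _
  rw [Category.comp_id]

lemma hcomp_induction {P : ∀ {a b c a' b' c' : C} {f : a ⟶ b} {g : b ⟶ c} {f' : a' ⟶ b'}
    {g' : b' ⟶ c'} (_ : of f ⟶ of f') (_ : of g ⟶ of g'), Prop}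
    (h : ∀ {a b c : C} {f f' : a ⟶ b} {g g' : b ⟶ c} (η : f ⟶ f') (θ : g ⟶ g'),
      P (ofCell η) (ofCell θ)) {a b c a' b' c' : C} {f : a ⟶ b} {g : b ⟶ c} {f' : a' ⟶ b'}
    {g' : b' ⟶ c'} (m : of f ⟶ of f') (n : of g ⟶ of g') : P m n := by
  obtain ⟨i, i', m⟩ := m
  obtain ⟨j, j', n⟩ := n
  dsimp only at i i' j j'
  -- The equality `j` concerns the shared middle object and becomes trivial once `i'` is
  -- substituted.
  subst i i' j'
  exact h m n

lemma map_hcomp (F : B ⥤ᵖ C) {a b c a' b' c' : B} {f : a ⟶ b} {g : b ⟶ c} {f' : a' ⟶ b'}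
    {g' : b' ⟶ c'} (m : of f ⟶ of f') (n : of g ⟶ of g') :
    map F (hcomp m n) ≫ ofCell (F.mapComp f' g').hom =
      ofCell (F.mapComp f g).hom ≫ hcomp (map F m) (map F n) := by
  refine hcomp_induction (P := fun {a b c a' b' c' f g f' g'} m n =>
    map F (hcomp m n) ≫ ofCell (F.mapComp f' g').hom =
      ofCell (F.mapComp f g).hom ≫ hcomp (map F m) (map F n)) (fun η θ => ?_) m n
  rw [hcomp_ofCell, map_ofCell, map_ofCell, map_ofCell, hcomp_ofCell, ← ofCell_comp,
    ← ofCell_comp]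
  simp

lemma hcomp_eqToHom {a b c a' b' c' : C} {f : a ⟶ b} {g : b ⟶ c} {f' : a' ⟶ b'} {g' : b' ⟶ c'}
    {m : of f ⟶ of f'} {n : of g ⟶ of g'} (h : of f = of f') (hm : m = eqToHom h)
    (h' : of g = of g') (hn : n = eqToHom h') :
    ∃ h'' : of (f ≫ g) = of (f' ≫ g'), hcomp m n = eqToHom h'' := by
  cases h
  cases h'
  subst hm hn
  exact ⟨rfl, (hcomp_ofCell (𝟙 f) (𝟙 g)).trans (by simp [ofCell_id])⟩

end Arr

/-- The natural transformation between arrow categories induced by an icon. -/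
def Icon.arr {F G : B ⥤ᵖ C} (α : Icon F G) {a b : B} (f : a ⟶ b) :
    Arr.of (F.map f) ⟶ Arr.of (G.map f) :=
  ⟨α.obj_eq a, α.obj_eq b, α.app f⟩

/-- This and the two `law_iff` lemmas translate between the transported axioms of `Icon` and plain
equations in the arrow category. The objects are variables here, so the equalities can be
eliminated. -/
lemma Icon.naturality_iff {x y x' y' : C} (hx : x = x') (hy : y = y') {f g : x ⟶ y}
    {f' g' : x' ⟶ y'} (m : f ⟶ g) (m' : f' ⟶ g') (p : Arr.of f ⟶ Arr.of f')
    (q : Arr.of g ⟶ Arr.of g') :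
    Arr.ofCell m ≫ q = p ≫ Arr.ofCell m' ↔ m ≫ q.cell = p.cell ≫ (homCast hx hy).map m' := by
  subst hx hy
  obtain ⟨_, _, p⟩ := p
  obtain ⟨_, _, q⟩ := q
  change f ⟶ f' at p
  change g ⟶ g' at q
  change Arr.ofCell m ≫ Arr.ofCell q = Arr.ofCell p ≫ Arr.ofCell m' ↔ m ≫ q = p ≫ m'
  rw [← Arr.ofCell_comp, ← Arr.ofCell_comp]
  exact ⟨fun h => Arr.ofCell_injective h, fun h => by rw [h]⟩

lemma Icon.arr_naturality_cell {F G : B ⥤ᵖ C} (α : Icon F G) {a b : B} {f g : a ⟶ b}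
    (η : f ⟶ g) :
    Arr.ofCell (F.map₂ η) ≫ α.arr g = α.arr f ≫ Arr.ofCell (G.map₂ η) :=
  (Icon.naturality_iff (α.obj_eq a) (α.obj_eq b) _ _ _ _).2 (α.naturality η)

lemma Icon.arr_naturality {F G : B ⥤ᵖ C} (α : Icon F G) {a b a' b' : B} {f : a ⟶ b}
    {g : a' ⟶ b'} (m : Arr.of f ⟶ Arr.of g) :
    Arr.map F m ≫ α.arr g = α.arr f ≫ Arr.map G m := by
  refine Arr.hom_induction (P := fun {a b a' b' f g} m =>
    Arr.map F m ≫ α.arr g = α.arr f ≫ Arr.map G m) (fun {a b f g} η => ?_) m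
  rw [Arr.map_ofCell, Arr.map_ofCell, Icon.arr_naturality_cell]

lemma Icon.id_law_iff {x x' : C} (h : x = x') {k : x ⟶ x} {k' : x' ⟶ x'}
    (m : k ⟶ 𝟙 x) (m' : k' ⟶ 𝟙 x') (r : Arr.of k ⟶ Arr.of k') :
    r ≫ Arr.ofCell m' = Arr.ofCell m ≫ eqToHom (congrArg (fun x => Arr.of (𝟙 x)) h) ↔
    r.cell ≫ (homCast h h).map m' ≫ eqToHom (homCast_id h) = m := by
  subst h
  obtain ⟨_, _, r⟩ := r
  change k ⟶ k' at r
  change Arr.ofCell r ≫ _ = Arr.ofCell m ≫ 𝟙 _ ↔ r ≫ m' ≫ 𝟙 _ = m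
  rw [← Arr.ofCell_comp, Category.comp_id, Category.comp_id]
  exact ⟨fun h => Arr.ofCell_injective h, fun h => by rw [h]⟩

lemma Icon.comp_law_iff {x y z x' y' z' : C} (hx : x = x') (hy : y = y') (hz : z = z')
    {f : x ⟶ y} {g : y ⟶ z} {k : x ⟶ z} {f' : x' ⟶ y'} {g' : y' ⟶ z'} {k' : x' ⟶ z'}
    (m : k ⟶ f ≫ g) (m' : k' ⟶ f' ≫ g') (p : Arr.of f ⟶ Arr.of f')
    (q : Arr.of g ⟶ Arr.of g') (r : Arr.of k ⟶ Arr.of k') :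
    r ≫ Arr.ofCell m' = Arr.ofCell m ≫ Arr.hcomp p q ↔
    r.cell ≫ (homCast hx hz).map m' ≫ eqToHom (homCast_comp hx hy hz f' g') =
      m ≫ p.cell ▷ g ≫ (homCast hx hy).obj f' ◁ q.cell := by
  subst hx hy hz
  obtain ⟨_, _, p⟩ := p
  obtain ⟨_, _, q⟩ := q
  obtain ⟨_, _, r⟩ := r
  change f ⟶ f' at p
  change g ⟶ g' at q
  change k ⟶ k' at r
  change Arr.ofCell r ≫ _ = _ ≫ Arr.hcomp (Arr.ofCell p) (Arr.ofCell q) ↔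
    r ≫ m' ≫ 𝟙 _ = m ≫ p ▷ g ≫ f' ◁ q
  rw [← Arr.ofCell_comp, Arr.hcomp_ofCell, ← Arr.ofCell_comp, Category.comp_id]
  exact ⟨fun h => Arr.ofCell_injective h, fun h => by rw [h]⟩

lemma Icon.arr_id {F G : B ⥤ᵖ C} (α : Icon F G) (a : B) :
    α.arr (𝟙 a) ≫ Arr.ofCell (G.mapId a).hom = Arr.ofCell (F.mapId a).hom ≫
      eqToHom (congrArg (fun x => Arr.of (𝟙 x)) (α.obj_eq a)) :=
  (Icon.id_law_iff (α.obj_eq a) _ _ _).2 (α.app_id a)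

lemma Icon.arr_comp {F G : B ⥤ᵖ C} (α : Icon F G) {a b c : B} (f : a ⟶ b) (g : b ⟶ c) :
    α.arr (f ≫ g) ≫ Arr.ofCell (G.mapComp f g).hom =
      Arr.ofCell (F.mapComp f g).hom ≫ Arr.hcomp (α.arr f) (α.arr g) :=
  (Icon.comp_law_iff (α.obj_eq a) (α.obj_eq b) (α.obj_eq c) _ _ _ _ _).2 (α.app_comp f g)

/-- The icon with given components in the arrow category. -/
def Icon.ofArr {F G : B ⥤ᵖ C} (hobj : ∀ a, F.obj a = G.obj a)
    (m : ∀ {a b : B} (f : a ⟶ b), Arr.of (F.map f) ⟶ Arr.of (G.map f))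
    (naturality : ∀ {a b : B} {f g : a ⟶ b} (η : f ⟶ g),
      Arr.ofCell (F.map₂ η) ≫ m g = m f ≫ Arr.ofCell (G.map₂ η))
    (id : ∀ a : B, m (𝟙 a) ≫ Arr.ofCell (G.mapId a).hom = Arr.ofCell (F.mapId a).hom ≫
      eqToHom (congrArg (fun x => Arr.of (𝟙 x)) (hobj a)))
    (comp : ∀ {a b c : B} (f : a ⟶ b) (g : b ⟶ c),
      m (f ≫ g) ≫ Arr.ofCell (G.mapComp f g).hom =
        Arr.ofCell (F.mapComp f g).hom ≫ Arr.hcomp (m f) (m g)) : Icon F G where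
  obj_eq := hobj
  app f := (m f).cell
  naturality {a b _ _} η :=
    (Icon.naturality_iff (hobj a) (hobj b) _ _ _ _).1 (naturality η)
  app_id a := (Icon.id_law_iff (hobj a) _ _ _).1 (id a)
  app_comp {a b c} f g :=
    (Icon.comp_law_iff (hobj a) (hobj b) (hobj c) _ _ _ _ _).1 (comp f g)

/-- Pseudofunctors are equal if there is an icon between them whose components are identities. -/
lemma Icon.eq_of_arr_eqToHom {F G : B ⥤ᵖ C} (α : Icon F G)
    (h : ∀ {a b : B} (f : a ⟶ b), ∃ e, α.arr f = eqToHom e) : F = G := by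
  obtain ⟨⟨⟨⟨Fo, Fm⟩, F₂⟩, Fi, Fc⟩, FI, FC, _, _, _, _, _⟩ := F
  obtain ⟨⟨⟨⟨Go, Gm⟩, G₂⟩, Gi, Gc⟩, GI, GC, _, _, _, _, _⟩ := G
  obtain rfl : Fo = Go := funext α.obj_eq
  obtain rfl : @Fm = @Gm := by
    funext a b f
    obtain ⟨e, -⟩ := h f
    injection e with _ _ e
  -- Source and target now coincide, so `eqToHom` is the identity by proof irrelevance. The three
  -- icon axioms then force the values on 2-cells and both constraints to agree.
  have h' : ∀ {a b : B} (f : a ⟶ b), α.arr f = 𝟙 _ := fun f => (h f).2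
  obtain rfl : @F₂ = @G₂ := by
    funext a b f g η
    have := α.arr_naturality_cell η
    rw [h', h'] at this
    erw [Category.comp_id, Category.id_comp] at this
    exact Arr.ofCell_injective this
  obtain rfl : FI = GI := by
    funext a
    have := α.arr_id a
    rw [h'] at this
    erw [Category.comp_id, Category.id_comp] at this
    exact Iso.ext (Arr.ofCell_injective this).symm
  obtain rfl : @FC = @GC := by
    funext a b c f g
    have := α.arr_comp f g
    rw [h', h', h'] at this
    erw [Arr.hcomp_ofCell (𝟙 _) (𝟙 _), id_whiskerRight, whiskerLeft_id, Category.comp_id,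
      Category.comp_id, Category.id_comp] at this
    exact Iso.ext (Arr.ofCell_injective this).symm
  rfl

end ArrowCategory

end TwoDim

namespace TwoDim

/-! ### The 2-category of strings of generators and its evaluation -/

section Presentations

variable {B : Type u₁} [Bicategory.{w₁, v₁} B] {C : Type u₂} [Bicategory.{w₂, v₂} C]
  {D : Type u₃} [Bicategory.{w₃, v₃} D]

variable (C) in
/-- A family of formal generators for the 1-cells of a bicategory. -/
structure Generators where
  Gen : C → C → Type v₁
  ev {x y : C} : Gen x y → (x ⟶ y)

namespace Generators

variable (P : Generators.{w₂, v₁, v₂} C)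

/-- Composable strings of generators. -/
inductive Word (x : C) : C → Type (max u₂ v₁)
  | nil : Word x x
  | cons {y z : C} (p : Word x y) (e : P.Gen y z) : Word x z

namespace Word

variable {P}

/-- The string consisting of one generator. -/
def single {x y : C} (e : P.Gen x y) : P.Word x y := nil.cons e

/-- Concatenation. -/
def comp {x y z : C} (p : P.Word x y) : P.Word y z → P.Word x z
  | nil => p
  | cons q e => (p.comp q).cons e

lemma comp_nil {x y : C} (p : P.Word x y) : p.comp nil = p := rfl

/-- Strings grow at the right end, so the right unit law is definitional and only this one needs
induction. -/
lemma nil_comp {x y : C} (p : P.Word x y) : nil.comp p = p := by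
  induction p with
  | nil => rfl
  | cons p e ih => exact congrArg (fun q => cons q e) ih

lemma comp_assoc {x y z w : C} (p : P.Word x y) (q : P.Word y z) (r : P.Word z w) :
    (p.comp q).comp r = p.comp (q.comp r) := by
  induction r with
  | nil => rfl
  | cons r e ih => exact congrArg (fun q => cons q e) ih

/-- The composite of a string of generators. -/
def eval {x y : C} : P.Word x y → (x ⟶ y)
  | nil => 𝟙 x
  | cons p e => p.eval ≫ P.ev e

lemma eval_comp [Strict C] {x y z : C} (p : P.Word x y) (q : P.Word y z) :
    (p.comp q).eval = p.eval ≫ q.eval := by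
  induction q with
  | nil => exact (Strict.comp_id _).symm
  | cons q e ih => exact (congrArg (· ≫ P.ev e) ih).trans (Strict.assoc _ _ _)

/-- The empty prefix contributes a factor `𝟙`, which strictness of `C` removes. -/
lemma eval_single [Strict C] {x y : C} (e : P.Gen x y) : (single e).eval = P.ev e :=
  Strict.id_comp _

end Word

/-- The 2-category with the objects of `C`, the strings of generators as 1-cells, and the 2-cells
of `C` between their composites as 2-cells. -/
@[ext]
structure Full (P : Generators.{w₂, v₁, v₂} C) where
  of ::
  base : C

namespace Full

variable {P}

instance : CategoryStruct P.Full where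
  Hom x y := P.Word x.base y.base
  id _ := Word.nil
  comp p q := Word.comp p q

/-- The composite in `C` of a 1-cell of `P.Full`. -/
def ev {x y : P.Full} (p : x ⟶ y) : x.base ⟶ y.base := Word.eval p

/-- The 2-cells of `P.Full`. -/
@[ext]
structure Cell {x y : P.Full} (p q : x ⟶ y) where
  val : ev p ⟶ ev q

instance homCategory (x y : P.Full) : Category (x ⟶ y) where
  Hom p q := Cell p q
  id p := ⟨𝟙 (ev p)⟩
  comp η θ := ⟨η.val ≫ θ.val⟩
  id_comp η := Cell.ext (Category.id_comp η.val)
  comp_id η := Cell.ext (Category.comp_id η.val)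
  assoc η θ κ := Cell.ext (Category.assoc η.val θ.val κ.val)

@[ext]
lemma cell_ext {x y : P.Full} {p q : x ⟶ y} {η θ : p ⟶ q} (h : η.val = θ.val) : η = θ :=
  Cell.ext h

@[simp]
lemma id_val {x y : P.Full} (p : x ⟶ y) : Cell.val (𝟙 p) = 𝟙 (ev p) := rfl

@[simp]
lemma comp_val {x y : P.Full} {p q r : x ⟶ y} (η : p ⟶ q) (θ : q ⟶ r) :
    Cell.val (η ≫ θ) = η.val ≫ θ.val := rfl

@[simp]
lemma eqToHom_val {x y : P.Full} {p q : x ⟶ y} (h : p = q) :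
    Cell.val (eqToHom h) = eqToHom (congrArg ev h) := by
  subst h; rfl

/-- Invertible 2-cells of `C` are invertible in `P.Full`. -/
@[simps]
def isoMk {x y : P.Full} {p q : x ⟶ y} (e : ev p ≅ ev q) : p ≅ q where
  hom := ⟨e.hom⟩
  inv := ⟨e.inv⟩

lemma ev_id (x : P.Full) : ev (𝟙 x) = 𝟙 x.base := rfl

variable [Strict C]

lemma ev_comp {x y z : P.Full} (p : x ⟶ y) (q : y ⟶ z) :
    ev (p ≫ q) = ev p ≫ ev q := Word.eval_comp p q

lemma whiskerLeft_congr {x y z : C} {f f' : x ⟶ y} (h : f = f') {g g' : y ⟶ z} (η : g ⟶ g') :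
    f ◁ η = eqToHom (h ▸ rfl) ≫ f' ◁ η ≫ eqToHom (h ▸ rfl) := by
  subst h; simp

lemma whiskerRight_congr {x y z : C} {f f' : x ⟶ y} (η : f ⟶ f') {g g' : y ⟶ z} (h : g = g') :
    η ▷ g = eqToHom (h ▸ rfl) ≫ η ▷ g' ≫ eqToHom (h ▸ rfl) := by
  subst h; simp

/-- Concatenation is strictly associative and unital, so all constraints are identities. Whiskering
is conjugated by `ev_comp`, because the value of a concatenation equals the composite of the values
only propositionally. Each axiom becomes the one of `C` once strictness turns its constraints into
`eqToHom`. -/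
instance bicategory : Bicategory P.Full where
  homCategory := homCategory
  whiskerLeft {x y z} p q q' η := ⟨eqToHom (ev_comp p q) ≫
    ev p ◁ η.val ≫ eqToHom (ev_comp p q').symm⟩
  whiskerRight {x y z p p'} η q := ⟨eqToHom (ev_comp p q) ≫
    η.val ▷ ev q ≫ eqToHom (ev_comp p' q).symm⟩
  associator p q r := eqToIso (Word.comp_assoc p q r)
  leftUnitor p := eqToIso (Word.nil_comp p)
  rightUnitor p := eqToIso (Word.comp_nil p)
  whiskerLeft_id p q := by ext; simp
  whiskerLeft_comp p _ _ _ η θ := by ext; simp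
  id_whiskerLeft {x y p q} η := by
    ext
    simp only [comp_val, eqToIso.hom, eqToIso.inv, eqToHom_val]
    rw [whiskerLeft_congr (ev_id x), Bicategory.id_whiskerLeft]
    simp [Strict.leftUnitor_eqToIso]
  comp_whiskerLeft p q _ _ η := by
    ext
    simp only [comp_val, eqToIso.hom, eqToIso.inv, eqToHom_val]
    rw [whiskerLeft_congr (ev_comp p q), Bicategory.comp_whiskerLeft]
    simp [Strict.associator_eqToIso]
  id_whiskerRight p q := by ext; simp
  comp_whiskerRight η θ p := by ext; simp
  whiskerRight_id {x y p q} η := by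
    ext
    simp only [comp_val, eqToIso.hom, eqToIso.inv, eqToHom_val]
    rw [whiskerRight_congr _ (ev_id y), Bicategory.whiskerRight_id]
    simp [Strict.rightUnitor_eqToIso]
  whiskerRight_comp η p q := by
    ext
    simp only [comp_val, eqToIso.hom, eqToIso.inv, eqToHom_val]
    rw [whiskerRight_congr _ (ev_comp p q), Bicategory.whiskerRight_comp]
    simp [Strict.associator_eqToIso]
  whisker_assoc p _ _ η q := by
    ext
    simp [Strict.associator_eqToIso]
  whisker_exchange {x y z p q r s} η θ := by
    ext
    have := Bicategory.whisker_exchange η.val θ.val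
    simp [reassoc_of% this]
  pentagon p q r s := by ext; simp
  triangle p q := by ext; simp

lemma whiskerLeft_val {x y z : P.Full} (p : x ⟶ y) {q q' : y ⟶ z} (η : q ⟶ q') :
    Cell.val (p ◁ η) = eqToHom (ev_comp p q) ≫ ev p ◁ η.val ≫ eqToHom (ev_comp p q').symm := rfl

lemma whiskerRight_val {x y z : P.Full} {p p' : x ⟶ y} (η : p ⟶ p') (q : y ⟶ z) :
    Cell.val (η ▷ q) = eqToHom (ev_comp p q) ≫ η.val ▷ ev q ≫ eqToHom (ev_comp p' q).symm := rfl

instance : Strict P.Full where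
  id_comp p := Word.nil_comp p
  comp_id p := Word.comp_nil p
  assoc p q r := Word.comp_assoc p q r
  leftUnitor_eqToIso _ := rfl
  rightUnitor_eqToIso _ := rfl
  associator_eqToIso _ _ _ := rfl

variable (P) in
/-- The 2-functor sending a string of generators to its composite. -/
def proj : P.Full ⥤ᵖ C where
  obj x := x.base
  map p := ev p
  map₂ η := η.val
  map₂_id _ := rfl
  map₂_comp _ _ := rfl
  mapId x := eqToIso (ev_id x)
  mapComp p q := eqToIso (ev_comp p q)
  map₂_whisker_left p _ _ η := by simp [whiskerLeft_val]
  map₂_whisker_right η p := by simp [whiskerRight_val]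
  map₂_associator p q r := by
    simp [Strict.associator_eqToIso]
  map₂_left_unitor p := by
    simp [Strict.leftUnitor_eqToIso]
  map₂_right_unitor p := by
    simp [Strict.rightUnitor_eqToIso]

lemma proj_isTwoFunctor : IsTwoFunctor (proj P) :=
  ⟨fun _ => ⟨_, rfl⟩, fun _ _ _ _ _ => ⟨_, rfl⟩⟩

variable {F G : B ⥤ᵖ P.Full}

lemma eval_homCast {x x' y y' : P.Full} (h : x = x') (h' : y = y') (p : x' ⟶ y') :
    ev ((homCast h h').obj p) =
      (homCast (congrArg base h) (congrArg base h')).obj (ev p) := by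
  subst h h'; rfl

/-- 2-cells of `P.Full` between 1-cells with equal ends are those of `C` between their
composites. -/
def arrLift {x y x' y' : P.Full} {p : x ⟶ y} {q : x' ⟶ y'} (m : Arr.of (ev p) ⟶ Arr.of (ev q)) :
    Arr.of p ⟶ Arr.of q :=
  ⟨Full.ext m.src_eq, Full.ext m.tgt_eq, ⟨m.cell ≫ eqToHom (eval_homCast _ _ q).symm⟩⟩

/-- A 2-cell of `P.Full` is nothing but its value. With `map_proj_arrLift` this makes evaluation
fully faithful on arrow categories, even between strings whose ends are only propositionally equal.
-/
lemma map_proj_injective {x y x' y' : P.Full} {p : x ⟶ y} {q : x' ⟶ y'}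
    {m n : Arr.of p ⟶ Arr.of q} (h : Arr.map (proj P) m = Arr.map (proj P) n) : m = n := by
  obtain ⟨i, i', m⟩ := m
  obtain ⟨j, j', n⟩ := n
  dsimp only at i i'
  subst i i'
  change Arr.map (proj P) (Arr.ofCell m) = Arr.map (proj P) (Arr.ofCell n) at h
  rw [Arr.map_ofCell, Arr.map_ofCell] at h
  exact congrArg Arr.ofCell (Cell.ext (Arr.ofCell_injective h))

lemma arrLift_ofCell {x y : P.Full} {p q : x ⟶ y} (η : ev p ⟶ ev q) :
    arrLift (Arr.ofCell η) = Arr.ofCell (C := P.Full) (f := p) (g := q) ⟨η⟩ :=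
  congrArg Arr.ofCell (Cell.ext (Category.comp_id _))

lemma map_proj_arrLift {x y x' y' : P.Full} {p : x ⟶ y} {q : x' ⟶ y'}
    (m : Arr.of (ev p) ⟶ Arr.of (ev q)) : Arr.map (proj P) (arrLift m) = m := by
  -- The wrappers are opened so that the equalities of ends relate variables and can be substituted.
  obtain ⟨x⟩ := x
  obtain ⟨y⟩ := y
  obtain ⟨x'⟩ := x'
  obtain ⟨y'⟩ := y'
  obtain ⟨i, i', m⟩ := m
  dsimp only at i i'
  subst i i'
  change Arr.map (proj P) (arrLift (Arr.ofCell m)) = Arr.ofCell m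
  rw [arrLift_ofCell, Arr.map_ofCell]
  rfl

end Full

end Generators

end Presentations

end TwoDim

namespace TwoDim

/-! ### Transporting pseudofunctors to new 1-cells and lifting them to strings -/

section Presentations

variable {B : Type u₁} [Bicategory.{w₁, v₁} B] {C : Type u₂} [Bicategory.{w₂, v₂} C]
  {D : Type u₃} [Bicategory.{w₃, v₃} D]

/-- Transport of a pseudofunctor along isomorphisms with new values on 1-cells. -/
def transport (H : B ⥤ᵖ C) (m : ∀ {a b : B}, (a ⟶ b) → (H.obj a ⟶ H.obj b))
    (ω : ∀ {a b : B} (f : a ⟶ b), H.map f ≅ m f) : B ⥤ᵖ C where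
  obj := H.obj
  map := m
  map₂ {a b f g} η := (ω f).inv ≫ H.map₂ η ≫ (ω g).hom
  mapId a := (ω (𝟙 a)).symm ≪≫ H.mapId a
  mapComp f g := (ω (f ≫ g)).symm ≪≫ H.mapComp f g ≪≫ whiskerRightIso (ω f) (H.map g) ≪≫
    whiskerLeftIso (m f) (ω g)
  map₂_whisker_left f g h η := by
    simp [← whisker_exchange_assoc]
  map₂_whisker_right {_ _ _ f g} η h := by
    simp [whisker_exchange_assoc]
  map₂_associator f g h := by
    simp only [Iso.trans_hom, Iso.symm_hom, Iso.trans_inv, Iso.symm_inv,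
      whiskerRightIso_hom, whiskerRightIso_inv, whiskerLeftIso_hom, whiskerLeftIso_inv,
      Pseudofunctor.map₂_associator, Category.assoc, comp_whiskerRight, whiskerLeft_comp]
    -- Interchange brings each `ω` next to its inverse; after cancellation only the associativity
    -- coherence of `H` is left.
    rw [whisker_exchange_assoc]
    simp only [hom_inv_whiskerRight_assoc, whiskerLeft_hom_inv_assoc]
    rw [whisker_exchange_assoc, associator_naturality_middle_assoc,
      associator_naturality_left_assoc, ← whiskerLeft_comp_assoc, ← whiskerLeft_comp_assoc,
      ← whisker_exchange (ω g).hom, Category.assoc, hom_inv_whiskerRight, Category.comp_id,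
      ← whisker_exchange_assoc (ω f).hom, ← associator_naturality_right_assoc,
      whiskerLeft_hom_inv_assoc, ← whisker_exchange_assoc (ω f).hom, hom_inv_whiskerRight_assoc]
  map₂_left_unitor f := by
    simp [whisker_exchange_assoc]
  map₂_right_unitor f := by
    simp [← whisker_exchange_assoc]

namespace Generators.Full

variable {P : Generators.{w₂, v₄, v₂} C} [Strict C]

/-- Construction of icons between pseudofunctors into `P.Full` from their images in `C`. -/
def iconMk {F G : B ⥤ᵖ P.Full} (hobj : ∀ a, (F.obj a).base = (G.obj a).base)
    (m : ∀ {a b : B} (f : a ⟶ b), Arr.of (ev (F.map f)) ⟶ Arr.of (ev (G.map f)))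
    (naturality : ∀ {a b : B} {f g : a ⟶ b} (η : f ⟶ g),
      Arr.ofCell (F.map₂ η).val ≫ m g = m f ≫ Arr.ofCell (G.map₂ η).val)
    (id : ∀ a : B, m (𝟙 a) ≫ Arr.ofCell (G.mapId a).hom.val = Arr.ofCell (F.mapId a).hom.val ≫
      eqToHom (congrArg (fun x => Arr.of (𝟙 x)) (hobj a)))
    (comp : ∀ {a b c : B} (f : a ⟶ b) (g : b ⟶ c),
      m (f ≫ g) ≫ Arr.ofCell ((G.mapComp f g).hom.val ≫ eqToHom (ev_comp _ _)) =
        Arr.ofCell ((F.mapComp f g).hom.val ≫ eqToHom (ev_comp _ _)) ≫ Arr.hcomp (m f) (m g)) :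
    Icon F G :=
  Icon.ofArr (fun a => Full.ext (hobj a)) (fun f => arrLift (m f))
    (fun {a b f g} η => by
      apply map_proj_injective
      rw [Arr.map_comp, Arr.map_comp, map_proj_arrLift, map_proj_arrLift, Arr.map_ofCell,
        Arr.map_ofCell]
      exact naturality η)
    (fun a => by
      apply map_proj_injective
      rw [Arr.map_comp, Arr.map_comp, map_proj_arrLift, Arr.map_ofCell, Arr.map_ofCell,
        Arr.map_eqToHom]
      exact id a)
    (fun f g => by
      apply map_proj_injective
      rw [← cancel_mono (Arr.ofCell ((proj P).mapComp (G.map f) (G.map g)).hom), Arr.map_comp,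
        Arr.map_comp, Category.assoc, Category.assoc, Arr.map_hcomp, map_proj_arrLift,
        map_proj_arrLift, map_proj_arrLift, Arr.map_ofCell, Arr.map_ofCell, ← Arr.ofCell_comp,
        ← Arr.ofCell_comp_assoc]
      exact comp f g)

/-- Icons between pseudofunctors into `P.Full` are icons between the composites with `proj P`. -/
def iconLift {F G : B ⥤ᵖ P.Full} (α : Icon (F.comp (proj P)) (G.comp (proj P))) : Icon F G :=
  iconMk α.obj_eq (fun f => α.arr f) (fun η => α.arr_naturality_cell η)
    (fun a => by
      have h := α.arr_id a
      have e (F : B ⥤ᵖ P.Full) : ((F.comp (proj P)).mapId a).hom = (F.mapId a).hom.val :=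
        Category.comp_id _
      rw [e, e] at h
      exact h)
    (fun f g => α.arr_comp f g)

lemma map_proj_arr_iconLift {F G : B ⥤ᵖ P.Full}
    (α : Icon (F.comp (proj P)) (G.comp (proj P))) {a b : B} (f : a ⟶ b) :
    Arr.map (proj P) ((iconLift α).arr f) = α.arr f := map_proj_arrLift _

section Lift

/-- The next five lemmas carry the pseudofunctor axioms from `C` to `P.Full`. The composition
constraint upstairs is the one downstairs followed by the identification `ev_comp`, and these
identifications cancel. -/
lemma lift_whiskerLeft_aux {x y z : P.Full} {p : x ⟶ y} {q q' : y ⟶ z} {l l' : x ⟶ z}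
    (m : ev l ≅ ev p ≫ ev q) (m' : ev l' ≅ ev p ≫ ev q') (k : ev q ⟶ ev q') {n : ev l ⟶ ev l'}
    (h : n = m.hom ≫ ev p ◁ k ≫ m'.inv) :
    (⟨n⟩ : Cell l l') = (isoMk (m ≪≫ eqToIso (ev_comp p q).symm)).hom ≫ p ◁ (⟨k⟩ : Cell q q') ≫
      (isoMk (m' ≪≫ eqToIso (ev_comp p q').symm)).inv := by
  ext; simp [h, whiskerLeft_val]

lemma lift_whiskerRight_aux {x y z : P.Full} {p p' : x ⟶ y} {q : y ⟶ z} {l l' : x ⟶ z}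
    (m : ev l ≅ ev p ≫ ev q) (m' : ev l' ≅ ev p' ≫ ev q) (k : ev p ⟶ ev p') {n : ev l ⟶ ev l'}
    (h : n = m.hom ≫ k ▷ ev q ≫ m'.inv) :
    (⟨n⟩ : Cell l l') = (isoMk (m ≪≫ eqToIso (ev_comp p q).symm)).hom ≫ (⟨k⟩ : Cell p p') ▷ q ≫
      (isoMk (m' ≪≫ eqToIso (ev_comp p' q).symm)).inv := by
  ext; simp [h, whiskerRight_val]

lemma lift_associator_aux {x y z t : P.Full} {p : x ⟶ y} {q : y ⟶ z} {r : z ⟶ t} {pq : x ⟶ z}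
    {qr : y ⟶ t} {l l' : x ⟶ t} (m : ev pq ≅ ev p ≫ ev q) (m' : ev l ≅ ev pq ≫ ev r)
    (n : ev qr ≅ ev q ≫ ev r) (n' : ev l' ≅ ev p ≫ ev qr) {k : ev l ⟶ ev l'}
    (h : k = m'.hom ≫ m.hom ▷ ev r ≫ (α_ _ _ _).hom ≫ ev p ◁ n.inv ≫ n'.inv) :
    (⟨k⟩ : Cell l l') = (isoMk (m' ≪≫ eqToIso (ev_comp pq r).symm)).hom ≫
      (isoMk (m ≪≫ eqToIso (ev_comp p q).symm)).hom ▷ r ≫ (α_ p q r).hom ≫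
      p ◁ (isoMk (n ≪≫ eqToIso (ev_comp q r).symm)).inv ≫
      (isoMk (n' ≪≫ eqToIso (ev_comp p qr).symm)).inv := by
  ext; simp [h, whiskerRight_val, whiskerLeft_val, Strict.associator_eqToIso]

lemma lift_leftUnitor_aux {x y : P.Full} {i : x ⟶ x} {p : x ⟶ y} {l : x ⟶ y}
    (m : ev l ≅ ev i ≫ ev p) (m' : ev i ≅ 𝟙 x.base) {k : ev l ⟶ ev p}
    (h : k = m.hom ≫ m'.hom ▷ ev p ≫ (λ_ (ev p)).hom) :
    (⟨k⟩ : Cell l p) = (isoMk (m ≪≫ eqToIso (ev_comp i p).symm)).hom ≫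
      (isoMk (q := 𝟙 x) m').hom ▷ p ≫ (λ_ p).hom := by
  ext
  have e : (isoMk (q := 𝟙 x) m').hom.val = m'.hom := rfl
  simp [h, whiskerRight_val, Strict.leftUnitor_eqToIso, e]
  rfl

lemma lift_rightUnitor_aux {x y : P.Full} {i : y ⟶ y} {p : x ⟶ y} {l : x ⟶ y}
    (m : ev l ≅ ev p ≫ ev i) (m' : ev i ≅ 𝟙 y.base) {k : ev l ⟶ ev p}
    (h : k = m.hom ≫ ev p ◁ m'.hom ≫ (ρ_ (ev p)).hom) :
    (⟨k⟩ : Cell l p) = (isoMk (m ≪≫ eqToIso (ev_comp p i).symm)).hom ≫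
      p ◁ (isoMk (q := 𝟙 y) m').hom ≫ (ρ_ p).hom := by
  ext
  have e : (isoMk (q := 𝟙 y) m').hom.val = m'.hom := rfl
  simp [h, whiskerLeft_val, Strict.rightUnitor_eqToIso, e]
  rfl

variable (H : B ⥤ᵖ C) (w : ∀ {a b : B}, (a ⟶ b) → P.Word (H.obj a) (H.obj b))
  (ω : ∀ {a b : B} (f : a ⟶ b), H.map f ≅ (w f).eval)

/-- The lift of a pseudofunctor along `proj P` for a choice of strings of generators whose
composites are isomorphic to its values. -/
def lift : B ⥤ᵖ P.Full where
  obj a := ⟨H.obj a⟩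
  map f := w f
  map₂ η := ⟨(transport H (fun f => (w f).eval) ω).map₂ η⟩
  map₂_id f := Cell.ext ((transport H (fun f => (w f).eval) ω).map₂_id f)
  map₂_comp η θ := Cell.ext ((transport H (fun f => (w f).eval) ω).map₂_comp η θ)
  mapId a := isoMk ((transport H (fun f => (w f).eval) ω).mapId a)
  mapComp f g := isoMk ((transport H (fun f => (w f).eval) ω).mapComp f g ≪≫
    eqToIso (Word.eval_comp (w f) (w g)).symm)
  map₂_whisker_left f _ _ η :=
    lift_whiskerLeft_aux _ _ _ ((transport H (fun f => (w f).eval) ω).map₂_whisker_left f η)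
  map₂_whisker_right η f :=
    lift_whiskerRight_aux _ _ _ ((transport H (fun f => (w f).eval) ω).map₂_whisker_right η f)
  map₂_associator f g h :=
    lift_associator_aux _ _ _ _ ((transport H (fun f => (w f).eval) ω).map₂_associator f g h)
  map₂_left_unitor f :=
    lift_leftUnitor_aux _ _ ((transport H (fun f => (w f).eval) ω).map₂_left_unitor f)
  map₂_right_unitor f :=
    lift_rightUnitor_aux _ _ ((transport H (fun f => (w f).eval) ω).map₂_right_unitor f)

/-- The lift of `H` is a lift up to an invertible icon. -/
def liftIcon : Icon ((lift H w ω).comp (proj P)) H where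
  obj_eq _ := rfl
  app f := (ω f).inv
  naturality η := by
    change ((ω _).inv ≫ H.map₂ η ≫ (ω _).hom) ≫ (ω _).inv = (ω _).inv ≫ H.map₂ η
    simp
  app_id a := by
    change (ω (𝟙 a)).inv ≫ (H.mapId a).hom ≫ 𝟙 _ = ((ω (𝟙 a)).inv ≫ (H.mapId a).hom) ≫ 𝟙 _
    simp
  app_comp f g := by
    change (ω (f ≫ g)).inv ≫ (H.mapComp f g).hom ≫ 𝟙 _ =
      (((((ω (f ≫ g)).inv ≫ (H.mapComp f g).hom ≫ (ω f).hom ▷ H.map g ≫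
        (w f).eval ◁ (ω g).hom)) ≫ eqToHom (Word.eval_comp (w f) (w g)).symm) ≫
          eqToHom (Word.eval_comp (w f) (w g))) ≫
        (ω f).inv ▷ (w g).eval ≫ H.map f ◁ (ω g).inv
    simp [whisker_exchange_assoc]

/-- The inverse of `liftIcon`. -/
def liftIconInv : Icon H ((lift H w ω).comp (proj P)) where
  obj_eq _ := rfl
  app f := (ω f).hom
  naturality η := by
    change H.map₂ η ≫ (ω _).hom = (ω _).hom ≫ (ω _).inv ≫ H.map₂ η ≫ (ω _).hom
    simp
  app_id a := by
    change (ω (𝟙 a)).hom ≫ (((ω (𝟙 a)).inv ≫ (H.mapId a).hom) ≫ 𝟙 _) ≫ 𝟙 _ = (H.mapId a).hom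
    simp
  app_comp f g := by
    change (ω (f ≫ g)).hom ≫
      (((((ω (f ≫ g)).inv ≫ (H.mapComp f g).hom ≫ (ω f).hom ▷ H.map g ≫
        (w f).eval ◁ (ω g).hom)) ≫ eqToHom (Word.eval_comp (w f) (w g)).symm) ≫
          eqToHom (Word.eval_comp (w f) (w g))) ≫ 𝟙 _ = (H.mapComp f g).hom ≫
        (ω f).hom ▷ H.map g ≫ (w f).eval ◁ (ω g).hom
    simp

end Lift

end Generators.Full

end Presentations

end TwoDim

/-! ### Identities up to equality of ends, and reduction to generators -/

namespace TwoDim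

/-- A morphism which is an identity up to equality of objects. -/
def IsEqToHom {C : Type u₁} [Category.{v₁} C] {x y : C} (m : x ⟶ y) : Prop :=
  ∃ h : x = y, m = eqToHom h

namespace IsEqToHom

variable {C : Type u₁} [Category.{v₁} C] {x y z : C}

lemma eqToHom (h : x = y) : IsEqToHom (eqToHom h) := ⟨h, rfl⟩

lemma id (x : C) : IsEqToHom (𝟙 x) := ⟨rfl, rfl⟩

lemma comp {m : x ⟶ y} {n : y ⟶ z} (hm : IsEqToHom m) (hn : IsEqToHom n) :
    IsEqToHom (m ≫ n) := by
  obtain ⟨rfl, rfl⟩ := hm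
  obtain ⟨rfl, rfl⟩ := hn
  exact ⟨rfl, by simp⟩

lemma of_comp {m : x ⟶ y} {n : y ⟶ z} (h : IsEqToHom (m ≫ n)) (hn : IsEqToHom n) :
    IsEqToHom m := by
  obtain ⟨rfl, rfl⟩ := hn
  simpa using h

/-- Parallel identities agree by proof irrelevance, so no coherence between them has to be checked.
-/
lemma eq {m n : x ⟶ y} (hm : IsEqToHom m) (hn : IsEqToHom n) : m = n := by
  obtain ⟨_, rfl⟩ := hm
  obtain ⟨_, rfl⟩ := hn
  rfl

end IsEqToHom

section

variable {B : Type u₁} [Bicategory.{w₁, v₁} B] {C : Type u₂} [Bicategory.{w₂, v₂} C]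
  {D : Type u₃} [Bicategory.{w₃, v₃} D]

lemma IsEqToHom.ofCell {a b : C} {f g : a ⟶ b} {η : f ⟶ g} (h : IsEqToHom η) :
    IsEqToHom (Arr.ofCell η) := by
  obtain ⟨rfl, rfl⟩ := h
  exact ⟨rfl, rfl⟩

lemma IsEqToHom.arrMap (F : B ⥤ᵖ C) {a b a' b' : B} {f : a ⟶ b} {g : a' ⟶ b'}
    {m : Arr.of f ⟶ Arr.of g} (h : IsEqToHom m) : IsEqToHom (Arr.map F m) := by
  obtain ⟨h, rfl⟩ := h
  exact ⟨_, Arr.map_eqToHom F h⟩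

lemma IsEqToHom.hcomp {a b c a' b' c' : C} {f : a ⟶ b} {g : b ⟶ c} {f' : a' ⟶ b'} {g' : b' ⟶ c'}
    {m : Arr.of f ⟶ Arr.of f'} {n : Arr.of g ⟶ Arr.of g'} (hm : IsEqToHom m)
    (hn : IsEqToHom n) : IsEqToHom (Arr.hcomp m n) :=
  Arr.hcomp_eqToHom _ hm.2 _ hn.2

lemma IsTwoFunctor.mapId_hom {F : B ⥤ᵖ C} (h : IsTwoFunctor F) (a : B) :
    IsEqToHom (F.mapId a).hom := by
  obtain ⟨e, h⟩ := h.1 a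
  exact ⟨e, by rw [h]; rfl⟩

lemma IsTwoFunctor.mapComp_hom {F : B ⥤ᵖ C} (h : IsTwoFunctor F) {a b c : B} (f : a ⟶ b)
    (g : b ⟶ c) : IsEqToHom (F.mapComp f g).hom := by
  obtain ⟨e, h⟩ := h.2 f g
  exact ⟨e, by rw [h]; rfl⟩

lemma IsTwoFunctor.comp {F : B ⥤ᵖ C} {G : C ⥤ᵖ D} (hF : IsTwoFunctor F) (hG : IsTwoFunctor G) :
    IsTwoFunctor (F.comp G) := by
  refine ⟨fun a => ?_, fun a b c f g => ?_⟩
  · obtain ⟨h, e⟩ := hF.1 a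
    obtain ⟨h', e'⟩ := hG.1 (F.obj a)
    refine ⟨(congrArg G.map h).trans h', ?_⟩
    change G.map₂Iso (F.mapId a) ≪≫ G.mapId (F.obj a) = _
    rw [e, e', PrelaxFunctor.map₂Iso_eqToIso]
    exact eqToIso_trans _ _
  · obtain ⟨h, e⟩ := hF.2 f g
    obtain ⟨h', e'⟩ := hG.2 (F.map f) (F.map g)
    refine ⟨(congrArg G.map h).trans h', ?_⟩
    change G.map₂Iso (F.mapComp f g) ≪≫ G.mapComp (F.map f) (F.map g) = _
    rw [e, e', PrelaxFunctor.map₂Iso_eqToIso]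
    exact eqToIso_trans _ _

namespace Generators

variable {P : Generators.{w₂, v₄, v₂} C} [Strict C]

/-- A generator, as a 1-cell of `P.Full`. -/
def Full.gen {x y : C} (e : P.Gen x y) : (⟨x⟩ : P.Full) ⟶ ⟨y⟩ := Word.single e

/-- An icon between 2-functors on `P.Full` whose components at generators are identities has only
identities as components. -/
lemma Full.isEqToHom_arr {F G : P.Full ⥤ᵖ D} (hF : IsTwoFunctor F) (hG : IsTwoFunctor G)
    (α : Icon F G) (h : ∀ {x y : C} (e : P.Gen x y), IsEqToHom (α.arr (gen e))) {x y : P.Full}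
    (p : x ⟶ y) : IsEqToHom (α.arr p) := by
  obtain ⟨x⟩ := x
  obtain ⟨y⟩ := y
  change P.Word x y at p
  induction p with
  | nil =>
    -- The unit law expresses this component followed by the unit constraint of `G` through that of
    -- `F`. Both constraints are identities, so the component is one. The composition law does the
    -- same for `cons`.
    refine IsEqToHom.of_comp ?_ (hG.mapId_hom ⟨x⟩).ofCell
    exact (α.arr_id ⟨x⟩) ▸ (hF.mapId_hom ⟨x⟩).ofCell.comp (.eqToHom _)
  | @cons y z p e ih =>
    let p' : (⟨x⟩ : P.Full) ⟶ ⟨y⟩ := p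
    refine IsEqToHom.of_comp ?_ (hG.mapComp_hom p' (gen e)).ofCell
    exact (α.arr_comp p' (gen e)) ▸ (hF.mapComp_hom p' (gen e)).ofCell.comp (ih.hcomp (h e))

end Generators

end

/-! ### 2-functors between string 2-categories induced by maps of generators -/

section WordMap

variable {C : Type u₂} [Bicategory.{w₂, v₂} C] {D : Type u₃} [Bicategory.{w₃, v₃} D]

namespace Generators

variable {P : Generators.{w₂, v₄, v₂} C} {P' : Generators.{w₃, v₄, v₃} D} (H : C ⥤ᵖ D)
  (φ : ∀ {x y : C}, P.Gen x y → P'.Gen (H.obj x) (H.obj y))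

/-- The effect on strings of a map of generators. -/
def Word.map {x y : C} : P.Word x y → P'.Word (H.obj x) (H.obj y)
  | nil => nil
  | cons p e => (p.map).cons (φ e)

lemma Word.map_comp {x y z : C} (p : P.Word x y) (q : P.Word y z) :
    (p.comp q).map H φ = (p.map H φ).comp (q.map H φ) := by
  induction q with
  | nil => rfl
  | cons q e ih => exact congrArg (fun q => cons q (φ e)) ih

variable (κ : ∀ {x y : C} (e : P.Gen x y), H.map (P.ev e) ≅ P'.ev (φ e))

/-- The comparison between the composites of a string of generators and of its image. -/
def Word.mapEval {x y : C} : ∀ p : P.Word x y, H.map p.eval ≅ (p.map H φ).eval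
  | nil => H.mapId x
  | cons p e => H.mapComp p.eval (P.ev e) ≪≫ whiskerRightIso p.mapEval (H.map (P.ev e)) ≪≫
      whiskerLeftIso (p.map H φ).eval (κ e)

/-- This is the inductive step of `mapEval_comp`, with the values of the strings generalized to
variables so that the equalities `h` and `h'` can be eliminated. -/
lemma mapEval_cons_aux [Strict C] [Strict D] {x y z t : C} {p : x ⟶ y} {q : y ⟶ z} {e : z ⟶ t}
    {k : x ⟶ z} (h : k = p ≫ q) {p' : H.obj x ⟶ H.obj y} {q' : H.obj y ⟶ H.obj z}
    {e' : H.obj z ⟶ H.obj t} {k' : H.obj x ⟶ H.obj z} (h' : p' ≫ q' = k') (a : H.map p ⟶ p')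
    (b : H.map q ⟶ q') (c : H.map e ⟶ e') {m : H.map k ⟶ k'}
    (hm : m = H.map₂ (eqToHom h) ≫ (H.mapComp p q).hom ≫ a ▷ H.map q ≫ p' ◁ b ≫ eqToHom h') :
    (H.mapComp k e).hom ≫ m ▷ H.map e ≫ k' ◁ c =
      H.map₂ (eqToHom ((congrArg (· ≫ e) h).trans (Strict.assoc p q e))) ≫
        (H.mapComp p (q ≫ e)).hom ≫ a ▷ H.map (q ≫ e) ≫
        p' ◁ ((H.mapComp q e).hom ≫ b ▷ H.map e ≫ q' ◁ c) ≫
        eqToHom ((Strict.assoc p' q' e').symm.trans (congrArg (· ≫ e') h')) := by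
  subst h h' hm
  -- By strictness the remaining equalities are associators, to which the associativity coherence of
  -- `H` applies.
  have h₁ : eqToHom ((congrArg (· ≫ e) rfl).trans (Strict.assoc p q e)) = (α_ p q e).hom := by
    rw [Strict.associator_eqToIso]; rfl
  have h₂ : eqToHom ((Strict.assoc p' q' e').symm.trans (congrArg (· ≫ e') rfl)) =
      (α_ p' q' e').inv := by
    rw [Strict.associator_eqToIso]; rfl
  rw [h₁, h₂, H.map₂_associator]
  simp only [eqToHom_refl, PrelaxFunctor.map₂_id, Category.id_comp, Category.comp_id,
    Category.assoc, comp_whiskerRight, whiskerLeft_comp, Iso.inv_hom_id_assoc]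
  rw [← whisker_exchange_assoc a, whiskerLeft_inv_hom_assoc]
  simp

/-- The comparison is assembled generator by generator from the constraints of `H`, so by coherence
it splits along concatenations. The strictness of `fullMap` rests on this. -/
lemma Word.mapEval_comp [Strict C] [Strict D] {x y z : C} (p : P.Word x y) (q : P.Word y z) :
    (Word.mapEval H φ κ (p.comp q)).hom = H.map₂ (eqToHom (eval_comp p q)) ≫
      (H.mapComp p.eval q.eval).hom ≫ (Word.mapEval H φ κ p).hom ▷ H.map q.eval ≫
      (p.map H φ).eval ◁ (Word.mapEval H φ κ q).hom ≫
      eqToHom ((eval_comp _ _).symm.trans (congrArg eval (Word.map_comp H φ p q).symm)) := by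
  induction q with
  | nil =>
    have h₁ : eqToHom (eval_comp p nil) = (ρ_ p.eval).inv := by
      rw [Strict.rightUnitor_eqToIso]; rfl
    have h₂ : eqToHom ((eval_comp _ _).symm.trans (congrArg eval (Word.map_comp H φ p nil).symm)) =
        (ρ_ (p.map H φ).eval).hom := by
      rw [Strict.rightUnitor_eqToIso]; rfl
    rw [h₁, h₂]
    change (Word.mapEval H φ κ p).hom = H.map₂ (ρ_ p.eval).inv ≫ (H.mapComp p.eval (𝟙 y)).hom ≫
      (Word.mapEval H φ κ p).hom ▷ H.map (𝟙 y) ≫ (p.map H φ).eval ◁ (H.mapId y).hom ≫ (ρ_ _).hom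
    rw [← whisker_exchange_assoc, rightUnitor_naturality, ← H.map₂_right_unitor_assoc,
      PrelaxFunctor.map₂_inv_hom_assoc]
  | cons q e ih =>
    change (H.mapComp (p.comp q).eval (P.ev e)).hom ≫
      (Word.mapEval H φ κ (p.comp q)).hom ▷ H.map (P.ev e) ≫
      ((p.comp q).map H φ).eval ◁ (κ e).hom = H.map₂ (eqToHom (eval_comp p (q.cons e))) ≫
      (H.mapComp p.eval (q.eval ≫ P.ev e)).hom ≫
      (Word.mapEval H φ κ p).hom ▷ H.map (q.eval ≫ P.ev e) ≫ (p.map H φ).eval ◁ (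
        (H.mapComp q.eval (P.ev e)).hom ≫ (Word.mapEval H φ κ q).hom ▷ H.map (P.ev e) ≫
      (q.map H φ).eval ◁ (κ e).hom) ≫ eqToHom _
    exact mapEval_cons_aux H _ _ _ _ _ ih

lemma Word.mapEval_single [Strict C] [Strict D] {x y : C} (e : P.Gen x y) :
    Arr.ofCell (Word.mapEval H φ κ (single e)).hom =
      eqToHom (congrArg (fun f => Arr.of (H.map f)) (eval_single e)) ≫ Arr.ofCell (κ e).hom ≫
        eqToHom (congrArg Arr.of (eval_single (φ e)).symm) := by
  have h : (Word.mapEval H φ κ (single e)).hom = eqToHom (congrArg H.map (eval_single e)) ≫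
      (κ e).hom ≫ eqToHom (eval_single (φ e)).symm := by
    change (H.mapComp (𝟙 x) (P.ev e)).hom ≫ (H.mapId x).hom ▷ H.map (P.ev e) ≫ 𝟙 _ ◁ (κ e).hom = _
    rw [H.mapComp_id_left_hom, Strict.leftUnitor_eqToIso, eqToIso.hom, PrelaxFunctor.map₂_eqToHom]
    simp [Strict.leftUnitor_eqToIso]
    rfl
  refine (congrArg Arr.ofCell h).trans ?_
  refine (Arr.ofCell_comp _ _).trans ?_
  rw [Arr.ofCell_eqToHom]
  exact congrArg (_ ≫ ·) ((Arr.ofCell_comp _ _).trans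
    (congrArg (_ ≫ ·) (Arr.ofCell_eqToHom _)))

variable [Strict C] [Strict D]

/-- The 2-functor induced by a map of generators which is compatible with a pseudofunctor up to
isomorphism. -/
def fullMap : P.Full ⥤ᵖ P'.Full :=
  Full.lift ((Full.proj P).comp H) (fun p => Word.map H φ p) (fun p => Word.mapEval H φ κ p)

/-- On 1-cells `fullMap` substitutes generators, which respects concatenation strictly. Its
composition constraint is that of `H` conjugated by `mapEval`, and `mapEval_comp` says that this
cancels to an identity. -/
lemma fullMap_isTwoFunctor : IsTwoFunctor (fullMap H φ κ) := by
  refine ⟨fun x => ⟨rfl, ?_⟩, fun x y z p q => ⟨Word.map_comp H φ p q, ?_⟩⟩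
  · ext
    change (H.mapId x.base).inv ≫ H.map₂ (𝟙 _) ≫ (H.mapId x.base).hom = 𝟙 _
    simp
  · ext
    refine Eq.trans ?_ (Full.eqToHom_val (Word.map_comp H φ p q)).symm
    change ((Word.mapEval H φ κ (p.comp q)).inv ≫ (H.map₂ (eqToHom (Word.eval_comp p q)) ≫
      (H.mapComp p.eval q.eval).hom) ≫ (Word.mapEval H φ κ p).hom ▷ H.map q.eval ≫
      (p.map H φ).eval ◁ (Word.mapEval H φ κ q).hom) ≫ eqToHom (Word.eval_comp _ _).symm =
        eqToHom (congrArg Word.eval (Word.map_comp H φ p q))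
    have h := Word.mapEval_comp H φ κ p q
    rw [← cancel_mono (eqToHom (congrArg Word.eval (Word.map_comp H φ p q).symm)),
      ← cancel_epi (Word.mapEval H φ κ (p.comp q)).hom]
    simp only [Category.assoc, eqToHom_trans, Iso.hom_inv_id_assoc, eqToHom_refl,
      Category.comp_id]
    exact h.symm

/-- The comparison of `fullMap` with the given pseudofunctor. -/
def fullMapIcon : Icon ((fullMap H φ κ).comp (Full.proj P')) ((Full.proj P).comp H) :=
  Full.liftIcon _ _ _

/-- The inverse of `fullMapIcon`. -/
def fullMapIconInv : Icon ((Full.proj P).comp H) ((fullMap H φ κ).comp (Full.proj P')) :=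
  Full.liftIconInv _ _ _

lemma fullMapIconInv_arr_gen {x y : C} (e : P.Gen x y) :
    (fullMapIconInv H φ κ).arr (Full.gen e) =
      eqToHom (congrArg (fun f => Arr.of (H.map f)) (Word.eval_single e)) ≫
        Arr.ofCell (κ e).hom ≫ eqToHom (congrArg Arr.of (Word.eval_single (φ e)).symm) :=
  Word.mapEval_single H φ κ e

end Generators

end WordMap

end TwoDim

/-! ### Components of icons and of the constraints of a pseudofunctor to `2Cat_{p,i}` -/

namespace TwoDim

namespace TwoCatPI

variable {X Y Z W : TwoCatPI.{u}}

/-- The components of a 2-cell of `2Cat_{p,i}`. -/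
def arr {F G : X ⟶ Y} (α : F ⟶ G) {x y : X.carrier} (v : x ⟶ y) :
    Arr.of (F.fn.map v) ⟶ Arr.of (G.fn.map v) := α.icon.arr v

lemma hom₂_ext_arr {F G : X ⟶ Y} {α β : F ⟶ G}
    (h : ∀ {x y : X.carrier} (v : x ⟶ y), arr α v = arr β v) : α = β :=
  Hom₂.ext' _ _ fun v => by
    have := h v
    injection this

@[simp]
lemma arr_id (F : X ⟶ Y) {x y : X.carrier} (v : x ⟶ y) : arr (𝟙 F) v = 𝟙 _ := rfl

@[simp]
lemma arr_comp {F G H : X ⟶ Y} (α : F ⟶ G) (β : G ⟶ H) {x y : X.carrier} (v : x ⟶ y) :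
    arr (α ≫ β) v = arr α v ≫ arr β v := rfl

lemma arr_naturality {F G : X ⟶ Y} (α : F ⟶ G) {x y x' y' : X.carrier} {v : x ⟶ y}
    {v' : x' ⟶ y'} (m : Arr.of v ⟶ Arr.of v') :
    Arr.map F.fn m ≫ arr α v' = arr α v ≫ Arr.map G.fn m := α.icon.arr_naturality m

lemma arr_whiskerRight {F G : X ⟶ Y} (α : F ⟶ G) (H : Y ⟶ Z) {x y : X.carrier} (v : x ⟶ y) :
    arr (α ▷ H) v = Arr.map H.fn (arr α v) := rfl

lemma isEqToHom_arr {F G : X ⟶ Y} {α : F ⟶ G} (h : IsEqToHom α) {x y : X.carrier} (v : x ⟶ y) :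
    IsEqToHom (arr α v) := by
  obtain ⟨rfl, rfl⟩ := h
  exact ⟨rfl, rfl⟩

/-- The equality `F = G` is part of the conclusion: an equality of pseudofunctors is proved by
exhibiting an icon with identity components. -/
lemma isEqToHom_of_arr {F G : X ⟶ Y} {α : F ⟶ G}
    (h : ∀ {x y : X.carrier} (v : x ⟶ y), IsEqToHom (arr α v)) : IsEqToHom α := by
  obtain rfl : F = G := Hom.ext' (α.icon.eq_of_arr_eqToHom fun v => h v)
  exact ⟨rfl, hom₂_ext_arr fun v => (h v).eq (.id _)⟩

/-- The components of an invertible 2-cell of `2Cat_{p,i}`. -/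
def arrIso {F G : X ⟶ Y} (α : F ≅ G) {x y : X.carrier} (v : x ⟶ y) :
    Arr.of (F.fn.map v) ≅ Arr.of (G.fn.map v) where
  hom := arr α.hom v
  inv := arr α.inv v
  hom_inv_id := by rw [← arr_comp, α.hom_inv_id, arr_id]
  inv_hom_id := by rw [← arr_comp, α.inv_hom_id, arr_id]

end TwoCatPI

open TwoCatPI

section Components

variable {A : Type u} [Bicategory.{u, u} A] (X : A ⥤ᵖ TwoCatPI.{u})

/-- The components of the composition constraint of a pseudofunctor to `2Cat_{p,i}`. -/
def compArr {a b c : A} (f : a ⟶ b) (g : b ⟶ c) {x y : (X.obj a).carrier} (v : x ⟶ y) :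
    Arr.of ((X.map (f ≫ g)).fn.map v) ≅ Arr.of ((X.map g).fn.map ((X.map f).fn.map v)) :=
  arrIso (X.mapComp f g) v

/-- The components of the unit constraint of a pseudofunctor to `2Cat_{p,i}`. -/
def idArr (a : A) {x y : (X.obj a).carrier} (v : x ⟶ y) :
    Arr.of ((X.map (𝟙 a)).fn.map v) ≅ Arr.of v :=
  arrIso (X.mapId a) v

lemma compArr_naturality {a b c : A} (f : a ⟶ b) (g : b ⟶ c) {x y x' y' : (X.obj a).carrier}
    {v : x ⟶ y} {v' : x' ⟶ y'} (m : Arr.of v ⟶ Arr.of v') :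
    Arr.map (X.map (f ≫ g)).fn m ≫ (compArr X f g v').hom =
      (compArr X f g v).hom ≫ Arr.map (X.map g).fn (Arr.map (X.map f).fn m) :=
  (arr_naturality (X.mapComp f g).hom m).trans
    (congrArg (_ ≫ ·) (Arr.map_comp_map (X.map f).fn (X.map g).fn m))

lemma idArr_naturality (a : A) {x y x' y' : (X.obj a).carrier}
    {v : x ⟶ y} {v' : x' ⟶ y'} (m : Arr.of v ⟶ Arr.of v') :
    Arr.map (X.map (𝟙 a)).fn m ≫ (idArr X a v').hom = (idArr X a v).hom ≫ m :=
  (arr_naturality (X.mapId a).hom m).trans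
    (congrArg (_ ≫ ·) (Arr.map_id_map m))

lemma compArr_assoc {a b c d : A} (f : a ⟶ b) (g : b ⟶ c) (h : c ⟶ d)
    {x y : (X.obj a).carrier} (v : x ⟶ y) :
    (compArr X (f ≫ g) h v).hom ≫ Arr.map (X.map h).fn (compArr X f g v).hom =
      arr (X.map₂ (α_ f g h).hom) v ≫ (compArr X f (g ≫ h) v).hom ≫
        (compArr X g h ((X.map f).fn.map v)).hom := by
  have := congrArg (fun α => arr α v) (X.mapComp_assoc_left_hom f g h)
  refine this.trans ?_
  -- The associator of `2Cat_{p,i}` contributes only an identity component, which is dropped here.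
  exact congrArg (fun k => arr (X.map₂ (α_ f g h).hom) v ≫ (compArr X f (g ≫ h) v).hom ≫ k)
    (Category.comp_id (compArr X g h ((X.map f).fn.map v)).hom)

lemma compArr_id_right {a b : A} (f : a ⟶ b) {x y : (X.obj a).carrier} (v : x ⟶ y) :
    (compArr X f (𝟙 b) v).hom ≫ (idArr X b ((X.map f).fn.map v)).hom =
      arr (X.map₂ (ρ_ f).hom) v := by
  have := congrArg (fun α => arr α v) (X.map₂_right_unitor f)
  refine Eq.trans ?_ this.symm
  exact congrArg (_ ≫ ·) (Category.comp_id _).symm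

lemma compArr_whiskerLeft {a b c : A} (f : a ⟶ b) {g h : b ⟶ c} (η : g ⟶ h)
    {x y : (X.obj a).carrier} (v : x ⟶ y) :
    arr (X.map₂ (f ◁ η)) v ≫ (compArr X f h v).hom =
      (compArr X f g v).hom ≫ arr (X.map₂ η) ((X.map f).fn.map v) := by
  have h' : X.map₂ (f ◁ η) ≫ (X.mapComp f h).hom = (X.mapComp f g).hom ≫ X.map f ◁ X.map₂ η := by
    simp
  exact congrArg (fun α => arr α v) h'

lemma compArr_whiskerRight {a b c : A} {f g : a ⟶ b} (η : f ⟶ g) (h : b ⟶ c)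
    {x y : (X.obj a).carrier} (v : x ⟶ y) :
    arr (X.map₂ (η ▷ h)) v ≫ (compArr X g h v).hom =
      (compArr X f h v).hom ≫ Arr.map (X.map h).fn (arr (X.map₂ η) v) := by
  have h' : X.map₂ (η ▷ h) ≫ (X.mapComp g h).hom = (X.mapComp f h).hom ≫ X.map₂ η ▷ X.map h := by
    simp
  exact congrArg (fun α => arr α v) h'

lemma isEqToHom_map₂ {a b : A} {f g : a ⟶ b} {η : f ⟶ g} (h : IsEqToHom η)
    {x y : (X.obj a).carrier} (v : x ⟶ y) : IsEqToHom (arr (X.map₂ η) v) := by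
  obtain ⟨rfl, rfl⟩ := h
  exact ⟨rfl, by simp⟩

end Components

end TwoDim

namespace TwoDim

open TwoCatPI Generators

/-! ### Formal cells, the strictification on objects and 1-cells, and evaluation -/

section Strictification

variable {A : Type u} [Bicategory.{u, u} A] (X : A ⥤ᵖ TwoCatPI.{u})

/-- The formal 1-cells `f(v)`, for `f : b ⟶ a` and a 1-cell `v` of `X b`. -/
structure FormalCell (a : A) (x y : (X.obj a).carrier) : Type u where
  {b : A}
  f : b ⟶ a
  {x' : (X.obj b).carrier}
  {y' : (X.obj b).carrier}
  v : x' ⟶ y'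
  -- The ends are constrained by equations instead of being fixed values: the pushforward along `g`
  -- must have the source `X g x`, which is only propositionally equal to `X (f ≫ g) x'`.
  src_eq : x = (X.map f).fn.obj x'
  tgt_eq : y = (X.map f).fn.obj y'

/-- The formal 1-cells, as generators for the 1-cells of `X a`. -/
def formalCells (a : A) : Generators.{u, u, u} (X.obj a).carrier where
  Gen := FormalCell X a
  ev e := (homCast e.src_eq e.tgt_eq).obj ((X.map e.f).fn.map e.v)

variable {X} in
lemma of_ev {a : A} {x y : (X.obj a).carrier} (e : (formalCells X a).Gen x y) :
    Arr.of ((formalCells X a).ev e) = Arr.of ((X.map e.f).fn.map e.v) :=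
  Arr.of_homCast _ _ _

/-- The constraint of `X` is an icon, and icons exist only between pseudofunctors that agree on
objects. This is why `(f ≫ g)(v)` has the same ends as `g` applied to `f(v)`. -/
lemma map_comp_obj {a b c : A} (f : a ⟶ b) (g : b ⟶ c) (x : (X.obj a).carrier) :
    (X.map (f ≫ g)).fn.obj x = (X.map g).fn.obj ((X.map f).fn.obj x) :=
  (X.mapComp f g).hom.icon.obj_eq x

/-- The action of the 1-cells of `A` on formal 1-cells. -/
def pushGen {a c : A} (g : a ⟶ c) {x y : (X.obj a).carrier} (e : (formalCells X a).Gen x y) :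
    (formalCells X c).Gen ((X.map g).fn.obj x) ((X.map g).fn.obj y) where
  f := e.f ≫ g
  v := e.v
  src_eq := (congrArg (X.map g).fn.obj e.src_eq).trans (map_comp_obj X e.f g e.x').symm
  tgt_eq := (congrArg (X.map g).fn.obj e.tgt_eq).trans (map_comp_obj X e.f g e.y').symm

/-- The comparison of the values of `g(f(v))` and `(fg)(v)`. -/
def pushGenIso {a c : A} (g : a ⟶ c) {x y : (X.obj a).carrier} (e : (formalCells X a).Gen x y) :
    (X.map g).fn.map ((formalCells X a).ev e) ≅ (formalCells X c).ev (pushGen X g e) :=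
  Arr.toIso (eqToIso (Arr.of_map_congr _ (of_ev e)) ≪≫ (compArr X e.f g e.v).symm ≪≫
    eqToIso (of_ev (pushGen X g e)).symm)

/-- The values of the strictification on objects. -/
def strictObj (a : A) : TwoCatPI.{u} := ⟨(formalCells X a).Full⟩

/-- The values of the strictification on 1-cells. -/
def strictMap {a c : A} (g : a ⟶ c) : strictObj X a ⟶ strictObj X c :=
  ⟨fullMap (X.map g).fn (pushGen X g) (pushGenIso X g)⟩

/-- The evaluation of strings of formal 1-cells. -/
def evalHom (a : A) : strictObj X a ⟶ X.obj a := ⟨Full.proj (formalCells X a)⟩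

/-- The pseudonaturality of the evaluation. -/
def evalIso {a c : A} (g : a ⟶ c) : strictMap X g ≫ evalHom X c ≅ evalHom X a ≫ X.map g where
  hom := ⟨fullMapIcon (X.map g).fn (pushGen X g) (pushGenIso X g)⟩
  inv := ⟨fullMapIconInv (X.map g).fn (pushGen X g) (pushGenIso X g)⟩
  hom_inv_id := hom₂_ext_arr fun p =>
    (Arr.ofIso (Word.mapEval (X.map g).fn (pushGen X g) (pushGenIso X g) p)).inv_hom_id
  inv_hom_id := hom₂_ext_arr fun p =>
    (Arr.ofIso (Word.mapEval (X.map g).fn (pushGen X g) (pushGenIso X g) p)).hom_inv_id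

lemma strictMap_isTwoFunctor {a c : A} (g : a ⟶ c) : IsTwoFunctor (strictMap X g).fn :=
  fullMap_isTwoFunctor _ _ _

variable {X} in
/-- The composite of a string of formal 1-cells. -/
abbrev ev {a : A} {x y : (strictObj X a).carrier} (p : x ⟶ y) :
    (evalHom X a).fn.obj x ⟶ (evalHom X a).fn.obj y := (evalHom X a).fn.map p

/-- The components of `evalIso`. -/
def evalArr {a c : A} (g : a ⟶ c) {x y : (strictObj X a).carrier} (p : x ⟶ y) :
    Arr.of (ev ((strictMap X g).fn.map p)) ≅ Arr.of ((X.map g).fn.map (ev p)) :=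
  arrIso (evalIso X g) p

lemma evalArr_naturality {a c : A} (g : a ⟶ c) {x y x' y' : (strictObj X a).carrier}
    {p : x ⟶ y} {q : x' ⟶ y'} (m : Arr.of p ⟶ Arr.of q) :
    Arr.map (evalHom X c).fn (Arr.map (strictMap X g).fn m) ≫ (evalArr X g q).hom =
      (evalArr X g p).hom ≫ Arr.map (X.map g).fn (Arr.map (evalHom X a).fn m) := by
  rw [← Arr.map_comp_map, ← Arr.map_comp_map]
  exact arr_naturality (evalIso X g).hom m

/-- A formal 1-cell, as a 1-cell of the strictification. -/
def gen {a b : A} (f : b ⟶ a) {x' y' : (X.obj b).carrier} (v : x' ⟶ y') :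
    (Full.of ((X.map f).fn.obj x') : (strictObj X a).carrier) ⟶
      Full.of ((X.map f).fn.obj y') :=
  Full.gen (P := formalCells X a) ⟨f, v, rfl, rfl⟩

lemma of_ev_gen {a b : A} (f : b ⟶ a) {x' y' : (X.obj b).carrier} (v : x' ⟶ y') :
    Arr.of (ev (gen X f v)) = Arr.of ((X.map f).fn.map v) :=
  congrArg Arr.of (Word.eval_single (P := formalCells X a) ⟨f, v, rfl, rfl⟩)

lemma of_gen {a b : A} (f : b ⟶ a) {x' y' : (X.obj b).carrier} (v : x' ⟶ y')
    {x y : (X.obj a).carrier} (hx : x = (X.map f).fn.obj x') (hy : y = (X.map f).fn.obj y') :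
    Arr.of (Full.gen (P := formalCells X a) ⟨f, v, hx, hy⟩) = Arr.of (gen X f v) := by
  subst hx hy; rfl

lemma of_strictMap_gen {a b c : A} (f : b ⟶ a) (g : a ⟶ c) {x' y' : (X.obj b).carrier}
    (v : x' ⟶ y') : Arr.of ((strictMap X g).fn.map (gen X f v)) = Arr.of (gen X (f ≫ g) v) :=
  of_gen X (f ≫ g) v _ _

lemma ofCell_pushGenIso {a c : A} (g : a ⟶ c) {x y : (X.obj a).carrier}
    (e : (formalCells X a).Gen x y) :
    Arr.ofCell (pushGenIso X g e).hom = eqToHom (Arr.of_map_congr _ (of_ev e)) ≫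
      (compArr X e.f g e.v).inv ≫ eqToHom (of_ev (pushGen X g e)).symm := rfl

lemma eqToHom_conj_inv {C : Type u₁} [Category.{v₁} C] {x x' x'' y y' y'' : C} (h : x = x')
    (h' : x' = x'') (m : y'' ≅ x'') (k'' : y'' = y') (k' : y' = y) (k : y = y'') (h'' : x'' = x) :
    eqToHom h ≫ (eqToHom h' ≫ m.inv ≫ eqToHom k'') ≫ eqToHom k' =
      (eqToIso k ≪≫ m ≪≫ eqToIso h'').inv := by
  subst h h' k'' k'; simp

/-- Evaluating `g` applied to `f(v)` gives `X (f ≫ g) v`, while applying `X g` to the value of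
`f(v)` gives `X g (X f v)`. The two differ by the composition constraint of `X`. -/
lemma evalArr_gen {a b c : A} (f : b ⟶ a) (g : a ⟶ c) {x' y' : (X.obj b).carrier}
    (v : x' ⟶ y') :
    (evalArr X g (gen X f v)).hom =
      eqToHom ((Arr.of_map_congr _ (of_strictMap_gen X f g v)).trans (of_ev_gen X (f ≫ g) v)) ≫
      (compArr X f g v).hom ≫ eqToHom (Arr.of_map_congr _ (of_ev_gen X f v)).symm := by
  suffices h : evalArr X g (gen X f v) = eqToIso ((Arr.of_map_congr (evalHom X c).fn
      (of_strictMap_gen X f g v)).trans (of_ev_gen X (f ≫ g) v)) ≪≫ compArr X f g v ≪≫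
        eqToIso (Arr.of_map_congr _ (of_ev_gen X f v)).symm by
    rw [h]; rfl
  -- `mapEval` goes from the image of the value to the value of the image, so the formula at
  -- generators is available for the inverse.
  apply Iso.ext_inv
  refine (fullMapIconInv_arr_gen (X.map g).fn (pushGen X g) (pushGenIso X g)
    ⟨f, v, rfl, rfl⟩).trans ?_
  refine (congrArg (fun k => _ ≫ k ≫ _) (ofCell_pushGenIso X g ⟨f, v, rfl, rfl⟩)).trans ?_
  exact eqToHom_conj_inv _ _ (compArr X f g v) _ _ _ _

end Strictification

end TwoDim

namespace TwoDim

open TwoCatPI Generators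

/-! ### Equality of morphisms up to equality of their ends -/

section EqUpTo

variable {C : Type u₁} [Category.{v₁} C]

/-- Equality of morphisms up to equalities of their sources and targets. -/
def EqUpTo {x y x' y' : C} (m : x ⟶ y) (n : x' ⟶ y') : Prop :=
  ∃ (hx : x = x') (hy : y = y'), m = eqToHom hx ≫ n ≫ eqToHom hy.symm

namespace EqUpTo

variable {x y z x' y' z' x'' y'' : C}

lemma refl (m : x ⟶ y) : EqUpTo m m := ⟨rfl, rfl, by simp⟩

lemma of_eq {m n : x ⟶ y} (h : m = n) : EqUpTo m n := h ▸ refl m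

lemma symm {m : x ⟶ y} {n : x' ⟶ y'} (h : EqUpTo m n) : EqUpTo n m := by
  obtain ⟨rfl, rfl, rfl⟩ := h
  exact ⟨rfl, rfl, by simp⟩

lemma trans {m : x ⟶ y} {n : x' ⟶ y'} {k : x'' ⟶ y''} (h : EqUpTo m n) (h' : EqUpTo n k) :
    EqUpTo m k := by
  obtain ⟨rfl, rfl, rfl⟩ := h
  obtain ⟨rfl, rfl, rfl⟩ := h'
  exact ⟨rfl, rfl, by simp⟩

lemma comp {m : x ⟶ y} {n : y ⟶ z} {m' : x' ⟶ y'} {n' : y' ⟶ z'} (h : EqUpTo m m')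
    (h' : EqUpTo n n') : EqUpTo (m ≫ n) (m' ≫ n') := by
  obtain ⟨rfl, rfl, rfl⟩ := h
  obtain ⟨_, rfl, rfl⟩ := h'
  exact ⟨rfl, rfl, by simp⟩

lemma inv {m : x ≅ y} {n : x' ≅ y'} (h : EqUpTo m.hom n.hom) : EqUpTo m.inv n.inv := by
  obtain ⟨rfl, rfl, h⟩ := h
  obtain rfl : m = n := Iso.ext (by simpa using h)
  exact refl _

lemma eq {m n : x ⟶ y} (h : EqUpTo m n) : m = n := by
  obtain ⟨_, _, rfl⟩ := h
  simp

lemma of_isEqToHom {m : x ⟶ y} {m' : x' ⟶ y'} (h : IsEqToHom m) (h' : IsEqToHom m')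
    (hx : x = x') : EqUpTo m m' := by
  subst hx
  obtain ⟨rfl, rfl⟩ := h
  obtain ⟨rfl, rfl⟩ := h'
  exact refl _

lemma isEqToHom {m : x ⟶ y} {m' : x' ⟶ y'} (h : EqUpTo m m') (h' : IsEqToHom m') :
    IsEqToHom m := by
  obtain ⟨rfl, rfl, rfl⟩ := h
  exact (IsEqToHom.eqToHom _).comp (h'.comp (.eqToHom _))

lemma isEqToHom_comp {i : x ⟶ y} (hi : IsEqToHom i) (m : y ⟶ z) : EqUpTo (i ≫ m) m := by
  obtain ⟨rfl, rfl⟩ := hi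
  exact of_eq (by simp)

lemma conj (h : x = x') (m : x' ⟶ y') (h' : y' = y) : EqUpTo (eqToHom h ≫ m ≫ eqToHom h') m :=
  ⟨h, h'.symm, rfl⟩

/-- If `m` and `n` agree up to equality of sources, then `m ≫ n⁻¹` is an identity. -/
lemma isEqToHom_comp_inv {m : x ⟶ y} {n : x' ≅ y} (h : EqUpTo m n.hom) :
    IsEqToHom (m ≫ n.inv) := by
  obtain ⟨rfl, _, rfl⟩ := h
  exact ⟨rfl, by simp⟩

/-- This direction recovers a coherence equation from the knowledge that a comparison is an
identity. -/
lemma of_isEqToHom_comp_inv {m : x ⟶ y} {n : x' ≅ y} (h : IsEqToHom (m ≫ n.inv)) :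
    EqUpTo m n.hom := by
  obtain ⟨rfl, h⟩ := h
  exact of_eq ((Iso.comp_inv_eq _).1 h |>.trans (Category.id_comp _))

lemma arrMap {B : Type u₁} [Bicategory.{w₁, v₁} B] {C : Type u₂} [Bicategory.{w₂, v₂} C]
    (F : B ⥤ᵖ C) {a₁ b₁ a₂ b₂ a₁' b₁' a₂' b₂' : B} {f₁ : a₁ ⟶ b₁} {f₂ : a₂ ⟶ b₂}
    {f₁' : a₁' ⟶ b₁'} {f₂' : a₂' ⟶ b₂'} {m : Arr.of f₁ ⟶ Arr.of f₂} {n : Arr.of f₁' ⟶ Arr.of f₂'}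
    (h : EqUpTo m n) : EqUpTo (Arr.map F m) (Arr.map F n) := by
  obtain ⟨h, h', rfl⟩ := h
  rw [Arr.map_comp, Arr.map_comp, Arr.map_eqToHom, Arr.map_eqToHom]
  exact conj _ _ _

end EqUpTo

end EqUpTo

namespace TwoCatPI

lemma arr_congr {X Y : TwoCatPI.{u}} {F G : X ⟶ Y} (α : F ⟶ G) {x y x' y' : X.carrier}
    {v : x ⟶ y} {v' : x' ⟶ y'} (h : Arr.of v = Arr.of v') : EqUpTo (arr α v) (arr α v') := by
  cases h
  exact .refl _

lemma eqUpTo_of_arr {X Y : TwoCatPI.{u}} {F G F' G' : X ⟶ Y} {α : F ⟶ G} {β : F' ⟶ G'}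
    (hF : F = F') (hG : G = G') (h : ∀ {x y : X.carrier} (v : x ⟶ y), EqUpTo (arr α v) (arr β v)) :
    EqUpTo α β := by
  subst hF hG
  exact .of_eq (hom₂_ext_arr fun v => (h v).eq)

end TwoCatPI

/-! ### Lifting 2-cells along evaluation; strict functoriality of the action -/

section Strictification

variable {A : Type u} [Bicategory.{u, u} A] (X : A ⥤ᵖ TwoCatPI.{u})

section Lift

variable {X} {W : TwoCatPI.{u}} {c : A} {F G : W ⟶ strictObj X c}

/-- The evaluation is locally fully faithful, so that 2-cells can be lifted along it. -/
def liftHom₂ (α : F ≫ evalHom X c ⟶ G ≫ evalHom X c) : F ⟶ G :=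
  ⟨Full.iconLift α.icon⟩

lemma map_arr_liftHom₂ (α : F ≫ evalHom X c ⟶ G ≫ evalHom X c) {x y : W.carrier} (v : x ⟶ y) :
    Arr.map (evalHom X c).fn (arr (liftHom₂ α) v) = arr α v :=
  Full.map_proj_arr_iconLift α.icon v

@[simp]
lemma liftHom₂_whiskerRight (α : F ≫ evalHom X c ⟶ G ≫ evalHom X c) :
    liftHom₂ α ▷ evalHom X c = α :=
  hom₂_ext_arr fun v => map_arr_liftHom₂ α v

lemma map_evalHom_injective {x y x' y' : (strictObj X c).carrier} {p : x ⟶ y} {q : x' ⟶ y'}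
    {m n : Arr.of p ⟶ Arr.of q}
    (h : Arr.map (evalHom X c).fn m = Arr.map (evalHom X c).fn n) : m = n :=
  Full.map_proj_injective h

lemma whiskerRight_evalHom_injective {α β : F ⟶ G} (h : α ▷ evalHom X c = β ▷ evalHom X c) :
    α = β :=
  hom₂_ext_arr fun v => map_evalHom_injective (congrArg (fun k => arr k v) h)

/-- Evaluation is faithful on 2-cells but forgets the strings, so their equality has to be supplied
separately. -/
lemma eqUpTo_of_map_evalHom {x y x' y' x₁ y₁ x₁' y₁' : (strictObj X c).carrier} {p : x ⟶ y}
    {q : x' ⟶ y'} {m : Arr.of p ⟶ Arr.of q} {p₁ : x₁ ⟶ y₁} {q₁ : x₁' ⟶ y₁'}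
    {n : Arr.of p₁ ⟶ Arr.of q₁} (hp : Arr.of p = Arr.of p₁) (hq : Arr.of q = Arr.of q₁)
    (h : EqUpTo (Arr.map (evalHom X c).fn m) (Arr.map (evalHom X c).fn n)) : EqUpTo m n := by
  cases hp
  cases hq
  exact .of_eq (map_evalHom_injective h.eq)

lemma isEqToHom_of_map_evalHom {x y x' y' : (strictObj X c).carrier} {p : x ⟶ y} {q : x' ⟶ y'}
    {m : Arr.of p ⟶ Arr.of q} (hpq : Arr.of p = Arr.of q)
    (h : IsEqToHom (Arr.map (evalHom X c).fn m)) : IsEqToHom m := by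
  cases hpq
  exact ⟨rfl, map_evalHom_injective (h.eq (by rw [eqToHom_refl, Arr.map_id]; exact .id _))⟩

/-- Invertible 2-cells can be lifted along the evaluation. -/
def liftIso₂ (α : F ≫ evalHom X c ≅ G ≫ evalHom X c) : F ≅ G where
  hom := liftHom₂ α.hom
  inv := liftHom₂ α.inv
  hom_inv_id := whiskerRight_evalHom_injective (by simp)
  inv_hom_id := whiskerRight_evalHom_injective (by simp)

end Lift

lemma compArr_congr {a b c : A} (f : a ⟶ b) (g : b ⟶ c) {x y x' y' : (X.obj a).carrier}
    {v : x ⟶ y} {v' : x' ⟶ y'} (h : Arr.of v = Arr.of v') :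
    EqUpTo (compArr X f g v).hom (compArr X f g v').hom := arr_congr _ h

lemma idArr_congr (a : A) {x y x' y' : (X.obj a).carrier}
    {v : x ⟶ y} {v' : x' ⟶ y'} (h : Arr.of v = Arr.of v') :
    EqUpTo (idArr X a v).hom (idArr X a v').hom := arr_congr _ h

lemma evalArr_congr {a c : A} (g : a ⟶ c) {x y x' y' : (strictObj X a).carrier}
    {p : x ⟶ y} {q : x' ⟶ y'} (h : Arr.of p = Arr.of q) :
    EqUpTo (evalArr X g p).hom (evalArr X g q).hom := arr_congr _ h

lemma evalArr_gen_eqUpTo {a b c : A} (f : b ⟶ a) (g : a ⟶ c) {x' y' : (X.obj b).carrier}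
    (v : x' ⟶ y') : EqUpTo (evalArr X g (gen X f v)).hom (compArr X f g v).hom := by
  rw [evalArr_gen]
  exact .conj _ _ _

lemma strictObj_isEqToHom_arr {a : A} {W : TwoCatPI.{u}} {F G : strictObj X a ⟶ W}
    (hF : IsTwoFunctor F.fn) (hG : IsTwoFunctor G.fn) (α : F ⟶ G)
    (h : ∀ {b : A} (f : b ⟶ a) {x' y' : (X.obj b).carrier} (v : x' ⟶ y'),
      IsEqToHom (arr α (gen X f v))) {x y : (strictObj X a).carrier} (p : x ⟶ y) :
    IsEqToHom (arr α p) :=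
  Full.isEqToHom_arr hF hG α.icon (by rintro _ _ ⟨f, v, rfl, rfl⟩; exact h f v) p

/-- The comparison of the actions of `g ≫ h` and of `g` followed by `h`. -/
def strictMapComp {a b c : A} (g : a ⟶ b) (h : b ⟶ c) :
    strictMap X (g ≫ h) ⟶ strictMap X g ≫ strictMap X h :=
  liftHom₂ ((evalIso X (g ≫ h)).hom ≫ evalHom X a ◁ (X.mapComp g h).hom ≫
    (α_ _ _ _).inv ≫ (evalIso X g).inv ▷ X.map h ≫ (α_ _ _ _).hom ≫
    strictMap X g ◁ (evalIso X h).inv ≫ (α_ _ _ _).inv)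

/-- The comparison of the action of an identity with the identity. -/
def strictMapId (a : A) : strictMap X (𝟙 a) ⟶ 𝟙 (strictObj X a) :=
  liftHom₂ ((evalIso X (𝟙 a)).hom ≫ evalHom X a ◁ (X.mapId a).hom ≫ (ρ_ _).hom ≫ (λ_ _).inv)

lemma comp_id_inv_aux {C : Type u₁} [Category.{v₁} C] {x y z t s : C} (m : x ⟶ y) (n : y ⟶ z)
    (j : s ≅ t) (i : t ≅ z) :
    m ≫ n ≫ 𝟙 z ≫ i.inv ≫ 𝟙 t ≫ j.inv ≫ 𝟙 s = (m ≫ n) ≫ (j ≪≫ i).inv := by simp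

lemma comp_id_id_aux {C : Type u₁} [Category.{v₁} C] {x y z : C} (m : x ⟶ y) (n : y ⟶ z) :
    m ≫ n ≫ 𝟙 z ≫ 𝟙 z = m ≫ n := by simp

lemma map_arr_strictMapComp {a b c : A} (g : a ⟶ b) (h : b ⟶ c)
    {x y : (strictObj X a).carrier} (p : x ⟶ y) :
    Arr.map (evalHom X c).fn (arr (strictMapComp X g h) p) =
      ((evalArr X (g ≫ h) p).hom ≫ (compArr X g h (ev p)).hom) ≫
        (evalArr X h ((strictMap X g).fn.map p) ≪≫
          Arr.mapIso (X.map h).fn (evalArr X g p)).inv := by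
  refine (map_arr_liftHom₂ _ p).trans ?_
  exact comp_id_inv_aux (evalArr X (g ≫ h) p).hom (compArr X g h (ev p)).hom
    (evalArr X h ((strictMap X g).fn.map p)) (Arr.mapIso (X.map h).fn (evalArr X g p))

lemma map_arr_strictMapId (a : A) {x y : (strictObj X a).carrier} (p : x ⟶ y) :
    Arr.map (evalHom X a).fn (arr (strictMapId X a) p) =
      (evalArr X (𝟙 a) p).hom ≫ (idArr X a (ev p)).hom := by
  refine (map_arr_liftHom₂ _ p).trans ?_
  exact comp_id_id_aux (evalArr X (𝟙 a) p).hom (idArr X a (ev p)).hom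

variable [Strict A]

lemma of_gen_congr {a b : A} {f g : b ⟶ a} (h : f = g) {x' y' : (X.obj b).carrier}
    (v : x' ⟶ y') : Arr.of (gen X f v) = Arr.of (gen X g v) := by subst h; rfl

/-- Both actions send `f(v)` to the same string since composition in `A` is strictly associative.
After evaluation the claim is the associativity coherence of `X` at `v`. -/
lemma strictMapComp_gen {a b c d : A} (f : a ⟶ b) (g : b ⟶ c) (h : c ⟶ d)
    {x' y' : (X.obj a).carrier} (v : x' ⟶ y') :
    IsEqToHom (arr (strictMapComp X g h) (gen X f v)) := by
  refine isEqToHom_of_map_evalHom ?_ ?_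
  · exact (of_strictMap_gen X f (g ≫ h) v).trans <|
      (of_gen_congr X (Strict.assoc f g h).symm v).trans <|
      (of_strictMap_gen X (f ≫ g) h v).symm.trans
        (Arr.of_map_congr _ (of_strictMap_gen X f g v).symm)
  · refine (congrArg IsEqToHom (map_arr_strictMapComp X g h (gen X f v))).mpr ?_
    apply EqUpTo.isEqToHom_comp_inv
    refine .trans (.comp (evalArr_gen_eqUpTo X f (g ≫ h) v)
      (compArr_congr X g h (of_ev_gen X f v))) ?_
    refine .trans ?_ (EqUpTo.comp ((evalArr_congr X h (of_strictMap_gen X f g v)).trans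
      (evalArr_gen_eqUpTo X (f ≫ g) h v)) ((evalArr_gen_eqUpTo X f g v).arrMap _)).symm
    rw [compArr_assoc]
    refine (EqUpTo.isEqToHom_comp ?_ _).symm
    -- The only surviving discrepancy is `X` applied to an associator of `A`, which is an identity.
    exact isEqToHom_map₂ X ⟨Strict.assoc f g h, congrArg Iso.hom (Strict.associator_eqToIso f g h)⟩ v

lemma strictMapId_gen {a b : A} (f : a ⟶ b) {x' y' : (X.obj a).carrier} (v : x' ⟶ y') :
    IsEqToHom (arr (strictMapId X b) (gen X f v)) := by
  refine isEqToHom_of_map_evalHom ?_ ?_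
  · exact (of_strictMap_gen X f (𝟙 b) v).trans (of_gen_congr X (Strict.comp_id f) v)
  · refine (congrArg IsEqToHom (map_arr_strictMapId X b (gen X f v))).mpr ?_
    refine EqUpTo.isEqToHom (.comp (evalArr_gen_eqUpTo X f (𝟙 b) v)
      (idArr_congr X b (of_ev_gen X f v))) ?_
    rw [compArr_id_right]
    exact isEqToHom_map₂ X ⟨Strict.comp_id f, congrArg Iso.hom (Strict.rightUnitor_eqToIso f)⟩ v

/-- Both sides are 2-functors, so inspecting the formal cells suffices. The equality of the two
1-cells, extracted later as `strictMap_comp`, is part of this statement. -/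
lemma isEqToHom_strictMapComp {a b c : A} (g : a ⟶ b) (h : b ⟶ c) :
    IsEqToHom (strictMapComp X g h) :=
  isEqToHom_of_arr fun p => strictObj_isEqToHom_arr X (strictMap_isTwoFunctor X _)
    ((strictMap_isTwoFunctor X _).comp (strictMap_isTwoFunctor X _)) _
    (fun f _ _ v => strictMapComp_gen X f g h v) p

lemma isEqToHom_strictMapId (a : A) : IsEqToHom (strictMapId X a) :=
  isEqToHom_of_arr fun p => strictObj_isEqToHom_arr X (strictMap_isTwoFunctor X _)
    (twoFunctors.id_holds _) _ (fun f _ _ v => strictMapId_gen X f v) p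

/-- This is compatibility of evaluation with composition, at every string. It is read off from
`strictMapComp` being an identity, since that 2-cell was defined by lifting the discrepancy between
the two sides. -/
lemma evalArr_comp {a b c : A} (g : a ⟶ b) (h : b ⟶ c) {x y : (strictObj X a).carrier}
    (p : x ⟶ y) :
    EqUpTo ((evalArr X (g ≫ h) p).hom ≫ (compArr X g h (ev p)).hom)
      ((evalArr X h ((strictMap X g).fn.map p)).hom ≫
        Arr.map (X.map h).fn (evalArr X g p).hom) := by
  refine EqUpTo.of_isEqToHom_comp_inv (n := evalArr X h ((strictMap X g).fn.map p) ≪≫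
    Arr.mapIso (X.map h).fn (evalArr X g p)) ?_
  refine (congrArg IsEqToHom (map_arr_strictMapComp X g h p)).mp ?_
  exact (isEqToHom_arr (isEqToHom_strictMapComp X g h) p).arrMap _

lemma evalArr_id (a : A) {x y : (strictObj X a).carrier} (p : x ⟶ y) :
    IsEqToHom ((evalArr X (𝟙 a) p).hom ≫ (idArr X a (ev p)).hom) := by
  refine (congrArg IsEqToHom (map_arr_strictMapId X a p)).mp ?_
  exact (isEqToHom_arr (isEqToHom_strictMapId X a) p).arrMap _

end Strictification

end TwoDim

namespace TwoDim

open TwoCatPI Generators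

open scoped Pseudofunctor.StrongTrans

/-! ### Pseudonatural transformations in components -/

section NatArr

variable {A : Type u} [Bicategory.{u, u} A] {F G : A ⥤ᵖ TwoCatPI.{u}}

/-- The components of the pseudonaturality isomorphisms of a transformation between pseudofunctors
to `2Cat_{p,i}`. -/
def natArr (σ : F ⟶ G) {a b : A} (f : a ⟶ b) {x y : (F.obj a).carrier} (v : x ⟶ y) :
    Arr.of ((σ.app b).fn.map ((F.map f).fn.map v)) ≅
      Arr.of ((G.map f).fn.map ((σ.app a).fn.map v)) :=
  arrIso (σ.naturality f) v

lemma natArr_congr (σ : F ⟶ G) {a b : A} (f : a ⟶ b) {x y x' y' : (F.obj a).carrier}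
    {v : x ⟶ y} {v' : x' ⟶ y'} (h : Arr.of v = Arr.of v') :
    EqUpTo (natArr σ f v).hom (natArr σ f v').hom := arr_congr _ h

lemma natArr_naturality (σ : F ⟶ G) {a b : A} (f : a ⟶ b) {x y x' y' : (F.obj a).carrier}
    {v : x ⟶ y} {v' : x' ⟶ y'} (m : Arr.of v ⟶ Arr.of v') :
    Arr.map (σ.app b).fn (Arr.map (F.map f).fn m) ≫ (natArr σ f v').hom =
      (natArr σ f v).hom ≫ Arr.map (G.map f).fn (Arr.map (σ.app a).fn m) := by
  rw [← Arr.map_comp_map, ← Arr.map_comp_map]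
  exact arr_naturality (σ.naturality f).hom m

lemma natArr_map₂ (σ : F ⟶ G) {a b : A} {f g : a ⟶ b} (η : f ⟶ g) {x y : (F.obj a).carrier}
    (v : x ⟶ y) :
    Arr.map (σ.app b).fn (arr (F.map₂ η) v) ≫ (natArr σ g v).hom =
      (natArr σ f v).hom ≫ arr (G.map₂ η) ((σ.app a).fn.map v) :=
  congrArg (fun α => arr α v) (σ.naturality_naturality η)

/-- The unitors and associators of `2Cat_{p,i}` have identity components; these lemmas discard them
from the pseudonaturality axioms. -/
lemma id_aux {C : Type u₁} [Category.{v₁} C] {x y z : C} {m : x ⟶ y} {n : y ⟶ z} {k : x ⟶ z} :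
    m ≫ n = k ≫ 𝟙 z ≫ 𝟙 z ↔ m ≫ n = k := by simp

lemma comp_aux {C : Type u₁} [Category.{v₁} C] {x y z t s : C} {m : x ⟶ y} {n : y ⟶ z}
    {p : x ⟶ t} {q : t ⟶ s} {r : s ⟶ z} :
    m ≫ n = p ≫ 𝟙 t ≫ q ≫ 𝟙 s ≫ r ≫ 𝟙 z ↔ m ≫ n = p ≫ q ≫ r := by simp

lemma comp_aux' {C : Type u₁} [Category.{v₁} C] {x z t s : C}
    (p : x ⟶ t) (q : t ⟶ s) (r : s ⟶ z) :
    p ≫ q ≫ r = p ≫ 𝟙 t ≫ q ≫ 𝟙 s ≫ r ≫ 𝟙 z := by simp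

lemma natArr_id (σ : F ⟶ G) (a : A) {x y : (F.obj a).carrier} (v : x ⟶ y) :
    (natArr σ (𝟙 a) v).hom ≫ (idArr G a ((σ.app a).fn.map v)).hom =
      Arr.map (σ.app a).fn (idArr F a v).hom :=
  id_aux.1 (congrArg (fun α => arr α v) (σ.naturality_id a))

lemma natArr_comp (σ : F ⟶ G) {a b c : A} (f : a ⟶ b) (g : b ⟶ c) {x y : (F.obj a).carrier}
    (v : x ⟶ y) :
    (natArr σ (f ≫ g) v).hom ≫ (compArr G f g ((σ.app a).fn.map v)).hom =
      Arr.map (σ.app c).fn (compArr F f g v).hom ≫ (natArr σ g ((F.map f).fn.map v)).hom ≫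
        Arr.map (G.map g).fn (natArr σ f v).hom :=
  comp_aux.1 (congrArg (fun α => arr α v) (σ.naturality_comp f g))

lemma naturality_id_of_arr {x x' : TwoCatPI.{u}} {p : x ⟶ x'} {k : x ⟶ x} {k' : x' ⟶ x'}
    (m : k ⟶ 𝟙 x) (m' : k' ⟶ 𝟙 x') (n : k ≫ p ⟶ p ≫ k')
    (h : ∀ {s t : x.carrier} (v : s ⟶ t),
      (arr n v : Arr.of (p.fn.map (k.fn.map v)) ⟶ _) ≫ arr m' (p.fn.map v) =
        Arr.map p.fn (arr m v)) :
    n ≫ p ◁ m' = m ▷ p ≫ (λ_ p).hom ≫ (ρ_ p).inv :=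
  hom₂_ext_arr fun v => id_aux.2 (h v)

lemma naturality_comp_of_arr {x y z x' y' z' : TwoCatPI.{u}} {p : x ⟶ x'} {q : y ⟶ y'}
    {r : z ⟶ z'} {f : x ⟶ y} {g : y ⟶ z} {k : x ⟶ z} {f' : x' ⟶ y'} {g' : y' ⟶ z'}
    {k' : x' ⟶ z'} (m : k ⟶ f ≫ g) (m' : k' ⟶ f' ≫ g') (n : f ≫ q ⟶ p ≫ f')
    (n' : g ≫ r ⟶ q ≫ g') (n'' : k ≫ r ⟶ p ≫ k')
    (h : ∀ {s t : x.carrier} (v : s ⟶ t),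
      (arr n'' v : Arr.of (r.fn.map (k.fn.map v)) ⟶ _) ≫ arr m' (p.fn.map v) =
        Arr.map r.fn (arr m v) ≫ arr n' (f.fn.map v) ≫ Arr.map g'.fn (arr n v)) :
    n'' ≫ p ◁ m' = m ▷ r ≫ (α_ f g r).hom ≫ f ◁ n' ≫ (α_ f q g').inv ≫ n ▷ g' ≫
      (α_ p f' g').hom :=
  hom₂_ext_arr fun v => (h v).trans
    (comp_aux' (Arr.map r.fn (arr m v)) (arr n' (f.fn.map v)) (Arr.map g'.fn (arr n v)))

/-- A pseudonatural transformation between pseudofunctors to `2Cat_{p,i}`, given by components. -/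
def transOfArr (app : ∀ a, F.obj a ⟶ G.obj a)
    (nat : ∀ {a b : A} (f : a ⟶ b), F.map f ≫ app b ≅ app a ≫ G.map f)
    (nat₂ : ∀ {a b : A} {f g : a ⟶ b} (η : f ⟶ g) {x y : (F.obj a).carrier} (v : x ⟶ y),
      Arr.map (app b).fn (arr (F.map₂ η) v) ≫ arr (nat g).hom v =
        (arr (nat f).hom v : Arr.of ((app b).fn.map ((F.map f).fn.map v)) ⟶ _) ≫
          arr (G.map₂ η) ((app a).fn.map v))
    (nat_id : ∀ (a : A) {x y : (F.obj a).carrier} (v : x ⟶ y),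
      (arr (nat (𝟙 a)).hom v : Arr.of ((app a).fn.map ((F.map (𝟙 a)).fn.map v)) ⟶ _) ≫
          (idArr G a ((app a).fn.map v)).hom = Arr.map (app a).fn (idArr F a v).hom)
    (nat_comp : ∀ {a b c : A} (f : a ⟶ b) (g : b ⟶ c) {x y : (F.obj a).carrier} (v : x ⟶ y),
      (arr (nat (f ≫ g)).hom v : Arr.of ((app c).fn.map ((F.map (f ≫ g)).fn.map v)) ⟶ _) ≫
          (compArr G f g ((app a).fn.map v)).hom =
        Arr.map (app c).fn (compArr F f g v).hom ≫ arr (nat g).hom ((F.map f).fn.map v) ≫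
          Arr.map (G.map g).fn (arr (nat f).hom v)) : F ⟶ G where
  app := app
  naturality := nat
  naturality_naturality η := hom₂_ext_arr fun v => nat₂ η v
  naturality_id a := naturality_id_of_arr _ _ _ (nat_id a)
  naturality_comp f g := naturality_comp_of_arr _ _ _ _ _ (nat_comp f g)

end NatArr

lemma LocallyFull.eq_conj {B : Type u₁} [Bicategory.{w₁, v₁} B] {C : Type u₂} {φ : C → B}
    {P : OneCellClass φ} {x y : LocallyFull P} {f g f' g' : x ⟶ y} (h : f = f') (h' : g = g')
    {η : f ⟶ g} {θ : f' ⟶ g'} (e : EqUpTo η.cell θ.cell) :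
    η = eqToHom h ≫ θ ≫ eqToHom h'.symm := by
  subst h h'
  exact LocallyFull.hom₂_ext (by simpa using e.eq)

/-! ### The strictification on 2-cells -/

section Strictification

variable {A : Type u} [Bicategory.{u, u} A] (X : A ⥤ᵖ TwoCatPI.{u})

/-- The values of the strictification on 2-cells. -/
def strictMap₂ {a b : A} {f g : a ⟶ b} (η : f ⟶ g) : strictMap X f ⟶ strictMap X g :=
  liftHom₂ ((evalIso X f).hom ≫ evalHom X a ◁ X.map₂ η ≫ (evalIso X g).inv)

lemma strictMap₂_whiskerRight {a b : A} {f g : a ⟶ b} (η : f ⟶ g) :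
    strictMap₂ X η ▷ evalHom X b =
      (evalIso X f).hom ≫ evalHom X a ◁ X.map₂ η ≫ (evalIso X g).inv :=
  liftHom₂_whiskerRight _

lemma strictMap₂_id {a b : A} (f : a ⟶ b) : strictMap₂ X (𝟙 f) = 𝟙 _ :=
  whiskerRight_evalHom_injective (by simp [strictMap₂_whiskerRight])

lemma strictMap₂_comp {a b : A} {f g h : a ⟶ b} (η : f ⟶ g) (θ : g ⟶ h) :
    strictMap₂ X (η ≫ θ) = strictMap₂ X η ≫ strictMap₂ X θ :=
  whiskerRight_evalHom_injective (by simp [strictMap₂_whiskerRight])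

lemma map_arr_strictMap₂ {a b : A} {f g : a ⟶ b} (η : f ⟶ g) {x y : (strictObj X a).carrier}
    (p : x ⟶ y) :
    Arr.map (evalHom X b).fn (arr (strictMap₂ X η) p) =
      (evalArr X f p).hom ≫ arr (X.map₂ η) (ev p) ≫ (evalArr X g p).inv :=
  map_arr_liftHom₂ _ p

variable [Strict A]

lemma strictMap_id (a : A) : strictMap X (𝟙 a) = 𝟙 (strictObj X a) :=
  (isEqToHom_strictMapId X a).choose

lemma strictMap_comp {a b c : A} (f : a ⟶ b) (g : b ⟶ c) :
    strictMap X (f ≫ g) = strictMap X f ≫ strictMap X g :=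
  (isEqToHom_strictMapComp X f g).choose

lemma of_strictMap_comp {a b c : A} (f : a ⟶ b) (g : b ⟶ c) {x y : (strictObj X a).carrier}
    (p : x ⟶ y) : Arr.of ((strictMap X (f ≫ g)).fn.map p) =
      Arr.of ((strictMap X g).fn.map ((strictMap X f).fn.map p)) :=
  congrArg (fun F => Arr.of (Hom.fn F |>.map p)) (strictMap_comp X f g)

/-- After evaluation, `strictMap₂` is `X.map₂` conjugated by `evalArr`. Factoring `evalArr` through
`evalArr_comp` reduces the claim to naturality of the composition constraint of `X`. -/
lemma strictMap₂_whiskerLeft {a b c : A} (f : a ⟶ b) {g h : b ⟶ c} (η : g ⟶ h) :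
    EqUpTo (strictMap₂ X (f ◁ η)) (strictMap X f ◁ strictMap₂ X η) := by
  refine eqUpTo_of_arr (strictMap_comp X f g) (strictMap_comp X f h) fun p => ?_
  refine eqUpTo_of_map_evalHom (of_strictMap_comp X f g p) (of_strictMap_comp X f h p) ?_
  refine .trans (.of_eq (map_arr_strictMap₂ X (f ◁ η) p)) ?_
  refine .trans ?_ (.of_eq (map_arr_strictMap₂ X η ((strictMap X f).fn.map p)).symm)
  have e (g : b ⟶ c) := evalArr_comp X f g p
  -- The composition constraint and its inverse are inserted, so that `evalArr_comp` applies at both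
  -- ends.
  have e' : (evalArr X (f ≫ g) p).hom ≫ arr (X.map₂ (f ◁ η)) (ev p) ≫
      (evalArr X (f ≫ h) p).inv =
      ((evalArr X (f ≫ g) p).hom ≫ (compArr X f g (ev p)).hom) ≫
        arr (X.map₂ η) ((X.map f).fn.map (ev p)) ≫
          (evalArr X (f ≫ h) p ≪≫ compArr X f h (ev p)).inv := by
    have := compArr_whiskerLeft X f η (ev p)
    rw [Category.assoc, ← reassoc_of% this]
    simp
  refine .trans (.of_eq e') ?_
  refine .trans (.comp (e g) (.comp (.refl _) (EqUpTo.inv (n :=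
    evalArr X h ((strictMap X f).fn.map p) ≪≫ Arr.mapIso (X.map h).fn (evalArr X f p)) (e h)))) ?_
  refine .of_eq ?_
  rw [Iso.trans_inv, Category.assoc]
  congr 1
  -- Naturality moves the evaluation comparison of `f` past `X.map₂ η`, where it meets its inverse.
  have := arr_naturality (X.map₂ η) (evalArr X f p).hom
  rw [reassoc_of% this]
  congr 1
  rw [← Category.assoc]
  refine (congrArg (· ≫ _) (Arr.mapIso (X.map h).fn (evalArr X f p)).hom_inv_id).trans ?_
  simp

lemma strictMap₂_whiskerRight_map {a b c : A} {f g : a ⟶ b} (η : f ⟶ g) (h : b ⟶ c) :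
    EqUpTo (strictMap₂ X (η ▷ h)) (strictMap₂ X η ▷ strictMap X h) := by
  refine eqUpTo_of_arr (strictMap_comp X f h) (strictMap_comp X g h) fun p => ?_
  refine eqUpTo_of_map_evalHom (of_strictMap_comp X f h p) (of_strictMap_comp X g h p) ?_
  refine .trans (.of_eq (map_arr_strictMap₂ X (η ▷ h) p)) ?_
  have e (f : a ⟶ b) := evalArr_comp X f h p
  have e' : (evalArr X (f ≫ h) p).hom ≫ arr (X.map₂ (η ▷ h)) (ev p) ≫
      (evalArr X (g ≫ h) p).inv =
      ((evalArr X (f ≫ h) p).hom ≫ (compArr X f h (ev p)).hom) ≫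
        Arr.map (X.map h).fn (arr (X.map₂ η) (ev p)) ≫
          (evalArr X (g ≫ h) p ≪≫ compArr X g h (ev p)).inv := by
    have := compArr_whiskerRight X η h (ev p)
    rw [Category.assoc, ← reassoc_of% this]
    simp
  refine .trans (.of_eq e') ?_
  refine .trans (.comp (e f) (.comp (.refl _) (EqUpTo.inv (n :=
    evalArr X h ((strictMap X g).fn.map p) ≪≫ Arr.mapIso (X.map h).fn (evalArr X g p)) (e g)))) ?_
  refine .of_eq ?_
  refine Eq.trans ?_ (congrArg (Arr.map (evalHom X c).fn) (arr_whiskerRight _ _ _).symm)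
  -- Right whiskering applies `strictMap X h` to a component; naturality of `evalArr` trades this
  -- for `X.map h` of the evaluated component.
  rw [← cancel_mono (evalArr X h ((strictMap X g).fn.map p)).hom, evalArr_naturality]
  rw [map_arr_strictMap₂, Arr.map_comp, Arr.map_comp]
  simp

/-- The strictification of a pseudofunctor. -/
def strictification : StrictPseudofunctor A TwoCatTwoI.{u} :=
  StrictPseudofunctor.mk''
    { obj a := ⟨strictObj X a⟩
      map f := ⟨strictMap X f, strictMap_isTwoFunctor X f⟩
      map₂ η := ⟨strictMap₂ X η⟩
      map₂_id f := LocallyFull.hom₂_ext (strictMap₂_id X f)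
      map₂_comp η θ := LocallyFull.hom₂_ext (strictMap₂_comp X η θ)
      map_id a := LocallyFull.hom_ext (strictMap_id X a)
      map_comp f g := LocallyFull.hom_ext (strictMap_comp X f g)
      map₂_whisker_left f _ _ η := LocallyFull.eq_conj
        (LocallyFull.hom_ext (strictMap_comp X f _)) (LocallyFull.hom_ext (strictMap_comp X f _))
        (strictMap₂_whiskerLeft X f η)
      map₂_whisker_right η h := LocallyFull.eq_conj
        (LocallyFull.hom_ext (strictMap_comp X _ h)) (LocallyFull.hom_ext (strictMap_comp X _ h))
        (strictMap₂_whiskerRight_map X η h) }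

end Strictification

end TwoDim

namespace TwoDim

open TwoCatPI Generators

open scoped Pseudofunctor.StrongTrans

section

variable {A : Type u} [Bicategory.{u, u} A]

/-- A 2-functor to `2Cat_{2,i}`, as a pseudofunctor to `2Cat_{p,i}`. -/
abbrev inclObj (Y : StrictPseudofunctor A TwoCatTwoI.{u}) : A ⥤ᵖ TwoCatPI.{u} :=
  Y.toPseudofunctor.comp (LocallyFull.inclusion twoFunctors.{u}).toPseudofunctor

lemma isEqToHom_cell {f g : TwoCatTwoI.{u}} {p q : f ⟶ g} {α : p ⟶ q} (h : IsEqToHom α) :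
    IsEqToHom α.cell := by
  obtain ⟨rfl, rfl⟩ := h
  exact .id _

lemma isEqToHom_inclObj_mapComp (Y : StrictPseudofunctor A TwoCatTwoI.{u}) {a b c : A}
    (f : a ⟶ b) (g : b ⟶ c) : IsEqToHom ((inclObj Y).mapComp f g).hom := by
  refine (isEqToHom_cell ⟨Y.map_comp f g, ?_⟩ : IsEqToHom (Y.mapComp f g).hom.cell).comp (.id _)
  rw [Y.mapComp_eq_eqToIso, eqToIso.hom]

lemma isEqToHom_inclObj_mapId (Y : StrictPseudofunctor A TwoCatTwoI.{u}) (a : A) :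
    IsEqToHom ((inclObj Y).mapId a).hom := by
  refine (isEqToHom_cell ⟨Y.map_id a, ?_⟩ : IsEqToHom (Y.mapId a).hom.cell).comp (.id _)
  rw [Y.mapId_eq_eqToIso, eqToIso.hom]

lemma isEqToHom_compArr (Y : StrictPseudofunctor A TwoCatTwoI.{u}) {a b c : A}
    (f : a ⟶ b) (g : b ⟶ c) {x y : ((inclObj Y).obj a).carrier} (v : x ⟶ y) :
    IsEqToHom (compArr (inclObj Y) f g v).hom :=
  isEqToHom_arr (isEqToHom_inclObj_mapComp Y f g) v

lemma isEqToHom_idArr (Y : StrictPseudofunctor A TwoCatTwoI.{u}) (a : A)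
    {x y : ((inclObj Y).obj a).carrier} (v : x ⟶ y) :
    IsEqToHom (idArr (inclObj Y) a v).hom :=
  isEqToHom_arr (isEqToHom_inclObj_mapId Y a) v

end

/-! ### Pointwise inverses of a locally faithful transformation are pseudonatural -/

section PointwiseInverse

lemma modification_of_arr_aux {C : Type u₁} [Category.{v₁} C] {x y z t : C} {k : x ⟶ t}
    {m : x ⟶ y} {n : y ⟶ z} {l : z ⟶ t} (h : k = m ≫ n ≫ l) :
    k ≫ 𝟙 t ≫ 𝟙 t = (𝟙 x ≫ m ≫ 𝟙 y ≫ n ≫ 𝟙 z) ≫ l := by simp [h]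

lemma modification_of_arr {x y x' y' : TwoCatPI.{u}} {f : x ⟶ y} {p : x ⟶ x'} {q : y ⟶ y'}
    {f' : x' ⟶ y'} {p' : x' ⟶ x} {q' : y' ⟶ y} (n : f ≫ q ⟶ p ≫ f') (n' : f' ≫ q' ⟶ p' ≫ f)
    (t : p ≫ p' ⟶ 𝟙 x) (t' : q ≫ q' ⟶ 𝟙 y)
    (h : ∀ {s t₁ : x.carrier} (v : s ⟶ t₁), arr t' (f.fn.map v) =
      Arr.map q'.fn (arr n v) ≫ arr n' (p.fn.map v) ≫ Arr.map f.fn (arr t v)) :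
    f ◁ t' ≫ (ρ_ f).hom ≫ (λ_ f).inv =
      ((α_ f q q').inv ≫ n ▷ q' ≫ (α_ p f' q').hom ≫ p ◁ n' ≫ (α_ p p' f).inv) ≫ t ▷ f :=
  hom₂_ext_arr fun v => modification_of_arr_aux (h v)

variable {A : Type u} [Bicategory.{u, u} A] {Q X : A ⥤ᵖ TwoCatPI.{u}}

/-- A family of inverses of the components of a pseudonatural transformation `e` with locally
faithful components, and with compatible comparison 2-cells. -/
structure PointwiseInverse (e : Q ⟶ X) where
  faithful (a : A) {x y x' y' : (Q.obj a).carrier} {p : x ⟶ y} {q : x' ⟶ y'}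
    {m n : Arr.of p ⟶ Arr.of q} : Arr.map (e.app a).fn m = Arr.map (e.app a).fn n → m = n
  inv (a : A) : X.obj a ⟶ Q.obj a
  invComp (a : A) : inv a ≫ e.app a ≅ 𝟙 (X.obj a)
  compInv (a : A) : e.app a ≫ inv a ≅ 𝟙 (Q.obj a)
  nat {a b : A} (f : a ⟶ b) : X.map f ≫ inv b ≅ inv a ≫ Q.map f
  -- Every other factor is invertible and `e` is faithful, so this equation determines the forward
  -- components of `nat f`; all its coherence follows from that.
  map_nat {a b : A} (f : a ⟶ b) {x y : (X.obj a).carrier} (v : x ⟶ y) :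
    Arr.map (e.app b).fn (arr (nat f).hom v : Arr.of ((inv b).fn.map ((X.map f).fn.map v)) ⟶
        Arr.of ((Q.map f).fn.map ((inv a).fn.map v))) ≫ (natArr e f ((inv a).fn.map v)).hom ≫
      Arr.map (X.map f).fn (arr (invComp a).hom v) = arr (invComp b).hom ((X.map f).fn.map v)
  map_compInv (a : A) {x y : (Q.obj a).carrier} (p : x ⟶ y) :
    Arr.map (e.app a).fn (arr (compInv a).hom p :
      Arr.of ((inv a).fn.map ((e.app a).fn.map p)) ⟶ Arr.of p) =
      arr (invComp a).hom ((e.app a).fn.map p)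

namespace PointwiseInverse

variable {e : Q ⟶ X} (R : PointwiseInverse e)

/-- The components of `invComp`. -/
def retrArr (a : A) {x y : (X.obj a).carrier} (v : x ⟶ y) :
    Arr.of ((e.app a).fn.map ((R.inv a).fn.map v)) ≅ Arr.of v := arrIso (R.invComp a) v

lemma retrArr_naturality (a : A) {x y x' y' : (X.obj a).carrier} {v : x ⟶ y} {v' : x' ⟶ y'}
    (m : Arr.of v ⟶ Arr.of v') :
    Arr.map (e.app a).fn (Arr.map (R.inv a).fn m) ≫ (R.retrArr a v').hom =
      (R.retrArr a v).hom ≫ m := by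
  rw [← Arr.map_comp_map]
  exact (arr_naturality (R.invComp a).hom m).trans (congrArg (_ ≫ ·) (Arr.map_id_map m))

/-- The components of `nat`. -/
def secArr {a b : A} (f : a ⟶ b) {x y : (X.obj a).carrier} (v : x ⟶ y) :
    Arr.of ((R.inv b).fn.map ((X.map f).fn.map v)) ≅
      Arr.of ((Q.map f).fn.map ((R.inv a).fn.map v)) :=
  arrIso (R.nat f) v

lemma map_secArr {a b : A} (f : a ⟶ b) {x y : (X.obj a).carrier} (v : x ⟶ y) :
    Arr.map (e.app b).fn (R.secArr f v).hom ≫ (natArr e f ((R.inv a).fn.map v)).hom ≫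
      Arr.map (X.map f).fn (R.retrArr a v).hom = (R.retrArr b ((X.map f).fn.map v)).hom :=
  R.map_nat f v

/-- For each pseudonaturality axiom of the inverses, faithfulness allows `e` to be applied.
Composing with the invertible naturality and retraction cells then turns `secArr` into `retrArr` by
`map_secArr`, and the axiom of `e` finishes. -/
lemma secArr_map₂ {a b : A} {f g : a ⟶ b} (η : f ⟶ g) {x y : (X.obj a).carrier} (v : x ⟶ y) :
    Arr.map (R.inv b).fn (arr (X.map₂ η) v) ≫ (R.secArr g v).hom =
      (R.secArr f v).hom ≫ arr (Q.map₂ η) ((R.inv a).fn.map v) := by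
  apply R.faithful
  have hg := R.map_secArr g v
  have hf := R.map_secArr f v
  rw [← cancel_mono (natArr e g ((R.inv a).fn.map v)).hom,
    ← cancel_mono (Arr.mapIso (X.map g).fn (R.retrArr a v)).hom]
  rw [Arr.map_comp, Arr.map_comp, Category.assoc, Category.assoc, Category.assoc, Category.assoc,
    reassoc_of% (natArr_map₂ e η ((R.inv a).fn.map v)), Arr.mapIso_hom, hg, retrArr_naturality, ← hf, Category.assoc, Category.assoc,
    ← arr_naturality]

lemma secArr_id (a : A) {x y : (X.obj a).carrier} (v : x ⟶ y) :
    (R.secArr (𝟙 a) v).hom ≫ (idArr Q a ((R.inv a).fn.map v)).hom =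
      Arr.map (R.inv a).fn (idArr X a v).hom := by
  apply R.faithful
  rw [← cancel_mono (R.retrArr a v).hom, retrArr_naturality, ← R.map_secArr (𝟙 a) v, Arr.map_comp,
    Category.assoc, Category.assoc, Category.assoc, idArr_naturality, ← natArr_id, Category.assoc]

lemma secArr_comp {a b c : A} (f : a ⟶ b) (g : b ⟶ c) {x y : (X.obj a).carrier} (v : x ⟶ y) :
    (R.secArr (f ≫ g) v).hom ≫ (compArr Q f g ((R.inv a).fn.map v)).hom =
      Arr.map (R.inv c).fn (compArr X f g v).hom ≫ (R.secArr g ((X.map f).fn.map v)).hom ≫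
        Arr.map (Q.map g).fn (R.secArr f v).hom := by
  apply R.faithful
  rw [← cancel_mono (natArr e g ((Q.map f).fn.map ((R.inv a).fn.map v))).hom,
    ← cancel_mono (Arr.mapIso (X.map g).fn (natArr e f ((R.inv a).fn.map v))).hom,
    ← cancel_mono (Arr.mapIso (X.map g).fn (Arr.mapIso (X.map f).fn (R.retrArr a v))).hom]
  simp only [Arr.map_comp, Category.assoc, Arr.mapIso_hom]
  rw [reassoc_of% (natArr_naturality e g (R.secArr f v).hom), ← Arr.map_comp, ← Arr.map_comp, R.map_secArr f v, R.map_secArr g,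
    retrArr_naturality, ← R.map_secArr (f ≫ g) v, Category.assoc, Category.assoc,
    compArr_naturality, Arr.map_comp, ← reassoc_of% (natArr_comp e f g ((R.inv a).fn.map v))]

/-- The inverses of the components of `e` form a pseudonatural transformation. -/
def trans : X ⟶ Q :=
  transOfArr R.inv R.nat (fun η _ _ v => R.secArr_map₂ η v) (fun a _ _ v => R.secArr_id a v)
    (fun f g _ _ v => R.secArr_comp f g v)

/-- The pseudonatural transformation `trans` is inverse to `e` on one side. -/
def transComp : R.trans ≫ e ≅ 𝟙 X :=
  Pseudofunctor.StrongTrans.isoMk R.invComp (fun f =>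
    modification_of_arr (R.nat f).hom (e.naturality f).hom (R.invComp _).hom (R.invComp _).hom
      (fun v => (R.map_nat f v).symm))

/-- The components of `compInv`. -/
def corArr (a : A) {x y : (Q.obj a).carrier} (p : x ⟶ y) :
    Arr.of ((R.inv a).fn.map ((e.app a).fn.map p)) ≅ Arr.of p := arrIso (R.compInv a) p

lemma map_corArr (a : A) {x y : (Q.obj a).carrier} (p : x ⟶ y) :
    Arr.map (e.app a).fn (R.corArr a p).hom = (R.retrArr a ((e.app a).fn.map p)).hom :=
  R.map_compInv a p

/-- This is the modification axiom for `compInv`. Under `e` the cells `corArr` become `retrArr`, so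
naturality of `retrArr` and `map_secArr` give it. -/
lemma corArr_naturality {a b : A} (f : a ⟶ b) {x y : (Q.obj a).carrier} (p : x ⟶ y) :
    (R.corArr b ((Q.map f).fn.map p)).hom =
      Arr.map (R.inv b).fn (natArr e f p).hom ≫ (R.secArr f ((e.app a).fn.map p)).hom ≫
        Arr.map (Q.map f).fn (R.corArr a p).hom := by
  apply R.faithful
  rw [R.map_corArr, ← cancel_mono (natArr e f p).hom, Arr.map_comp, Arr.map_comp,
    Category.assoc, Category.assoc, natArr_naturality, R.map_corArr, ← R.retrArr_naturality,
    ← R.map_secArr f ((e.app a).fn.map p)]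

/-- The pseudonatural transformation `trans` is inverse to `e` on the other side. -/
def compTrans : e ≫ R.trans ≅ 𝟙 Q :=
  Pseudofunctor.StrongTrans.isoMk R.compInv (fun f =>
    modification_of_arr (e.naturality f).hom (R.nat f).hom (R.compInv _).hom (R.compInv _).hom
      (fun p => R.corArr_naturality f p))

end PointwiseInverse

end PointwiseInverse

end TwoDim

namespace TwoDim

open TwoCatPI Generators

open scoped Pseudofunctor.StrongTrans

/-! ### The unit and its equivalence with evaluation -/

section Unit

variable {A : Type u} [Bicategory.{u, u} A] (X : A ⥤ᵖ TwoCatPI.{u})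

lemma map_id_obj (a : A) (x : (X.obj a).carrier) : (X.map (𝟙 a)).fn.obj x = x :=
  (X.mapId a).hom.icon.obj_eq x

/-- The formal 1-cell `1(v)`. -/
def idGen {a : A} {x y : (X.obj a).carrier} (v : x ⟶ y) : (formalCells X a).Gen x y where
  f := 𝟙 a
  v := v
  src_eq := (map_id_obj X a x).symm
  tgt_eq := (map_id_obj X a y).symm

/-- The comparison of `v` with the value of `1(v)`. -/
def idGenIso {a : A} {x y : (X.obj a).carrier} (v : x ⟶ y) :
    v ≅ (Word.single (idGen X v)).eval :=
  Arr.toIso ((idArr X a v).symm ≪≫ eqToIso (of_ev (idGen X v)).symm ≪≫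
    eqToIso (congrArg Arr.of (Word.eval_single (idGen X v))).symm)

/-- The inclusion of the 1-cells as formal 1-cells. -/
def unitHom (a : A) : X.obj a ⟶ strictObj X a :=
  ⟨Full.lift (Pseudofunctor.id _) (fun v => Word.single (idGen X v)) (fun v => idGenIso X v)⟩

/-- The evaluation is a retraction of the inclusion of the 1-cells. -/
def unitEvalIso (a : A) : unitHom X a ≫ evalHom X a ≅ 𝟙 (X.obj a) where
  hom := ⟨Full.liftIcon _ _ _⟩
  inv := ⟨Full.liftIconInv _ _ _⟩
  hom_inv_id := hom₂_ext_arr fun v => (Arr.ofIso (idGenIso X v)).inv_hom_id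
  inv_hom_id := hom₂_ext_arr fun v => (Arr.ofIso (idGenIso X v)).hom_inv_id

lemma of_unitHom {a : A} {x y : (X.obj a).carrier} (v : x ⟶ y) :
    Arr.of ((unitHom X a).fn.map v) = Arr.of (gen X (𝟙 a) v) :=
  of_gen X (𝟙 a) v _ _

/-- The string `1(v)` evaluates to `X (𝟙 a) v`, so returning to `v` uses the unit constraint of `X`.
-/
lemma arr_unitEvalIso {a : A} {x y : (X.obj a).carrier} (v : x ⟶ y) :
    EqUpTo (arr (unitEvalIso X a).hom v) (idArr X a v).hom := by
  have h : EqUpTo ((idArr X a v).symm ≪≫ eqToIso (of_ev (idGen X v)).symm ≪≫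
    eqToIso (congrArg Arr.of (Word.eval_single (idGen X v))).symm).inv (idArr X a v).hom := by
    simp only [Iso.trans_inv, eqToIso.inv, Iso.symm_inv, Category.assoc]
    exact (EqUpTo.isEqToHom_comp (.eqToHom _) _).trans
      (EqUpTo.isEqToHom_comp (.eqToHom (of_ev (idGen X v))) _)
  exact h

variable [Strict A]

/-- The evaluation, as a pseudonatural transformation. -/
def evalTrans : inclObj (strictification X) ⟶ X :=
  transOfArr (F := inclObj (strictification X)) (evalHom X) (evalIso X)
    (fun {a b f g} η {x y} p => by
      refine (congrArg (· ≫ (evalArr X g p).hom) (map_arr_strictMap₂ X η p)).trans ?_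
      simp only [Category.assoc, Iso.inv_hom_id, Category.comp_id]
      rfl)
    -- The strictification has identity constraints, so both sides of the unit law are identities
    -- and hence equal; in the composition law the same fact removes one factor.
    (fun a _ _ p => (evalArr_id X a p).eq ((isEqToHom_idArr (strictification X) a p).arrMap _))
    (fun f g _ _ p => ((evalArr_comp X f g p).trans (EqUpTo.isEqToHom_comp
      ((isEqToHom_compArr (strictification X) f g p).arrMap _) _).symm).eq)

/-- The unit is pseudonatural. -/
def unitNat {a b : A} (f : a ⟶ b) : X.map f ≫ unitHom X b ≅ unitHom X a ≫ strictMap X f :=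
  liftIso₂ (α_ _ _ _ ≪≫ whiskerLeftIso (X.map f) (unitEvalIso X b) ≪≫ ρ_ _ ≪≫ (λ_ _).symm ≪≫
    whiskerRightIso (unitEvalIso X a).symm (X.map f) ≪≫ α_ _ _ _ ≪≫
    whiskerLeftIso (unitHom X a) (evalIso X f).symm ≪≫ (α_ _ _ _).symm)

/-- The unit and the evaluation are inverse to each other. -/
def evalUnitIso (a : A) : evalHom X a ≫ unitHom X a ≅ 𝟙 (strictObj X a) :=
  liftIso₂ (α_ _ _ _ ≪≫ whiskerLeftIso (evalHom X a) (unitEvalIso X a) ≪≫ ρ_ _ ≪≫ (λ_ _).symm)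

lemma unitNat_aux {C : Type u₁} [Category.{v₁} C] {x y z t : C} (m : x ⟶ y) (n : z ≅ y)
    (k : t ≅ z) : (𝟙 x ≫ m ≫ 𝟙 y ≫ 𝟙 y ≫ n.inv ≫ 𝟙 z ≫ k.inv ≫ 𝟙 t) ≫ k.hom ≫ n.hom = m := by
  simp

lemma evalUnit_aux {C : Type u₁} [Category.{v₁} C] {x y : C} (m : x ⟶ y) :
    𝟙 x ≫ m ≫ 𝟙 y ≫ 𝟙 y = m := by simp

lemma map_arr_unitNat {a b : A} (f : a ⟶ b) {x y : (X.obj a).carrier} (v : x ⟶ y) :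
    Arr.map (evalHom X b).fn (arr (unitNat X f).hom v) ≫
      (evalArr X f ((unitHom X a).fn.map v)).hom ≫
      Arr.map (X.map f).fn (arr (unitEvalIso X a).hom v) =
        arr (unitEvalIso X b).hom ((X.map f).fn.map v) := by
  refine (congrArg (· ≫ (evalArr X f ((unitHom X a).fn.map v)).hom ≫
      Arr.map (X.map f).fn (arr (unitEvalIso X a).hom v)) (map_arr_liftHom₂ _ v)).trans ?_
  exact unitNat_aux (arr (unitEvalIso X b).hom ((X.map f).fn.map v))
    (Arr.mapIso (X.map f).fn (arrIso (unitEvalIso X a) v)) (evalArr X f ((unitHom X a).fn.map v))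

/-- The unit and the evaluation are inverse to each other. -/
def evalInverse : PointwiseInverse (evalTrans X) where
  faithful _ _ _ _ _ _ _ _ _ h := map_evalHom_injective h
  inv := unitHom X
  invComp := unitEvalIso X
  compInv := evalUnitIso X
  nat f := unitNat X f
  map_nat f _ _ v := map_arr_unitNat X f v
  map_compInv a _ _ p := (map_arr_liftHom₂ _ p).trans
    (evalUnit_aux (arr (unitEvalIso X a).hom (ev p)))

/-- The unit of the strictification. -/
def unitTrans : X ⟶ inclObj (strictification X) := (evalInverse X).trans

lemma unitTrans_isInternalEquivalence : IsInternalEquivalence (unitTrans X) :=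
  ⟨evalTrans X, ⟨(evalInverse X).transComp⟩, ⟨(evalInverse X).compTrans⟩⟩

end Unit

end TwoDim

namespace TwoDim

open TwoCatPI Generators

open scoped Pseudofunctor.StrongTrans

/-! ### Replacing the components of a transformation by isomorphic ones -/

section Transport

variable {A : Type u} [Bicategory.{u, u} A] {F G : A ⥤ᵖ TwoCatPI.{u}} (σ : F ⟶ G)
  (t : ∀ a, F.obj a ⟶ G.obj a) (i : ∀ a, t a ≅ σ.app a)

/-- The pseudonaturality isomorphisms transported along isomorphisms of 1-cells. -/
def transportNat {a b : A} (f : a ⟶ b) : F.map f ≫ t b ≅ t a ≫ G.map f :=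
  whiskerLeftIso (F.map f) (i b) ≪≫ σ.naturality f ≪≫ whiskerRightIso (i a).symm (G.map f)

/-- The components of `i`. -/
def transportArr (a : A) {x y : (F.obj a).carrier} (v : x ⟶ y) :
    Arr.of ((t a).fn.map v) ≅ Arr.of ((σ.app a).fn.map v) := arrIso (i a) v

lemma transportArr_naturality (a : A) {x y x' y' : (F.obj a).carrier} {v : x ⟶ y} {v' : x' ⟶ y'}
    (m : Arr.of v ⟶ Arr.of v') :
    Arr.map (t a).fn m ≫ (transportArr σ t i a v').hom =
      (transportArr σ t i a v).hom ≫ Arr.map (σ.app a).fn m :=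
  arr_naturality (i a).hom m

/-- The components of `transportNat`. -/
def transportNatArr {a b : A} (f : a ⟶ b) {x y : (F.obj a).carrier} (v : x ⟶ y) :
    Arr.of ((t b).fn.map ((F.map f).fn.map v)) ≅ Arr.of ((G.map f).fn.map ((t a).fn.map v)) :=
  arrIso (transportNat σ t i f) v

lemma transportNatArr_hom {a b : A} (f : a ⟶ b) {x y : (F.obj a).carrier} (v : x ⟶ y) :
    (transportNatArr σ t i f v).hom = (transportArr σ t i b ((F.map f).fn.map v)).hom ≫
      (natArr σ f v).hom ≫ (Arr.mapIso (G.map f).fn (transportArr σ t i a v)).inv := rfl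

/-- This form of the definition has no inverses. Postcomposing an axiom with the invertible
`transportArr` makes it applicable and reduces the axiom to that of `σ`. -/
lemma transportNatArr_comp_map {a b : A} (f : a ⟶ b) {x y : (F.obj a).carrier} (v : x ⟶ y) :
    (transportNatArr σ t i f v).hom ≫ Arr.map (G.map f).fn (transportArr σ t i a v).hom =
      (transportArr σ t i b ((F.map f).fn.map v)).hom ≫ (natArr σ f v).hom := by
  rw [transportNatArr_hom, ← Arr.mapIso_hom, Category.assoc, Category.assoc, Iso.inv_hom_id,
    Category.comp_id]

lemma transportNatArr_map₂ {a b : A} {f g : a ⟶ b} (η : f ⟶ g) {x y : (F.obj a).carrier}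
    (v : x ⟶ y) :
    Arr.map (t b).fn (arr (F.map₂ η) v) ≫ (transportNatArr σ t i g v).hom =
      (transportNatArr σ t i f v).hom ≫ arr (G.map₂ η) ((t a).fn.map v) := by
  rw [← cancel_mono (Arr.mapIso (G.map g).fn (transportArr σ t i a v)).hom, Arr.mapIso_hom,
    Category.assoc, Category.assoc, transportNatArr_comp_map, ← arr_naturality,
    reassoc_of% (transportNatArr_comp_map σ t i f v), reassoc_of% (transportArr_naturality σ t i b (arr (F.map₂ η) v)),
    natArr_map₂]

lemma transportNatArr_id (a : A) {x y : (F.obj a).carrier} (v : x ⟶ y) :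
    (transportNatArr σ t i (𝟙 a) v).hom ≫ (idArr G a ((t a).fn.map v)).hom =
      Arr.map (t a).fn (idArr F a v).hom := by
  rw [← cancel_mono (transportArr σ t i a v).hom, Category.assoc, ← idArr_naturality,
    reassoc_of% (transportNatArr_comp_map σ t i (𝟙 a) v), transportArr_naturality, natArr_id]

lemma transportNatArr_comp {a b c : A} (f : a ⟶ b) (g : b ⟶ c) {x y : (F.obj a).carrier}
    (v : x ⟶ y) :
    (transportNatArr σ t i (f ≫ g) v).hom ≫ (compArr G f g ((t a).fn.map v)).hom =
      Arr.map (t c).fn (compArr F f g v).hom ≫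
        (transportNatArr σ t i g ((F.map f).fn.map v)).hom ≫
        Arr.map (G.map g).fn (transportNatArr σ t i f v).hom := by
  rw [← cancel_mono (Arr.mapIso (G.map g).fn (Arr.mapIso (G.map f).fn
    (transportArr σ t i a v))).hom, Arr.mapIso_hom, Arr.mapIso_hom, Category.assoc, Category.assoc,
    ← compArr_naturality, reassoc_of% (transportNatArr_comp_map σ t i (f ≫ g) v), Category.assoc,
    ← Arr.map_comp, transportNatArr_comp_map, Arr.map_comp,
    reassoc_of% (transportNatArr_comp_map σ t i g ((F.map f).fn.map v)),
    reassoc_of% (transportArr_naturality σ t i c (compArr F f g v).hom), natArr_comp]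

/-- The transport of a pseudonatural transformation along isomorphisms of its components. -/
def transportTrans : F ⟶ G :=
  transOfArr t (transportNat σ t i) (fun η _ _ v => transportNatArr_map₂ σ t i η v)
    (fun a _ _ v => transportNatArr_id σ t i a v)
    (fun f g _ _ v => transportNatArr_comp σ t i f g v)

/-- The transport is isomorphic to the given transformation. -/
def transportTransIso : transportTrans σ t i ≅ σ :=
  Pseudofunctor.StrongTrans.isoMk i (fun f => by
    change F.map f ◁ (i _).hom ≫ (σ.naturality f).hom =
      (F.map f ◁ (i _).hom ≫ (σ.naturality f).hom ≫ (i _).inv ▷ G.map f) ≫ (i _).hom ▷ G.map f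
    simp)

end Transport

/-! ### Restricting transformations and modifications to `2Cat_{2,i}` -/

section Lifting

variable {A : Type u} [Bicategory.{u, u} A] {Y Y' : StrictPseudofunctor A TwoCatTwoI.{u}}

lemma inclObj_mapId (Y : StrictPseudofunctor A TwoCatTwoI.{u}) (a : A) :
    ((inclObj Y).mapId a).hom = (Y.mapId a).hom.cell := Category.comp_id _

lemma inclObj_mapComp (Y : StrictPseudofunctor A TwoCatTwoI.{u}) {a b c : A} (f : a ⟶ b)
    (g : b ⟶ c) : ((inclObj Y).mapComp f g).hom = (Y.mapComp f g).hom.cell := Category.comp_id _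

/-- A pseudonatural transformation whose components are 2-functors, as a transformation of functors
to `2Cat_{2,i}`. -/
def restrictTrans (T : inclObj Y ⟶ inclObj Y') (hT : ∀ a, IsTwoFunctor (T.app a).fn) :
    Y.toPseudofunctor ⟶ Y'.toPseudofunctor where
  app a := ⟨T.app a, hT a⟩
  naturality f := LocallyFull.isoMk (T.naturality f)
  naturality_naturality η := LocallyFull.hom₂_ext (T.naturality_naturality η)
  naturality_id a := LocallyFull.hom₂_ext (by
    have h := T.naturality_id a
    rw [inclObj_mapId, inclObj_mapId] at h
    exact h)
  naturality_comp f g := LocallyFull.hom₂_ext (by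
    have h := T.naturality_comp f g
    rw [inclObj_mapComp, inclObj_mapComp] at h
    exact h)

lemma postcompTrans_naturality (α : Y.toPseudofunctor ⟶ Y'.toPseudofunctor) {a b : A}
    (f : a ⟶ b) :
    ((postcompTrans (LocallyFull.inclusion twoFunctors.{u}).toPseudofunctor α).naturality f).hom =
      (α.naturality f).hom.cell :=
  (Category.id_comp _).trans (Category.comp_id _)

lemma postcompTrans_restrictTrans (T : inclObj Y ⟶ inclObj Y')
    (hT : ∀ a, IsTwoFunctor (T.app a).fn) :
    postcompTrans (LocallyFull.inclusion twoFunctors.{u}).toPseudofunctor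
      (restrictTrans T hT) = T := by
  -- The components agree on the nose, but the naturality cells differ by constraints of the
  -- inclusion, which are identities. The identity modification absorbs this difference.
  refine eq_of_modification (⟨{ app a := 𝟙 (T.app a), naturality f := ?_ }⟩) (fun a => rfl)
    (fun a => rfl)
  refine Eq.trans ?_ (congrArg (· ≫ _) (postcompTrans_naturality (restrictTrans T hT) f).symm)
  change _ ◁ 𝟙 _ ≫ (T.naturality f).hom = (T.naturality f).hom ≫ 𝟙 _ ▷ _
  simp

/-- Modifications between the underlying transformations are modifications. -/
def restrictModification {α β : Y.toPseudofunctor ⟶ Y'.toPseudofunctor}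
    (Γ : postcompTrans (LocallyFull.inclusion twoFunctors.{u}).toPseudofunctor α ⟶
      postcompTrans (LocallyFull.inclusion twoFunctors.{u}).toPseudofunctor β) : α ⟶ β :=
  ⟨{ app a := ⟨Γ.as.app a⟩
     naturality f := LocallyFull.hom₂_ext (by
      have h := Γ.as.naturality f
      rw [postcompTrans_naturality, postcompTrans_naturality] at h
      exact h) }⟩

end Lifting

section Inclusion

variable {A : Type u} [Bicategory.{u, u} A] {Y Y' : TwoFunctorCat A TwoCatTwoI.{u}}

/-- `J` is locally fully faithful: both `2Cat_{2,i}` and the 2-category of 2-functors keep all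
2-cells of the ambient one. -/
lemma inclusionJ_map₂_bijective (τ τ' : Y ⟶ Y') :
    Function.Bijective ((inclusionJ A).map₂ : (τ ⟶ τ') → _) := by
  refine ⟨fun Γ Γ' h => ?_, fun Γ => ⟨⟨restrictModification Γ⟩, ?_⟩⟩
  · refine LocallyFull.hom₂_ext (Pseudofunctor.StrongTrans.homCategory.ext fun a => ?_)
    exact LocallyFull.hom₂_ext (congrArg (fun Γ => Γ.as.app a) h)
  · rfl

end Inclusion

end TwoDim

namespace TwoDim

open TwoCatPI Generators

open scoped Pseudofunctor.StrongTrans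

/-- All 1-cells of a bicategory, as generators. -/
def allCells (C : Type u₁) [Bicategory.{w₁, v₁} C] : Generators.{w₁, v₁, v₁} C where
  Gen x y := x ⟶ y
  ev f := f

/-! ### Extending a transformation along the unit -/

section Extension

variable {A : Type u} [Bicategory.{u, u} A] {X : A ⥤ᵖ TwoCatPI.{u}}
  {Y : StrictPseudofunctor A TwoCatTwoI.{u}} (σ : X ⟶ inclObj Y)

/-- The naturality cells of `σ` are icons, so `σ` is strictly natural on objects. This gives `(Y
f)(σ v)` the ends required of the image of `f(v)`. -/
lemma natural_obj {a b : A} (f : a ⟶ b) (x : (X.obj a).carrier) :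
    (σ.app b).fn.obj ((X.map f).fn.obj x) = ((inclObj Y).map f).fn.obj ((σ.app a).fn.obj x) :=
  (σ.naturality f).hom.icon.obj_eq x

/-- The value `(Y f)(σ v)` of the extension of `σ` at the formal 1-cell `f(v)`. -/
def extGen {a : A} {x y : (X.obj a).carrier} (e : (formalCells X a).Gen x y) :
    (allCells ((inclObj Y).obj a).carrier).Gen ((σ.app a).fn.obj x) ((σ.app a).fn.obj y) :=
  (homCast ((congrArg (σ.app a).fn.obj e.src_eq).trans (natural_obj σ e.f e.x'))
    ((congrArg (σ.app a).fn.obj e.tgt_eq).trans (natural_obj σ e.f e.y'))).obj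
    (((inclObj Y).map e.f).fn.map ((σ.app e.b).fn.map e.v))

lemma of_extGen {a : A} {x y : (X.obj a).carrier} (e : (formalCells X a).Gen x y) :
    Arr.of ((allCells ((inclObj Y).obj a).carrier).ev (extGen σ e)) =
      Arr.of (((inclObj Y).map e.f).fn.map ((σ.app e.b).fn.map e.v)) :=
  Arr.of_homCast _ _ _

/-- The comparison of `σ` at the value of a formal 1-cell with `extGen`. -/
def extGenIso {a : A} {x y : (X.obj a).carrier} (e : (formalCells X a).Gen x y) :
    (σ.app a).fn.map ((formalCells X a).ev e) ≅
      (allCells ((inclObj Y).obj a).carrier).ev (extGen σ e) :=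
  Arr.toIso (eqToIso (Arr.of_map_congr _ (of_ev e)) ≪≫ natArr σ e.f e.v ≪≫
    eqToIso (of_extGen σ e).symm)

/-- The components of the extension of `σ` along the unit. -/
def extHom (a : A) : strictObj X a ⟶ (inclObj Y).obj a :=
  ⟨(fullMap (σ.app a).fn (extGen σ) (extGenIso σ)).comp (Full.proj (allCells _))⟩

lemma extHom_isTwoFunctor (a : A) : IsTwoFunctor (extHom σ a).fn :=
  (fullMap_isTwoFunctor _ _ _).comp Full.proj_isTwoFunctor

/-- The comparison of the extension of `σ` with the evaluation followed by `σ`. -/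
def extIso (a : A) : extHom σ a ≅ evalHom X a ≫ σ.app a where
  hom := ⟨fullMapIcon (σ.app a).fn (extGen σ) (extGenIso σ)⟩
  inv := ⟨fullMapIconInv (σ.app a).fn (extGen σ) (extGenIso σ)⟩
  hom_inv_id := hom₂_ext_arr fun p =>
    (Arr.ofIso (Word.mapEval (σ.app a).fn (extGen σ) (extGenIso σ) p)).inv_hom_id
  inv_hom_id := hom₂_ext_arr fun p =>
    (Arr.ofIso (Word.mapEval (σ.app a).fn (extGen σ) (extGenIso σ) p)).hom_inv_id

lemma ofCell_extGenIso {a : A} {x y : (X.obj a).carrier} (e : (formalCells X a).Gen x y) :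
    EqUpTo (Arr.ofCell (extGenIso σ e).hom) (natArr σ e.f e.v).hom :=
  EqUpTo.conj (Arr.of_map_congr _ (of_ev e)) _ (of_extGen σ e).symm

/-- The components of `extIso`. -/
def extArr (a : A) {x y : (strictObj X a).carrier} (p : x ⟶ y) :
    Arr.of ((extHom σ a).fn.map p) ≅ Arr.of ((σ.app a).fn.map (ev p)) :=
  arrIso (extIso σ a) p

lemma extArr_congr (a : A) {x y x' y' : (strictObj X a).carrier} {p : x ⟶ y} {q : x' ⟶ y'}
    (h : Arr.of p = Arr.of q) : EqUpTo (extArr σ a p).hom (extArr σ a q).hom :=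
  arr_congr (extIso σ a).hom h

lemma extArr_gen_inv {a b : A} (f : b ⟶ a) {x y : (X.obj b).carrier} (v : x ⟶ y) :
    EqUpTo (extArr σ a (gen X f v)).inv (natArr σ f v).hom := by
  have h := fullMapIconInv_arr_gen (σ.app a).fn (extGen σ) (extGenIso σ)
    (x := (X.map f).fn.obj x) (y := (X.map f).fn.obj y) ⟨f, v, rfl, rfl⟩
  refine .trans (.of_eq h) ?_
  exact (EqUpTo.conj _ _ _).trans (ofCell_extGenIso σ ⟨f, v, rfl, rfl⟩)

lemma extArr_gen {a b : A} (f : b ⟶ a) {x y : (X.obj b).carrier} (v : x ⟶ y) :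
    EqUpTo (extArr σ a (gen X f v)).hom (natArr σ f v).inv :=
  EqUpTo.inv (m := (extArr σ a (gen X f v)).symm) (extArr_gen_inv σ f v)

variable [Strict A]

/-- The extension of `σ` along the unit, as a pseudonatural transformation. -/
def extTrans : inclObj (strictification X) ⟶ inclObj Y :=
  transportTrans (evalTrans X ≫ σ) (extHom σ) (extIso σ)

lemma natArr_evalTrans_comp_aux {C : Type u₁} [Category.{v₁} C] {x y z : C} (m : x ⟶ y)
    (n : y ⟶ z) : 𝟙 x ≫ m ≫ 𝟙 y ≫ n ≫ 𝟙 z = m ≫ n := by simp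

lemma natArr_extTrans {a b : A} (f : a ⟶ b) {x y : (strictObj X a).carrier} (p : x ⟶ y) :
    (natArr (extTrans σ) f p).hom = (extArr σ b ((strictMap X f).fn.map p)).hom ≫
      (Arr.map (σ.app b).fn (evalArr X f p).hom ≫ (natArr σ f (ev p)).hom) ≫
        Arr.map ((inclObj Y).map f).fn (extArr σ a p).inv := by
  refine (transportNatArr_hom (evalTrans X ≫ σ) (extHom σ) (extIso σ) f p).trans ?_
  exact congrArg (fun k => (extArr σ b ((strictMap X f).fn.map p)).hom ≫ k ≫
    Arr.map ((inclObj Y).map f).fn (extArr σ a p).inv)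
    (natArr_evalTrans_comp_aux (Arr.map (σ.app b).fn (evalArr X f p).hom)
      (natArr σ f (ev p)).hom)

/-- At `f(v)` the cell is built from the naturality of `σ` at `f ≫ g`, at `g` and at `f`, together
with the composition constraint of `X`. Coherence of `σ` reduces it to the composition constraint of
`Y`, an identity. -/
lemma natArr_extTrans_gen {a b c : A} (f : a ⟶ b) (g : b ⟶ c) {x y : (X.obj a).carrier}
    (v : x ⟶ y) : IsEqToHom (natArr (extTrans σ) g (gen X f v)).hom := by
  refine (congrArg IsEqToHom (natArr_extTrans σ g (gen X f v))).mpr ?_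
  refine EqUpTo.isEqToHom (.comp ((extArr_congr σ c (of_strictMap_gen X f g v)).trans
    (extArr_gen σ (f ≫ g) v)) (.comp (.comp ((evalArr_gen_eqUpTo X f g v).arrMap _)
      (natArr_congr σ g (of_ev_gen X f v))) ((extArr_gen_inv σ f v).arrMap _))) ?_
  rw [Category.assoc, ← natArr_comp, Iso.inv_hom_id_assoc]
  exact isEqToHom_compArr Y f g _

lemma isEqToHom_extTrans_naturality {a b : A} (f : a ⟶ b) :
    IsEqToHom ((extTrans σ).naturality f).hom :=
  isEqToHom_of_arr fun p => strictObj_isEqToHom_arr X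
    (F := strictMap X f ≫ extHom σ b) (G := extHom σ a ≫ (inclObj Y).map f)
    ((strictMap_isTwoFunctor X f).comp (extHom_isTwoFunctor σ b))
    ((extHom_isTwoFunctor σ a).comp (Y.map f).property) _
    (fun g _ _ v => natArr_extTrans_gen σ g f v) p

/-- The comparison of `σ` with the unit followed by the extension of `σ`. -/
def unitExtIso : unitTrans X ≫ extTrans σ ≅ σ :=
  whiskerLeftIso (unitTrans X) (transportTransIso (evalTrans X ≫ σ) (extHom σ) (extIso σ)) ≪≫
    (α_ _ _ _).symm ≪≫ whiskerRightIso (evalInverse X).transComp σ ≪≫ λ_ σ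

lemma unitExt_aux {C : Type u₁} [Category.{v₁} C] {x y z : C} (m : x ⟶ y)
    (n : y ⟶ z) : m ≫ 𝟙 y ≫ n ≫ 𝟙 z = m ≫ n := by simp

lemma arr_unitExtIso (a : A) {x y : (X.obj a).carrier} (v : x ⟶ y) :
    arr ((unitExtIso σ).hom.as.app a) v = (extArr σ a ((unitHom X a).fn.map v)).hom ≫
      Arr.map (σ.app a).fn (arr (unitEvalIso X a).hom v) :=
  unitExt_aux (extArr σ a ((unitHom X a).fn.map v)).hom
    (Arr.map (σ.app a).fn (arr (unitEvalIso X a).hom v))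

/-- The extension sends `1(v)` to `(Y 1)(σ v)`, and the unit coherence of `σ` leaves only the unit
constraint of `Y`, which is an identity. -/
lemma isEqToHom_unitExtIso (a : A) : IsEqToHom ((unitExtIso σ).hom.as.app a) := by
  refine isEqToHom_of_arr fun v => ?_
  refine (congrArg IsEqToHom (arr_unitExtIso σ a v)).mpr ?_
  refine EqUpTo.isEqToHom (.comp ((extArr_congr σ a (of_unitHom X v)).trans
    (extArr_gen σ (𝟙 a) v)) ((arr_unitEvalIso X v).arrMap _)) ?_
  rw [← natArr_id, Iso.inv_hom_id_assoc]
  exact isEqToHom_idArr Y a _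

lemma unitTrans_comp_extTrans : unitTrans X ≫ extTrans σ = σ :=
  eq_of_modification (unitExtIso σ).hom (fun a => (isEqToHom_unitExtIso σ a).choose)
    (fun a => (isEqToHom_unitExtIso σ a).choose_spec)

end Extension

end TwoDim

namespace TwoDim

open TwoCatPI Generators

open scoped Pseudofunctor.StrongTrans

/-! ### Precomposition with an internal equivalence -/

section Equivalence

variable {B : Type u₁} [Bicategory.{w₁, v₁} B]

/-- Whiskering with a composite which is isomorphic to an identity. -/
lemma whiskerLeft_whiskerLeft {a b : B} {f : a ⟶ b} {g : b ⟶ a} (i : g ≫ f ≅ 𝟙 b) {c : B}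
    {h k : b ⟶ c} (α : h ⟶ k) :
    g ◁ f ◁ α = (α_ g f h).inv ≫ i.hom ▷ h ≫ (λ_ h).hom ≫ α ≫ (λ_ k).inv ≫ i.inv ▷ k ≫
      (α_ g f k).hom := by
  have h1 : i.hom ▷ h ≫ (λ_ h).hom ≫ α = (g ≫ f) ◁ α ≫ i.hom ▷ k ≫ (λ_ k).hom := by
    rw [← leftUnitor_naturality, whisker_exchange_assoc]
  rw [reassoc_of% h1]
  simp

/-- Precomposition with an internal equivalence is fully faithful. -/
lemma IsInternalEquivalence.whiskerLeft_bijective {a b : B} {f : a ⟶ b}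
    (hf : IsInternalEquivalence f) {c : B} (h k : b ⟶ c) :
    Function.Bijective (fun α : h ⟶ k => f ◁ α) := by
  obtain ⟨g, ⟨j⟩, ⟨i⟩⟩ := hf
  -- This is stated for an arbitrary pair because it is applied both to `f`, through `i`, and to its
  -- pseudoinverse, through `j`.
  have inj {a b : B} {f : a ⟶ b} {g : b ⟶ a} (i : g ≫ f ≅ 𝟙 b) {c : B} {h k : b ⟶ c}
      {α β : h ⟶ k} (e : f ◁ α = f ◁ β) : α = β := by
    have e' := congrArg (g ◁ ·) e
    simp only [whiskerLeft_whiskerLeft i] at e'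
    simpa only [cancel_epi, cancel_mono, ← Category.assoc] using e'
  -- The preimage of `Γ` is `g ◁ Γ` conjugated by `g ≫ f ≅ 𝟙`. That it maps to `Γ` is checked after
  -- whiskering with `g`, which is injective.
  refine ⟨fun α β e => inj i e, fun Γ => ⟨(λ_ h).inv ≫ i.inv ▷ h ≫ (α_ g f h).hom ≫ g ◁ Γ ≫
    (α_ g f k).inv ≫ i.hom ▷ k ≫ (λ_ k).hom, inj j ?_⟩⟩
  dsimp only
  rw [whiskerLeft_whiskerLeft i]
  simp

end Equivalence

/-! ### The universal property of the unit -/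

section UniversalProperty

lemma isEqToHom_of_cell {B : Type u₁} [Bicategory.{w₁, v₁} B] {C : Type u₂} {φ : C → B}
    {P : OneCellClass φ} {x y : LocallyFull P} {f g : x ⟶ y} {α : f ⟶ g}
    (h : IsEqToHom α.cell) : IsEqToHom α := by
  obtain ⟨e, h⟩ := h
  obtain rfl : f = g := LocallyFull.hom_ext e
  exact ⟨rfl, LocallyFull.hom₂_ext h⟩

lemma isEqToHom_as_app {A : Type u₁} [Bicategory.{w₁, v₁} A] {K : Type u₂} [Bicategory.{w₂, v₂} K] {F G : A ⥤ᵖ K} {α β : F ⟶ G}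
    {Γ : α ⟶ β} (h : IsEqToHom Γ) (a : A) : IsEqToHom (Γ.as.app a) := by
  obtain ⟨rfl, rfl⟩ := h
  exact .id _

variable {A : Type u} [Bicategory.{u, u} A] [Strict A] (X : A ⥤ᵖ TwoCatPI.{u})

/-- The strictification, as an object of `[A, 2Cat_{2,i}]`. -/
def strict : TwoFunctorCat A TwoCatTwoI.{u} := ⟨strictification X⟩

/-- The unit of the strictification. -/
def unit : X ⟶ (inclusionJ A).obj (strict X) := unitTrans X

variable {X} {Y : TwoFunctorCat A TwoCatTwoI.{u}}

/-- The extension of a pseudonatural transformation along the unit. -/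
def extend (σ : X ⟶ (inclusionJ A).obj Y) : strict X ⟶ Y where
  cell := restrictTrans (Y := strictification X) (Y' := Y.obj) (extTrans (Y := Y.obj) σ)
    (extHom_isTwoFunctor (Y := Y.obj) σ)
  property a b f := by
    obtain ⟨h, e⟩ : IsEqToHom ((restrictTrans (Y := strictification X) (Y' := Y.obj)
        (extTrans (Y := Y.obj) σ) (extHom_isTwoFunctor (Y := Y.obj) σ)).naturality f).hom :=
      isEqToHom_of_cell (isEqToHom_extTrans_naturality (Y := Y.obj) σ f)
    exact ⟨h, Iso.ext e⟩

lemma unit_comp_extend (σ : X ⟶ (inclusionJ A).obj Y) :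
    unit X ≫ (inclusionJ A).map (extend σ) = σ :=
  (congrArg (unitTrans X ≫ ·) (postcompTrans_restrictTrans (Y := strictification X) (Y' := Y.obj)
    (extTrans (Y := Y.obj) σ) (extHom_isTwoFunctor (Y := Y.obj) σ))).trans
    (unitTrans_comp_extTrans (Y := Y.obj) σ)

lemma unit_isInternalEquivalence : IsInternalEquivalence (unit X) :=
  unitTrans_isInternalEquivalence X

lemma unit_whiskerLeft_bijective (τ τ' : strict X ⟶ Y) :
    Function.Bijective (fun Γ : τ ⟶ τ' => unit X ◁ (inclusionJ A).map₂ Γ) :=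
  (unit_isInternalEquivalence.whiskerLeft_bijective _ _).comp (inclusionJ_map₂_bijective τ τ')

/-- Since `f(v)` is the image of `1(v)` under the action of `f`, the modification axiom at `f`
expresses the component at `f(v)` through the one at `1(v)`, an identity by hypothesis. The
naturality cells of `τ` and `τ'` are identities by 2-naturality. -/
lemma arr_modification_gen {τ τ' : strict X ⟶ Y} (Γ : τ ⟶ τ')
    (h : IsEqToHom (unit X ◁ (inclusionJ A).map₂ Γ)) {a b : A} (f : b ⟶ a)
    {x y : (X.obj b).carrier} (v : x ⟶ y) :
    IsEqToHom (arr (Γ.cell.as.app a).cell (gen X f v)) := by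
  have hΓ : IsEqToHom (arr (Γ.cell.as.app b).cell ((unitHom X b).fn.map v)) :=
    isEqToHom_arr (isEqToHom_as_app h b) v
  have e : Arr.of (gen X f v) = Arr.of ((strictMap X f).fn.map ((unitHom X b).fn.map v)) :=
    (of_gen_congr X (Strict.id_comp f).symm v).trans ((of_strictMap_gen X (𝟙 b) f v).symm.trans
      (Arr.of_map_congr _ (of_unitHom X v).symm))
  have n (τ : strict X ⟶ Y) : IsEqToHom (arr (τ.cell.naturality f).hom.cell
      ((unitHom X b).fn.map v)) := by
    obtain ⟨h, h'⟩ := τ.property f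
    exact isEqToHom_arr (isEqToHom_cell ⟨h, congrArg Iso.hom h'⟩) _
  refine EqUpTo.isEqToHom (arr_congr (Γ.cell.as.app a).cell e) ?_
  refine IsEqToHom.of_comp ?_ (n τ')
  have e' : strictMap X f ◁ (Γ.cell.as.app a).cell ≫ (τ'.cell.naturality f).hom.cell =
      (τ.cell.naturality f).hom.cell ≫ (Γ.cell.as.app b).cell ▷ (Y.obj.map f).cell :=
    congrArg LocallyFull.Hom₂.cell (Γ.cell.as.naturality f)
  exact (congrArg (fun α => IsEqToHom (arr α ((unitHom X b).fn.map v))) e').mpr ((n τ).comp (hΓ.arrMap (Y.obj.map f).cell.fn))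

/-- The equality of restrictions is itself a 2-cell, so it lifts to a modification `Γ : τ ⟶ τ'`.
This `Γ` is an identity at formal cells, hence everywhere, which forces the two transformations to
be equal. -/
lemma extend_unique {τ τ' : strict X ⟶ Y}
    (h : unit X ≫ (inclusionJ A).map τ = unit X ≫ (inclusionJ A).map τ') : τ = τ' := by
  obtain ⟨Γ, hΓ⟩ := (unit_whiskerLeft_bijective τ τ').2 (eqToHom h)
  have e (a : A) : IsEqToHom (Γ.cell.as.app a) :=
    isEqToHom_of_cell (isEqToHom_of_arr fun p => strictObj_isEqToHom_arr X
      (τ.cell.app a).property (τ'.cell.app a).property _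
      (fun f _ _ v => arr_modification_gen Γ ⟨h, hΓ⟩ f v) p)
  exact LocallyFull.hom_ext (eq_of_modification Γ.cell (fun a => (e a).choose)
    (fun a => (e a).choose_spec))

end UniversalProperty

end TwoDim

namespace TwoDim

/-! ### From 2-dimensional universal arrows to a 2-adjunction -/

section UniversalArrows

variable {B : Type u₁} [Bicategory.{w₁, v₁} B] {C : Type u₂} [Bicategory.{w₂, v₂} C]

/-- A choice of 2-dimensional universal arrows from the objects of `B` to a 2-functor `R`. -/
structure UniversalArrows (R : StrictPseudofunctor C B) where
  obj : B → C
  unit (b : B) : b ⟶ R.obj (obj b)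
  desc {b : B} {c : C} (f : b ⟶ R.obj c) : obj b ⟶ c
  fac {b : B} {c : C} (f : b ⟶ R.obj c) : unit b ≫ R.map (desc f) = f
  hom_ext {b : B} {c : C} {g h : obj b ⟶ c} : unit b ≫ R.map g = unit b ≫ R.map h → g = h
  bijective {b : B} {c : C} (g h : obj b ⟶ c) :
    Function.Bijective (fun α : g ⟶ h => unit b ◁ R.map₂ α)

namespace UniversalArrows

variable {R : StrictPseudofunctor C B} (U : UniversalArrows R)

lemma hom₂_ext {b : B} {c : C} {g h : U.obj b ⟶ c} {α β : g ⟶ h}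
    (e : EqUpTo (U.unit b ◁ R.map₂ α) (U.unit b ◁ R.map₂ β)) : α = β :=
  (U.bijective g h).1 e.eq

/-- The equalities of ends inside the hypothesis already identify the 1-cells, so 2-cells can be
compared after restriction along the unit with no prior matching of ends. -/
lemma eqUpTo_of_unit {b : B} {c : C} {g h g' h' : U.obj b ⟶ c} {α : g ⟶ h} {β : g' ⟶ h'}
    (e : EqUpTo (U.unit b ◁ R.map₂ α) (U.unit b ◁ R.map₂ β)) : EqUpTo α β := by
  obtain rfl : g = g' := U.hom_ext e.choose
  obtain rfl : h = h' := U.hom_ext e.choose_spec.choose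
  exact .of_eq (U.hom₂_ext e)

/-- The 2-cell induced by a 2-cell. -/
noncomputable def desc₂ {b : B} {c : C} {g h : b ⟶ R.obj c} (α : g ⟶ h) : U.desc g ⟶ U.desc h :=
  ((U.bijective (U.desc g) (U.desc h)).2 (eqToHom (U.fac g) ≫ α ≫ eqToHom (U.fac h).symm)).choose

lemma fac₂ {b : B} {c : C} {g h : b ⟶ R.obj c} (α : g ⟶ h) :
    EqUpTo (U.unit b ◁ R.map₂ (U.desc₂ α)) α :=
  ⟨U.fac g, U.fac h, ((U.bijective (U.desc g) (U.desc h)).2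
    (eqToHom (U.fac g) ≫ α ≫ eqToHom (U.fac h).symm)).choose_spec⟩

end UniversalArrows

namespace EqUpTo

lemma comp_eqToHom {D : Type u₁} [Category.{v₁} D] {x y x' y' : D}
    {m : x ⟶ y} {n : x' ⟶ y'} (h : EqUpTo m n) (hx : x = x') (hy : y = y') :
    m ≫ eqToHom hy = eqToHom hx ≫ n := by
  obtain ⟨rfl, rfl, rfl⟩ := h
  simp

section Strict

variable [Strict B]

lemma whiskerLeft {a b c : B} (f : a ⟶ b) {g h g' h' : b ⟶ c} {α : g ⟶ h} {β : g' ⟶ h'}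
    (e : EqUpTo α β) : EqUpTo (f ◁ α) (f ◁ β) := by
  obtain ⟨rfl, rfl, rfl⟩ := e
  exact .of_eq (by simp)

lemma whiskerRight {a b c : B} {g h g' h' : a ⟶ b} {α : g ⟶ h} {β : g' ⟶ h'}
    (e : EqUpTo α β) (f : b ⟶ c) : EqUpTo (α ▷ f) (β ▷ f) := by
  obtain ⟨rfl, rfl, rfl⟩ := e
  exact .of_eq (by simp)

lemma whiskerLeft_congr {a b c : B} {f f' : a ⟶ b} (e : f = f') {g h : b ⟶ c} (α : g ⟶ h) :
    EqUpTo (f ◁ α) (f' ◁ α) := by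
  subst e; exact .refl _

lemma whiskerRight_congr {a b c : B} {f f' : b ⟶ c} (e : f = f') {g h : a ⟶ b} (α : g ⟶ h) :
    EqUpTo (α ▷ f) (α ▷ f') := by
  subst e; exact .refl _

lemma id_whiskerLeft {a b : B} {g h : a ⟶ b} (α : g ⟶ h) : EqUpTo (𝟙 a ◁ α) α := by
  refine ⟨Strict.id_comp g, Strict.id_comp h, ?_⟩
  rw [Bicategory.id_whiskerLeft, Strict.leftUnitor_eqToIso, Strict.leftUnitor_eqToIso]
  rfl

lemma whiskerRight_id {a b : B} {g h : a ⟶ b} (α : g ⟶ h) : EqUpTo (α ▷ 𝟙 b) α := by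
  refine ⟨Strict.comp_id g, Strict.comp_id h, ?_⟩
  rw [Bicategory.whiskerRight_id, Strict.rightUnitor_eqToIso, Strict.rightUnitor_eqToIso]
  rfl

lemma comp_whiskerLeft {a b c d : B} (f : a ⟶ b) (f' : b ⟶ c) {g h : c ⟶ d} (α : g ⟶ h) :
    EqUpTo ((f ≫ f') ◁ α) (f ◁ f' ◁ α) := by
  refine ⟨Strict.assoc _ _ _, Strict.assoc _ _ _, ?_⟩
  rw [Bicategory.comp_whiskerLeft, Strict.associator_eqToIso, Strict.associator_eqToIso]
  rfl

lemma whiskerRight_comp {a b c d : B} {g h : a ⟶ b} (α : g ⟶ h) (f : b ⟶ c) (f' : c ⟶ d) :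
    EqUpTo (α ▷ (f ≫ f')) (α ▷ f ▷ f') := by
  refine ⟨(Strict.assoc _ _ _).symm, (Strict.assoc _ _ _).symm, ?_⟩
  rw [Bicategory.whiskerRight_comp, Strict.associator_eqToIso, Strict.associator_eqToIso]
  rfl

lemma whisker_assoc {a b c d : B} (f : a ⟶ b) {g h : b ⟶ c} (α : g ⟶ h) (k : c ⟶ d) :
    EqUpTo ((f ◁ α) ▷ k) (f ◁ α ▷ k) := by
  refine ⟨Strict.assoc _ _ _, Strict.assoc _ _ _, ?_⟩
  rw [Bicategory.whisker_assoc, Strict.associator_eqToIso, Strict.associator_eqToIso]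
  rfl

end Strict

lemma map₂_whiskerLeft (R : StrictPseudofunctor C B) {a b c : C} (f : a ⟶ b) {g h : b ⟶ c}
    (α : g ⟶ h) : EqUpTo (R.map₂ (f ◁ α)) (R.map f ◁ R.map₂ α) := by
  refine ⟨R.map_comp _ _, R.map_comp _ _, ?_⟩
  rw [R.map₂_whisker_left, R.mapComp_eq_eqToIso, R.mapComp_eq_eqToIso]
  rfl

lemma map₂_whiskerRight (R : StrictPseudofunctor C B) {a b c : C} {g h : a ⟶ b}
    (α : g ⟶ h) (f : b ⟶ c) : EqUpTo (R.map₂ (α ▷ f)) (R.map₂ α ▷ R.map f) := by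
  refine ⟨R.map_comp _ _, R.map_comp _ _, ?_⟩
  rw [R.map₂_whisker_right, R.mapComp_eq_eqToIso, R.mapComp_eq_eqToIso]
  rfl

end EqUpTo

namespace UniversalArrows

variable {R : StrictPseudofunctor C B} (U : UniversalArrows R)

/-- The action of the left 2-adjoint on 1-cells. -/
def map {a b : B} (f : a ⟶ b) : U.obj a ⟶ U.obj b := U.desc (f ≫ U.unit b)

lemma unit_map {a b : B} (f : a ⟶ b) : U.unit a ≫ R.map (U.map f) = f ≫ U.unit b := U.fac _

/-- The action of the left 2-adjoint on 2-cells. -/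
noncomputable def map₂ {a b : B} {f g : a ⟶ b} (α : f ⟶ g) : U.map f ⟶ U.map g :=
  U.desc₂ (α ▷ U.unit b)

lemma unit_map₂ {a b : B} {f g : a ⟶ b} (α : f ⟶ g) :
    EqUpTo (U.unit a ◁ R.map₂ (U.map₂ α)) (α ▷ U.unit b) := U.fac₂ _

/-- The components of the counit. -/
def counit (c : C) : U.obj (R.obj c) ⟶ c := U.desc (𝟙 (R.obj c))

lemma unit_counit (c : C) : U.unit (R.obj c) ≫ R.map (U.counit c) = 𝟙 (R.obj c) := U.fac _

variable [Strict B]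

/-- Functoriality, counit naturality and the left triangle identity are all checked after
restriction along the unit, where the factorizations compute both sides. -/
lemma map_id (a : B) : U.map (𝟙 a) = 𝟙 (U.obj a) :=
  U.hom_ext (by rw [U.unit_map, R.map_id, Strict.id_comp, Strict.comp_id])

lemma map_comp {a b c : B} (f : a ⟶ b) (g : b ⟶ c) : U.map (f ≫ g) = U.map f ≫ U.map g :=
  U.hom_ext (by
    rw [U.unit_map, R.map_comp, ← Strict.assoc (U.unit a), U.unit_map, Strict.assoc f (U.unit b),
      U.unit_map, Strict.assoc])

lemma map₂_id {a b : B} (f : a ⟶ b) : U.map₂ (𝟙 f) = 𝟙 _ :=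
  U.hom₂_ext ((U.unit_map₂ _).trans (by
    simp only [id_whiskerRight, R.map₂_id, whiskerLeft_id]
    exact .of_isEqToHom (.id _) (.id _) (U.unit_map f).symm))

lemma map₂_comp {a b : B} {f g h : a ⟶ b} (α : f ⟶ g) (β : g ⟶ h) :
    U.map₂ (α ≫ β) = U.map₂ α ≫ U.map₂ β :=
  U.hom₂_ext ((U.unit_map₂ _).trans (by
    simp only [comp_whiskerRight, R.map₂_comp, whiskerLeft_comp]
    exact (U.unit_map₂ α).symm.comp (U.unit_map₂ β).symm))

/-- Restricted along the unit, both sides become `f ◁ α ▷ U.unit c`, up to the strict equalities of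
ends. -/
lemma map₂_whiskerLeft {a b c : B} (f : a ⟶ b) {g h : b ⟶ c} (α : g ⟶ h) :
    EqUpTo (U.map₂ (f ◁ α)) (U.map f ◁ U.map₂ α) :=
  U.eqUpTo_of_unit <| (U.unit_map₂ _).trans <| (EqUpTo.whisker_assoc _ _ _).trans <|
    ((U.unit_map₂ α).symm.whiskerLeft f).trans <| (EqUpTo.comp_whiskerLeft _ _ _).symm.trans <|
    (EqUpTo.whiskerLeft_congr (U.unit_map f).symm _).trans <|
    (EqUpTo.comp_whiskerLeft _ _ _).trans <|
    ((EqUpTo.map₂_whiskerLeft R _ _).whiskerLeft _).symm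

lemma map₂_whiskerRight {a b c : B} {f g : a ⟶ b} (α : f ⟶ g) (h : b ⟶ c) :
    EqUpTo (U.map₂ (α ▷ h)) (U.map₂ α ▷ U.map h) :=
  U.eqUpTo_of_unit <| (U.unit_map₂ _).trans <| (EqUpTo.whiskerRight_comp _ _ _).symm.trans <|
    (EqUpTo.whiskerRight_congr (U.unit_map h).symm _).trans <|
    (EqUpTo.whiskerRight_comp _ _ _).trans <| ((U.unit_map₂ α).symm.whiskerRight _).trans <|
    (EqUpTo.whisker_assoc _ _ _).trans <| ((EqUpTo.map₂_whiskerRight R _ _).whiskerLeft _).symm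

lemma map_unit_counit (b : B) : U.map (U.unit b) ≫ U.counit (U.obj b) = 𝟙 (U.obj b) :=
  U.hom_ext (by
    rw [R.map_comp, ← Strict.assoc, U.unit_map, Strict.assoc, U.unit_counit, R.map_id])

variable [Strict C]

/-- The left 2-adjoint determined by universal arrows. -/
noncomputable def left : StrictPseudofunctor B C :=
  StrictPseudofunctor.mk''
    { obj := U.obj
      map := U.map
      map₂ := U.map₂
      map₂_id := U.map₂_id
      map₂_comp := U.map₂_comp
      map_id := U.map_id
      map_comp := U.map_comp
      map₂_whisker_left f _ _ α := (U.map₂_whiskerLeft f α).choose_spec.choose_spec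
      map₂_whisker_right α f := (U.map₂_whiskerRight α f).choose_spec.choose_spec }

lemma counit_naturality {c c' : C} (f : c ⟶ c') :
    U.map (R.map f) ≫ U.counit c' = U.counit c ≫ f :=
  U.hom_ext (by
    rw [R.map_comp, R.map_comp, ← Strict.assoc, ← Strict.assoc, U.unit_map, U.unit_counit,
      Strict.assoc, U.unit_counit, Strict.comp_id, Strict.id_comp])

lemma counit_naturality₂ {c c' : C} {f g : c ⟶ c'} (α : f ⟶ g) :
    EqUpTo (U.map₂ (R.map₂ α) ▷ U.counit c') (U.counit c ◁ α) :=
  U.eqUpTo_of_unit <| ((EqUpTo.map₂_whiskerRight R _ _).whiskerLeft _).trans <|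
    (EqUpTo.whisker_assoc _ _ _).symm.trans <| ((U.unit_map₂ _).whiskerRight _).trans <|
    (EqUpTo.whiskerRight_comp _ _ _).symm.trans <|
    (EqUpTo.whiskerRight_congr (U.unit_counit c') _).trans <|
    (EqUpTo.whiskerRight_id _).trans <| (EqUpTo.id_whiskerLeft _).symm.trans <|
    (EqUpTo.whiskerLeft_congr (U.unit_counit c).symm _).trans <|
    (EqUpTo.comp_whiskerLeft _ _ _).trans <|
    ((EqUpTo.map₂_whiskerLeft R _ _).whiskerLeft _).symm

/-- The 2-adjunction determined by universal arrows. -/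
noncomputable def adjunction : TwoAdjunction U.left R where
  unit :=
    { app := U.unit
      naturality f := (U.unit_map f).symm
      naturality₂ α := (U.unit_map₂ α).symm.comp_eqToHom _ _ }
  counit :=
    { app := U.counit
      naturality f := U.counit_naturality f
      naturality₂ α := (U.counit_naturality₂ α).comp_eqToHom _ _ }
  left_triangle b := U.map_unit_counit b
  right_triangle c := U.unit_counit c

end UniversalArrows

end UniversalArrows

section Equivalence

variable {B : Type u₁} [Bicategory.{w₁, v₁} B]

/-- If `f` is an equivalence and `f ≫ g = 𝟙`, then `g` is an equivalence. -/
lemma IsInternalEquivalence.of_comp_eq_id {a b : B} {f : a ⟶ b} {g : b ⟶ a}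
    (hf : IsInternalEquivalence f) (h : f ≫ g = 𝟙 a) : IsInternalEquivalence g := by
  obtain ⟨f', ⟨i⟩, ⟨j⟩⟩ := hf
  refine ⟨f, ⟨?_⟩, ⟨eqToIso h⟩⟩
  -- A one-sided inverse of an equivalence is isomorphic to its pseudoinverse: `g ≅ (f' ≫ f) ≫ g ≅
  -- f' ≫ (f ≫ g) ≅ f'`.
  have k : g ≅ f' := (λ_ g).symm ≪≫ whiskerRightIso j.symm g ≪≫ α_ _ _ _ ≪≫
    whiskerLeftIso f' (eqToIso h) ≪≫ ρ_ f'
  exact whiskerRightIso k f ≪≫ j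

end Equivalence

open scoped Pseudofunctor.StrongTrans in
/-- The universal arrows given by the strictification. -/
def universalArrows (A : Type u) [Bicategory.{u, u} A] [Strict A] :
    UniversalArrows (inclusionJ A) where
  obj := strict
  unit X := unit X
  desc σ := extend σ
  fac σ := unit_comp_extend σ
  hom_ext h := extend_unique h
  bijective τ τ' := unit_whiskerLeft_bijective τ τ'

end TwoDim

theorem theorem4p14 (A : Type u) [Bicategory.{u, u} A] [Strict A] :
    ∃ (Q : StrictPseudofunctor (A ⥤ᵖ TwoCatPI.{u}) (TwoFunctorCat A TwoCatTwoI.{u}))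
      (adj : TwoAdjunction Q (inclusionJ A)),
      (∀ X : A ⥤ᵖ TwoCatPI.{u}, IsInternalEquivalence (adj.unit.app X)) ∧
      (∀ Y : TwoFunctorCat A TwoCatTwoI.{u},
        IsInternalEquivalence ((inclusionJ A).map (adj.counit.app Y))) :=
  ⟨(universalArrows A).left, (universalArrows A).adjunction,
    fun _ => unit_isInternalEquivalence, fun Y =>
      -- By the triangle identity, the image of the counit is a strict one-sided inverse of the unit
      -- at `JY`, which is an equivalence.
      unit_isInternalEquivalence.of_comp_eq_id ((universalArrows A).unit_counit Y)⟩
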